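/- Let $\mathcal H$ be a complex Hilbert space and let $\pi$ be a strongly continuous unitary representation of $\mathrm U(1)$ on $\mathcal H$. Let $X$ be its charge operator, i.e. the selfadjoint operator with $\pi(e^{i\alpha})=\exp(i\alpha X)$ for $\alpha\in\mathbb R$; its spectrum is pure point and contained in $\mathbb Z$. For $\mu\in\mathbb Z$ let $\mathcal H^{(\mu)}=\ker(X-\mu)$ (possibly zero), let $X^{(\mu)}$ be the orthogonal projection onto $\mathcal H^{(\mu)}$, and write $\psi^{(\mu)}=X^{(\mu)}\psi$. Assume that every $\mathcal H^{(\mu)}$ is finite-dimensional. Put $$D_X=\{\psi\in\mathcal H : X^{(\mu)}\psi=0 \text{ for all but finitely many } \mu\}.$$ A (possibly unbounded) selfadjoint operator $H$ is said to commute with $X$ if its spectral projections commute with all $X^{(\mu)}$. Let $\mathfrak u(X)=\{iH : H=H^*\text{ commuting with }X\}$. For $Q\in\mathfrak u(X)$ let $t\mapsto\exp(tQ)$ denote the strongly continuous one-parameter unitary group with generator $Q$. All topological notions for sets of unitaries refer to the strong operator topology on the unitary group $\mathcal U(\mathcal H)$. Then: 1. Every selfadjoint $H$ commuting with $X$ has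 $D_X$ as an invariant domain of essential selfadjointness: $D_X\subset D(H)$, $HD_X\subset D_X$, and $H$ is the closure of its restriction to $D_X$. The set $\mathfrak u(X)$ is a real Lie algebra, where $\lambda Q_1+Q_2$ and $[Q_1,Q_2]$ are the elements of $\mathfrak u(X)$ given on $\psi\in D_X$ by $\lambda Q_1\psi+Q_2\psi$ and $Q_1Q_2\psi-Q_2Q_1\psi$. Moreover, for every $iH\in\mathfrak u(X)$ there are selfadjoint operators $H^{(\mu)}\in\mathcal B(\mathcal H^{(\mu)})$ with $H\psi=\sum_\mu H^{(\mu)}\psi^{(\mu)}$ for $\psi\in D_X$, and every family $(H^{(\mu)})_{\mu\in\mathbb Z}$ of selfadjoint operators arises in this way from exactly one $iH\in\mathfrak u(X)$. 2. The exponential map is well defined on $\mathfrak u(X)$ (each $Q\in\mathfrak u(X)$ generates exactly one strongly continuous one-parameter unitary group), and $\exp(iH)\psi=\sum_\mu\exp(iH^{(\mu)})\psi^{(\mu)}$ for all $\psi\in\mathcal H$. It maps $\mathfrak u(X)$ onto the subgroup $$\mathcal U(X)=\{U\in\mathcal U(\mathcal H) : [U,\pi(z)]=0\text{ for all }z\in\mathrm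 U(1)\},$$ which is strongly closed in $\mathcal U(\mathcal H)$. For every $U\in\mathcal U(X)$ there are unitaries $U^{(\mu)}$ on $\mathcal H^{(\mu)}$ with $U\psi=\sum_\mu U^{(\mu)}\psi^{(\mu)}$ for all $\psi\in\mathcal H$, and every family $(U^{(\mu)})_{\mu\in\mathbb Z}$ of such unitaries arises in this way from exactly one $U\in\mathcal U(X)$. 3. Let $iH_1,\dots,iH_d\in\mathfrak u(X)$, let $\mathfrak l\subset\mathfrak u(X)$ be the Lie subalgebra generated by them, and let the dynamical group $\mathcal G$ be the smallest strongly closed subgroup of $\mathcal U(\mathcal H)$ that contains $\exp(itH_k)$ for all $k\in\{1,\dots,d\}$ and $t\in\mathbb R$. Then $\exp(\mathfrak l)\subset\mathcal G$, and the strong closure of $\exp(\mathfrak l)$ in $\mathcal U(\mathcal H)$ is $\mathcal G$. -/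

import Mathlib

open MeasureTheory Topology
open scoped ENNReal InnerProductSpace

noncomputable section

namespace ChargeControl

variable {𝓗 : Type*} [NormedAddCommGroup 𝓗] [InnerProductSpace ℂ 𝓗] [CompleteSpace 𝓗]

/-! ### Unitaries and the strong operator topology -/

/-- The exponential series of a bounded operator on a Hilbert space. -/
def boundedExp {K : Type*} [NormedAddCommGroup K] [InnerProductSpace ℂ K] (h : K →L[ℂ] K) :
    K →L[ℂ] K := NormedSpace.exp h

/-- The strong operator topology on the group of unitaries: the topology of pointwise
convergence on vectors, restricted from bounded operators to unitaries. -/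
@[reducible] def strongTopology (𝓗 : Type*) [NormedAddCommGroup 𝓗] [InnerProductSpace ℂ 𝓗]
    [CompleteSpace 𝓗] : TopologicalSpace (unitary (𝓗 →L[ℂ] 𝓗)) :=
  TopologicalSpace.induced
    (fun U => ContinuousLinearMap.toPointwiseConvergenceCLM ℂ (RingHom.id ℂ) 𝓗 𝓗
      (U : 𝓗 →L[ℂ] 𝓗))
    inferInstance

/-! ### Generators and exponentials -/

/-- The infinitesimal generator of a family `V : ℝ → unitaries`: its domain consists of the `ψ`
for which `t ↦ V t ψ` is differentiable at `0`, and it maps `ψ` to that derivative. -/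
def generator (V : ℝ → unitary (𝓗 →L[ℂ] 𝓗)) : 𝓗 →ₗ.[ℂ] 𝓗 where
  domain :=
    { carrier := {ψ | DifferentiableAt ℝ (fun t : ℝ => (V t : 𝓗 →L[ℂ] 𝓗) ψ) 0}
      add_mem' := fun {a b} ha hb => by
        simp only [Set.mem_ofPred_eq, map_add] at ha hb ⊢
        exact ha.add hb
      zero_mem' := by simp
      smul_mem' := fun c a ha => by
        simp only [Set.mem_ofPred_eq, map_smul] at ha ⊢
        exact ha.const_smul c }
  toFun :=
    { toFun := fun ψ => deriv (fun t : ℝ => (V t : 𝓗 →L[ℂ] 𝓗) (ψ : 𝓗)) 0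
      map_add' := fun a b => by
        simp only [Submodule.coe_add, map_add]
        exact deriv_add a.2 b.2
      map_smul' := fun c a => by
        simp only [Submodule.coe_smul, map_smul, RingHom.id_apply]
        exact deriv_const_smul c a.2 }

/-- Strongly continuous one-parameter groups of unitaries. -/
structure IsUnitaryGroup (V : ℝ → unitary (𝓗 →L[ℂ] 𝓗)) : Prop where
  map_zero : V 0 = 1
  map_add : ∀ s t, V (s + t) = V s * V t
  continuous : ∀ ψ : 𝓗, Continuous fun t => (V t : 𝓗 →L[ℂ] 𝓗) ψ

open Classical in
/-- `expGroup A t` is `exp (t A)` for an anti-selfadjoint operator `A`: the one-parameter unitary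
group with generator `A` (the default value `1` is used if there is no such group). -/
def expGroup (A : 𝓗 →ₗ.[ℂ] 𝓗) : ℝ → unitary (𝓗 →L[ℂ] 𝓗) :=
  if h : ∃ V : ℝ → unitary (𝓗 →L[ℂ] 𝓗), IsUnitaryGroup V ∧ generator V = A then h.choose else 1

/-- The exponential `exp A` of an anti-selfadjoint operator `A`. -/
def expOp (A : 𝓗 →ₗ.[ℂ] 𝓗) : unitary (𝓗 →L[ℂ] 𝓗) := expGroup A 1

/-- The dynamical group of the control problem with generators `A k = i H k`: the smallest strongly
closed group of unitaries that contains all `exp (t A k)`. -/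
def dynamicalGroup {ι : Type*} (A : ι → 𝓗 →ₗ.[ℂ] 𝓗) : Subgroup (unitary (𝓗 →L[ℂ] 𝓗)) :=
  sInf {G | IsClosed[strongTopology 𝓗] (G : Set (unitary (𝓗 →L[ℂ] 𝓗))) ∧
    ∀ k t, expGroup (A k) t ∈ G}

/-! ### Spectral measures -/

variable (𝓗) in
/-- Projection-valued measures on the Borel sets of `ℝ` (the values on other sets are
irrelevant). -/
structure SpectralMeasure where
  proj : Set ℝ → 𝓗 →L[ℂ] 𝓗
  isStarProjection : ∀ B, MeasurableSet B → IsStarProjection (proj B)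
  proj_empty : proj ∅ = 0
  proj_univ : proj Set.univ = 1
  proj_inter : ∀ B C, MeasurableSet B → MeasurableSet C → proj (B ∩ C) = proj B * proj C
  hasSum_iUnion : ∀ B : ℕ → Set ℝ, (∀ n, MeasurableSet (B n)) →
    Pairwise (Function.onFun Disjoint B) →
      ∀ ψ, HasSum (fun n => proj (B n) ψ) (proj (⋃ n, B n) ψ)

namespace SpectralMeasure

theorem normSq_eq (E : SpectralMeasure 𝓗) (ψ : 𝓗) {B : Set ℝ} (hB : MeasurableSet B) :
    ‖E.proj B ψ‖ ^ 2 = (⟪ψ, E.proj B ψ⟫_ℂ).re := by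
  have h := E.isStarProjection B hB
  have h1 : E.proj B (E.proj B ψ) = E.proj B ψ := by
    have := h.isIdempotentElem
    exact congrArg (fun T : 𝓗 →L[ℂ] 𝓗 => T ψ) this
  have h2 : ⟪E.proj B ψ, E.proj B ψ⟫_ℂ = ⟪ψ, E.proj B (E.proj B ψ)⟫_ℂ := by
    have := (ContinuousLinearMap.isSelfAdjoint_iff_isSymmetric.mp h.isSelfAdjoint)
    exact this ψ (E.proj B ψ)
  rw [h1] at h2
  rw [← h2, ← inner_self_eq_norm_sq (𝕜 := ℂ)]
  rfl

/-- The finite Borel measure `B ↦ ⟪ψ, E(B) ψ⟫ = ‖E(B) ψ‖²`. -/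
def scalarMeasure (E : SpectralMeasure 𝓗) (ψ : 𝓗) : Measure ℝ :=
  Measure.ofMeasurable (fun B _ => ENNReal.ofReal (‖E.proj B ψ‖ ^ 2))
    (by simp [E.proj_empty])
    (by
      intro B hB hd
      have hs : HasSum (fun n => ‖E.proj (B n) ψ‖ ^ 2) (‖E.proj (⋃ n, B n) ψ‖ ^ 2) := by
        have h := (Complex.reCLM.hasSum
          ((innerSL ℂ ψ).hasSum (E.hasSum_iUnion B hB hd ψ)))
        rw [E.normSq_eq ψ (MeasurableSet.iUnion hB)]
        simp only [fun n => E.normSq_eq ψ (hB n)]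
        exact h
      rw [← hs.tsum_eq, ENNReal.ofReal_tsum_of_nonneg (fun n => by positivity) hs.summable])

/-- `E` is the spectral measure of `T`, that is `T = ∫ x dE(x)` with domain
`{ψ | ∫ x² d⟪ψ, E(x) ψ⟫ < ∞}`. The quadratic form determines the values of `T` by
polarization. -/
def IsSpectralMeasureOf (E : SpectralMeasure 𝓗) (T : 𝓗 →ₗ.[ℂ] 𝓗) : Prop :=
  (∀ ψ, ψ ∈ T.domain ↔ ∫⁻ x, ENNReal.ofReal (x ^ 2) ∂(E.scalarMeasure ψ) < ∞) ∧
    ∀ ψ : T.domain, ⟪(ψ : 𝓗), T ψ⟫_ℂ = ((∫ x, x ∂(E.scalarMeasure (ψ : 𝓗)) : ℝ) : ℂ)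

end SpectralMeasure

/-! ### The charge operator and the operators commuting with it -/

/-- The charge operator `X` of a representation `π` of `U(1)`, i.e. the operator with
`π (e^{iα}) = exp (i α X)`. -/
def chargeOperator (π : Circle →* unitary (𝓗 →L[ℂ] 𝓗)) : 𝓗 →ₗ.[ℂ] 𝓗 :=
  (-Complex.I) • generator fun α : ℝ => π (Circle.exp α)

/-- The eigenspace of `X` for `μ ∈ ℤ`; it is zero if `μ` is not an eigenvalue. -/
def chargeSpace (π : Circle →* unitary (𝓗 →L[ℂ] 𝓗)) (μ : ℤ) : Submodule ℂ 𝓗 where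
  carrier := {ψ | ∃ h : ψ ∈ (chargeOperator π).domain, chargeOperator π ⟨ψ, h⟩ = (μ : ℂ) • ψ}
  add_mem' := by
    rintro a b ⟨ha, ha'⟩ ⟨hb, hb'⟩
    refine ⟨add_mem ha hb, ?_⟩
    have := (chargeOperator π).map_add ⟨a, ha⟩ ⟨b, hb⟩
    rw [ha', hb', ← smul_add] at this
    exact this
  zero_mem' := ⟨zero_mem _, by
    have := (chargeOperator π).map_zero
    rw [smul_zero]
    exact this⟩
  smul_mem' := by
    rintro c a ⟨ha, ha'⟩
    refine ⟨Submodule.smul_mem _ c ha, ?_⟩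
    have := (chargeOperator π).map_smul c ⟨a, ha⟩
    rw [ha', smul_comm] at this
    exact this

variable (π : Circle →* unitary (𝓗 →L[ℂ] 𝓗)) [∀ μ : ℤ, FiniteDimensional ℂ (chargeSpace π μ)]

/-- The component `ψ^(μ) = X^(μ) ψ` of `ψ` in the eigenspace, as an element of that eigenspace. -/
def component (μ : ℤ) : 𝓗 →L[ℂ] chargeSpace π μ := (chargeSpace π μ).orthogonalProjectionOnto

/-- The eigenprojection `X^(μ)` as an operator on the whole space. -/
def chargeProj (μ : ℤ) : 𝓗 →L[ℂ] 𝓗 := (chargeSpace π μ).starProjection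

/-- The space `D_X` of finite particle vectors. -/
def finiteParticle : Submodule ℂ 𝓗 where
  carrier := {ψ | {μ : ℤ | chargeProj π μ ψ ≠ 0}.Finite}
  add_mem' := fun {a b} ha hb => (ha.union hb).subset fun μ hμ => by
    by_contra hc
    simp only [Set.mem_union, Set.mem_ofPred_eq, not_or, not_not] at hc
    exact hμ (by rw [map_add, hc.1, hc.2, add_zero])
  zero_mem' := by simp
  smul_mem' := fun c a ha => ha.subset fun μ hμ hc => hμ (by rw [map_smul, hc, smul_zero])

/-- `T` commutes with `X`: the spectral projections of `T` commute with the
eigenprojections of `X`. -/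
def CommutesWithCharge (T : 𝓗 →ₗ.[ℂ] 𝓗) : Prop :=
  ∃ E : SpectralMeasure 𝓗, E.IsSpectralMeasureOf T ∧
    ∀ B, MeasurableSet B → ∀ μ : ℤ, Commute (E.proj B) (chargeProj π μ)

/-- `𝔲(X)`, the set of all `i T` with `T` selfadjoint and commuting with `X`. -/
def chargeAlgebra : Set (𝓗 →ₗ.[ℂ] 𝓗) :=
  {A | ∃ T : 𝓗 →ₗ.[ℂ] 𝓗, IsSelfAdjoint T ∧ CommutesWithCharge π T ∧ A = Complex.I • T}

/-- `𝒰(X)`, the group of all unitaries commuting with all `π z`. -/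
def chargeGroup : Subgroup (unitary (𝓗 →L[ℂ] 𝓗)) := Subgroup.centralizer (Set.range π)

end ChargeControl

end

open ChargeControl

set_option linter.unusedSectionVars false

/-! Block decomposition. Fourier coefficients of an orbit map z ↦ π(z)φ are charge eigenvectors. If
φ is orthogonal to all eigenspaces, the matrix coefficient ⟪φ, π(z)φ⟫ has vanishing Fourier
coefficients, so it vanishes at z = 1 and φ = 0. Hence 𝓗 is the Hilbert sum of the
finite-dimensional charge spaces (`chargeSpace_isHilbertSum`).

Operators. If the spectral projections of T commute with the charge projections, they preserve every
block. The vectors E([n, n+1))ψ for ψ in a block are mutually orthogonal inside a finite-dimensional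
space, so almost all of them vanish and ψ lies in the domain of T; polarization then shows that T
preserves the block (`SpectralMeasure.IsSpectralMeasureOf.exists_hasBlocks`). Diagonalizing the
blocks gives a Hilbert basis of eigenvectors, and a selfadjoint T with such a basis is a `diagOp`,
whose core, spectral measure and unitary group are computed coordinatewise. So 𝔲(X) is the product
of the skew-adjoint operators of the blocks (`chargeEquiv`), 𝒰(X) is the product of their unitary
groups (`range_blockUnitary`), and exp acts block by block. It is onto because a unitary on a
finite-dimensional space has a logarithm.

Dynamical group. `blockUnitary` is continuous from the product topology to the strong one and sends
closed sets to strongly closed sets, so the question concerns products of finite-dimensional unitary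
groups. A closed subgroup has a Lie algebra (`lieAlgebraOf`): the product formula gives sums and
differentiating conjugations gives brackets. Hence exp(𝔩) lies in the dynamical group. For the
reverse inclusion the closure of exp(𝔩) must be a group, that is, exp A exp B must be a limit of
exponentials. Only finitely many coordinates matter at a time, so 𝔩 may be taken inside one
finite-dimensional algebra with a trace (`IsSkewLie.exp_mul_exp_mem_closure`).

There the curve exp A exp(tB) is followed. At exp A write B = B₀ + (Y - exp(-A) Y exp A) with B₀
commuting with exp A (`IsSkewLie.exists_split`). To first order the second summand is a conjugation,
which 𝔩 absorbs. A is replaced by a logarithm of exp A that commutes with B₀ itself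
(`IsSkewLie.exists_commute_exp_eq`), and then exponents add. The logarithms grow at most linearly in
t, so compactness carries the construction to t = 1 with an arbitrarily small error. -/

namespace ChargeControl

/-! ### Exponentials and the adjoint action in real Banach algebras -/

section BanachAlgebra

variable {𝒜 : Type*} [NormedRing 𝒜] [NormedAlgebra ℝ 𝒜] [CompleteSpace 𝒜]

theorem continuous_exp : Continuous (NormedSpace.exp : 𝒜 → 𝒜) :=
  letI := NormedAlgebra.restrictScalars ℚ ℝ 𝒜
  NormedSpace.exp_continuous

theorem exp_add_of_commute {a b : 𝒜} (h : Commute a b) :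
    NormedSpace.exp (a + b) = NormedSpace.exp a * NormedSpace.exp b :=
  letI := NormedAlgebra.restrictScalars ℚ ℝ 𝒜
  NormedSpace.exp_add_of_commute h

theorem exp_mul_exp_neg (a : 𝒜) : NormedSpace.exp a * NormedSpace.exp (-a) = 1 := by
  rw [← exp_add_of_commute (Commute.refl a).neg_right, add_neg_cancel, NormedSpace.exp_zero]

theorem exp_neg_mul_exp (a : 𝒜) : NormedSpace.exp (-a) * NormedSpace.exp a = 1 := by
  simpa using exp_mul_exp_neg (-a)

theorem exp_conj_exp (a b : 𝒜) :
    NormedSpace.exp (NormedSpace.exp b * a * NormedSpace.exp (-b)) =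
      NormedSpace.exp b * NormedSpace.exp a * NormedSpace.exp (-b) :=
  letI := NormedAlgebra.restrictScalars ℚ ℝ 𝒜
  NormedSpace.exp_units_conj ⟨NormedSpace.exp b, NormedSpace.exp (-b), exp_mul_exp_neg b,
    exp_neg_mul_exp b⟩ a

/-- The adjoint action of an exponential is the exponential of the commutator map. -/
theorem exp_commutator_apply (a b : 𝒜) :
    NormedSpace.exp (ContinuousLinearMap.mul ℝ 𝒜 b - (ContinuousLinearMap.mul ℝ 𝒜).flip b) a =
      NormedSpace.exp b * a * NormedSpace.exp (-b) := by
  set D : 𝒜 →L[ℝ] 𝒜 := ContinuousLinearMap.mul ℝ 𝒜 b - (ContinuousLinearMap.mul ℝ 𝒜).flip b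
    with hD
  -- Undoing the conjugation: since `D` is the commutator with b, the three terms of the derivative
  -- cancel and this curve is constant.
  let c : ℝ → 𝒜 := fun t =>
    NormedSpace.exp (t • (-b)) * NormedSpace.exp (t • D) a * NormedSpace.exp (t • b)
  have hc : ∀ t, HasDerivAt c 0 t := by
    intro t
    have h1 := hasDerivAt_exp_smul_const (-b) t
    have h2 := (hasDerivAt_exp_smul_const' D t).clm_apply (hasDerivAt_const t a)
    have h3 := hasDerivAt_exp_smul_const' b t
    refine ((h1.mul h2).mul h3).congr_deriv ?_
    have hDx : (D * NormedSpace.exp (t • D)) a =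
        b * NormedSpace.exp (t • D) a - NormedSpace.exp (t • D) a * b := rfl
    rw [hDx, map_zero, add_zero, Pi.mul_apply]
    noncomm_ring
  have h01 : c 1 = c 0 := is_const_of_deriv_eq_zero (fun t => (hc t).differentiableAt)
    (fun t => (hc t).deriv) 1 0
  simp only [c, one_smul, zero_smul ℝ, NormedSpace.exp_zero, one_mul, mul_one] at h01
  have h0 : (0 : ℝ) • D = 0 := by ext; simp
  rw [h0, NormedSpace.exp_zero, one_apply_eq_self] at h01
  calc NormedSpace.exp D a
      = (NormedSpace.exp b * NormedSpace.exp (-b)) * NormedSpace.exp D a *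
          (NormedSpace.exp b * NormedSpace.exp (-b)) := by simp [exp_mul_exp_neg]
    _ = NormedSpace.exp b * (NormedSpace.exp (-b) * NormedSpace.exp D a * NormedSpace.exp b) *
          NormedSpace.exp (-b) := by noncomm_ring
    _ = _ := by rw [h01]

/-- The conjugate is the exponential series of the commutator map applied to a; its terms are
multiples of iterated brackets, and 𝔩 is closed. -/
theorem conj_exp_mem {𝔩 : Submodule ℝ 𝒜} (hcl : IsClosed (𝔩 : Set 𝒜))
    (hbr : ∀ a ∈ 𝔩, ∀ b ∈ 𝔩, a * b - b * a ∈ 𝔩) {a b : 𝒜} (ha : a ∈ 𝔩) (hb : b ∈ 𝔩) :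
    NormedSpace.exp b * a * NormedSpace.exp (-b) ∈ 𝔩 := by
  rw [← exp_commutator_apply]
  set D : 𝒜 →L[ℝ] 𝒜 := ContinuousLinearMap.mul ℝ 𝒜 b - (ContinuousLinearMap.mul ℝ 𝒜).flip b
    with hD
  have hmem : ∀ n : ℕ, (D ^ n) a ∈ 𝔩 := by
    intro n
    induction n with
    | zero => simpa
    | succ n ih =>
      rw [pow_succ', mul_apply_eq_comp]
      exact hbr b hb _ ih
  have hs := (NormedSpace.exp_series_hasSum_exp' (𝕂 := ℝ) D).mapL (ContinuousLinearMap.apply ℝ 𝒜 a)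
  refine hcl.mem_of_tendsto hs (Filter.Eventually.of_forall fun s => ?_)
  refine 𝔩.sum_mem fun n _ => ?_
  simpa using 𝔩.smul_mem _ (hmem n)

theorem hasDerivAt_conj_exp (a b : 𝒜) :
    HasDerivAt (fun t : ℝ => NormedSpace.exp (t • b) * a * NormedSpace.exp (-(t • b)))
      (b * a - a * b) 0 := by
  have h1 := hasDerivAt_exp_smul_const b (0 : ℝ)
  have h2 := hasDerivAt_exp_smul_const (-b) (0 : ℝ)
  simp only [← smul_neg]
  refine ((h1.mul_const a).mul h2).congr_deriv ?_
  simp [sub_eq_add_neg]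

end BanachAlgebra

/-! ### Density of the exponentials of a skew-adjoint Lie algebra in finite dimension -/

section CStar

variable {𝒜 : Type*} [NormedRing 𝒜] [NormedAlgebra ℝ 𝒜] [CompleteSpace 𝒜] [StarRing 𝒜]
  [CStarRing 𝒜]

theorem exp_mem_unitary {a : 𝒜} (ha : star a = -a) : NormedSpace.exp a ∈ unitary 𝒜 :=
  letI := NormedAlgebra.restrictScalars ℚ ℝ 𝒜
  NormedSpace.exp_mem_unitary_of_mem_skewAdjoint ha

theorem norm_conj_exp {b : 𝒜} (hb : star b = -b) (a : 𝒜) :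
    ‖NormedSpace.exp b * a * NormedSpace.exp (-b)‖ = ‖a‖ := by
  have h1 := CStarRing.norm_coe_unitary_mul ⟨_, exp_mem_unitary hb⟩ a
  have h2 := CStarRing.norm_mul_coe_unitary (NormedSpace.exp b * a)
    ⟨_, exp_mem_unitary (a := -b) (by simp [hb])⟩
  exact h2.trans h1

/-- A real Lie algebra of skew-adjoint elements. -/
structure IsSkewLie (𝔩 : Submodule ℝ 𝒜) : Prop where
  skew : ∀ a ∈ 𝔩, star a = -a
  bracket_mem : ∀ a ∈ 𝔩, ∀ b ∈ 𝔩, a * b - b * a ∈ 𝔩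

/-- A trace that dominates the square of the norm. -/
structure IsDominatingTrace (τ : 𝒜 →ₗ[ℝ] ℝ) : Prop where
  comm : ∀ a b, τ (a * b) = τ (b * a)
  le : ∀ a, ‖a‖ ^ 2 ≤ τ (star a * a)

variable [FiniteDimensional ℝ 𝒜] {τ : 𝒜 →ₗ[ℝ] ℝ} {𝔩 : Submodule ℝ 𝒜}

/-- If `exp A` commutes with `B` then `A` can be replaced by an element with the same exponential
that itself commutes with `B`. -/
theorem IsSkewLie.exists_commute_exp_eq (h𝔩 : IsSkewLie 𝔩) (hτ : IsDominatingTrace τ)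
    {A B : 𝒜} (hA : A ∈ 𝔩) (hB : B ∈ 𝔩) (hAB : Commute (NormedSpace.exp A) B) :
    ∃ A' ∈ 𝔩, NormedSpace.exp A' = NormedSpace.exp A ∧ ‖A'‖ ≤ ‖A‖ ∧ Commute A' B := by
  have hcl : IsClosed (𝔩 : Set 𝒜) := 𝔩.closed_of_finiteDimensional
  have hτc : Continuous τ := τ.continuous_of_finiteDimensional
  have : ProperSpace 𝒜 := FiniteDimensional.proper ℝ 𝒜
  -- The logarithms of exp A in 𝔩 that are no longer than A form a compact set; the desired one
  -- maximizes the trace pairing with B.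
  let S : Set 𝒜 := {A' | A' ∈ 𝔩 ∧ NormedSpace.exp A' = NormedSpace.exp A} ∩
    Metric.closedBall 0 ‖A‖
  have hS : IsCompact S := (isCompact_closedBall (0 : 𝒜) ‖A‖).inter_left
    (hcl.inter (isClosed_eq continuous_exp continuous_const))
  obtain ⟨A', ⟨⟨hA'1, hA'2⟩, hA'3⟩, hmax⟩ := hS.exists_isMaxOn
    ⟨A, ⟨hA, rfl⟩, by simp⟩ (f := fun x => -τ (x * B)) (by fun_prop)
  refine ⟨A', hA'1, hA'2, by simpa using hA'3, ?_⟩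
  -- Both A' and B commute with exp A, hence so does Z; conjugating A' by exp(tZ) therefore never
  -- leaves `S`.
  set Z := A' * B - B * A' with hZ
  have hZ𝔩 : Z ∈ 𝔩 := h𝔩.bracket_mem _ hA'1 _ hB
  have hZs := h𝔩.skew _ hZ𝔩
  have hZg : Commute Z (NormedSpace.exp A) := by
    have h1 : Commute A' (NormedSpace.exp A) := by
      rw [← hA'2]; exact (Commute.refl A').exp_right
    exact (h1.mul_left hAB.symm).sub_left (hAB.symm.mul_left h1)
  have hcurve : ∀ t : ℝ, NormedSpace.exp (t • Z) * A' * NormedSpace.exp (-(t • Z)) ∈ S := by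
    intro t
    have htZ : t • Z ∈ 𝔩 := 𝔩.smul_mem t hZ𝔩
    refine ⟨⟨conj_exp_mem hcl h𝔩.bracket_mem hA'1 htZ, ?_⟩, ?_⟩
    · have hc : Commute (NormedSpace.exp (t • Z)) (NormedSpace.exp A) :=
        (hZg.smul_left t).exp_left
      rw [exp_conj_exp, hA'2, hc.eq, mul_assoc, exp_mul_exp_neg, mul_one]
    · rw [mem_closedBall_zero_iff, norm_conj_exp (h𝔩.skew _ htZ)]
      simpa using hA'3
  have hloc : IsLocalMax
      (fun t : ℝ => -τ (NormedSpace.exp (t • Z) * A' * NormedSpace.exp (-(t • Z)) * B)) 0 := by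
    refine Filter.Eventually.of_forall fun t => ?_
    simpa using hmax (hcurve t)
  have hder : HasDerivAt
      (fun t : ℝ => -τ (NormedSpace.exp (t • Z) * A' * NormedSpace.exp (-(t • Z)) * B))
      (-τ ((Z * A' - A' * Z) * B)) 0 :=
    ((⟨τ, hτc⟩ : 𝒜 →L[ℝ] ℝ).hasFDerivAt.comp_hasDerivAt 0
      ((hasDerivAt_conj_exp A' Z).mul_const B)).neg
  have h0 := hloc.hasDerivAt_eq_zero hder
  -- Cyclicity of the trace turns the derivative into -τ(Z²), which is at least ‖Z‖² as Z is skew. A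
  -- critical point thus has Z = 0.
  have h1 : τ ((Z * A' - A' * Z) * B) = τ (Z * Z) := by
    have h2 : τ (A' * (Z * B)) = τ (Z * B * A') := hτ.comm _ _
    calc τ ((Z * A' - A' * Z) * B) = τ (Z * (A' * B)) - τ (A' * (Z * B)) := by
          rw [← map_sub]; congr 1; noncomm_ring
      _ = τ (Z * Z) := by
          rw [h2, ← map_sub]; congr 1; rw [hZ]; noncomm_ring
  have h2 := hτ.le Z
  rw [hZs, neg_mul, map_neg] at h2
  have h3 : ‖Z‖ ^ 2 ≤ 0 := by linarith
  have h4 : Z = 0 := by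
    have : ‖Z‖ = 0 := by nlinarith [norm_nonneg Z]
    simpa using this
  exact sub_eq_zero.mp h4

/-- Splitting `B` into a part commuting with `g = exp A` and a part tangent to the conjugacy class
of `g`. -/
theorem IsSkewLie.exists_split (h𝔩 : IsSkewLie 𝔩) (hτ : IsDominatingTrace τ)
    {A B : 𝒜} (hA : A ∈ 𝔩) (hB : B ∈ 𝔩) :
    ∃ B₀ ∈ 𝔩, ∃ Y ∈ 𝔩, Commute (NormedSpace.exp A) B₀ ∧ ‖B₀‖ ^ 2 ≤ -τ (B * B) ∧
      B = B₀ + (Y - NormedSpace.exp (-A) * Y * NormedSpace.exp A) := by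
  have hcl : IsClosed (𝔩 : Set 𝒜) := 𝔩.closed_of_finiteDimensional
  have hconj : ∀ Y ∈ 𝔩, NormedSpace.exp (-A) * Y * NormedSpace.exp A ∈ 𝔩 := fun Y hY => by
    simpa using conj_exp_mem hcl h𝔩.bracket_mem hY (𝔩.neg_mem hA)
  have hconj' : ∀ Y ∈ 𝔩, NormedSpace.exp A * Y * NormedSpace.exp (-A) ∈ 𝔩 := fun Y hY =>
    conj_exp_mem hcl h𝔩.bracket_mem hY hA
  have hpos : ∀ a ∈ 𝔩, ‖a‖ ^ 2 ≤ -τ (a * a) := fun a ha => by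
    simpa [h𝔩.skew a ha] using hτ.le a
  -- Positive definite on 𝔩, because star a = -a there and the trace dominates the norm.
  let β : LinearMap.BilinForm ℝ 𝔩 :=
    LinearMap.mk₂ ℝ (fun x y => -τ ((x : 𝒜) * y)) (by intros; simp [add_mul]; ring)
      (by intros; simp) (by intros; simp [mul_add]; ring) (by intros; simp)
  have hβ : ∀ x y : 𝔩, β x y = -τ ((x : 𝒜) * y) := fun _ _ => rfl
  let N : 𝔩 →ₗ[ℝ] 𝔩 :=
    { toFun := fun Y => ⟨Y - NormedSpace.exp (-A) * Y * NormedSpace.exp A,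
        𝔩.sub_mem Y.2 (hconj Y Y.2)⟩
      map_add' := fun x y => by
        ext; simp only [Submodule.coe_add]; noncomm_ring
      map_smul' := fun c x => by
        ext; simp [smul_sub] }
  have hsymm : β.IsSymm := ⟨fun x y => by simp [hβ, hτ.comm (x : 𝒜) y]⟩
  have hnd : ∀ x : 𝔩, β x x = 0 → x = 0 := fun x hx => by
    have := hpos x x.2
    rw [hβ] at hx
    have h0 : ‖(x : 𝒜)‖ = 0 := by nlinarith [norm_nonneg (x : 𝒜)]
    simpa using h0
  -- The tangent part of B is taken in the range of `N`, the other part in its β-orthogonal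
  -- complement.
  have hcompl : IsCompl N.range (β.orthogonal N.range) := by
    refine LinearMap.BilinForm.isCompl_orthogonal_of_restrict_nondegenerate hsymm.isRefl ?_
    have hr : (β.restrict N.range).IsSymm := ⟨fun x y => hsymm.eq x y⟩
    refine (LinearMap.IsRefl.nondegenerate_iff_separatingLeft hr.isRefl).2 ?_
    intro x hx
    exact Subtype.ext (hnd _ (hx x))
  obtain ⟨w, hw, v, hv, hwv⟩ := Submodule.mem_sup.1
    (hcompl.sup_eq_top ▸ Submodule.mem_top : (⟨B, hB⟩ : 𝔩) ∈ N.range ⊔ β.orthogonal N.range)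
  obtain ⟨Y, rfl⟩ := hw
  have hBeq : B = (v : 𝒜) + (Y - NormedSpace.exp (-A) * Y * NormedSpace.exp A) := by
    have := congrArg Subtype.val hwv
    rw [add_comm]; exact this.symm
  refine ⟨v, v.2, Y, Y.2, ?_, ?_, hBeq⟩
  -- The β-adjoint of `N` is X ↦ X - exp(A) X exp(-A). It kills v since v is orthogonal to the range
  -- of `N`, so exp A commutes with v.
  · set d : 𝔩 := v - ⟨_, hconj' v v.2⟩ with hd
    have hort : ∀ X : 𝔩, β (N X) v = 0 := fun X => hv (N X) ⟨X, rfl⟩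
    have hd0 : ∀ X : 𝔩, β X d = 0 := by
      intro X
      rw [← hort X, hβ, hβ]
      congr 1
      have h1 : τ (NormedSpace.exp (-A) * X * NormedSpace.exp A * v) =
          τ (X * (NormedSpace.exp A * v * NormedSpace.exp (-A))) := by
        rw [mul_assoc, mul_assoc, hτ.comm]; congr 1; noncomm_ring
      simp only [hd, N, LinearMap.coe_mk, AddHom.coe_mk, Submodule.coe_sub, mul_sub, sub_mul,
        map_sub, h1]
    have := hnd d (hd0 d)
    have hv' : (v : 𝒜) = NormedSpace.exp A * v * NormedSpace.exp (-A) :=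
      congrArg Subtype.val (sub_eq_zero.1 this)
    change NormedSpace.exp A * v = v * NormedSpace.exp A
    conv_rhs => rw [hv', mul_assoc, exp_neg_mul_exp, mul_one]
  -- Pythagoras for β bounds the component v by B.
  · have h1 : β (⟨B, hB⟩ : 𝔩) ⟨B, hB⟩ = β v v + β (N Y) (N Y) := by
      have h2 : β (N Y) v = 0 := hv _ ⟨Y, rfl⟩
      have h3 : β v (N Y) = 0 := by rw [hsymm.eq v]; exact h2
      rw [← hwv]; simp [h2, h3]; ring
    have h4 := hpos v v.2
    have h5 := hpos (N Y) (N Y).2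
    simp only [hβ] at h1
    nlinarith [sq_nonneg ‖((N Y : 𝔩) : 𝒜)‖]

/-- One infinitesimal step along exp A exp(tB). The slope M of the norm bound depends on B alone and
not on A, so the step can be iterated without losing compactness. -/
theorem IsSkewLie.exists_exp_near (h𝔩 : IsSkewLie 𝔩) (hτ : IsDominatingTrace τ)
    {A B : 𝒜} (hA : A ∈ 𝔩) (hB : B ∈ 𝔩) {M δ : ℝ} (hM : 0 ≤ M) (hM' : -τ (B * B) ≤ M ^ 2)
    (hδ : 0 < δ) :
    ∀ᶠ ε : ℝ in 𝓝[>] 0, ∃ A' ∈ 𝔩, ‖A'‖ ≤ ‖A‖ + ε * M ∧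
      ‖NormedSpace.exp A * NormedSpace.exp (ε • B) - NormedSpace.exp A'‖ ≤ δ * ε := by
  have hcl : IsClosed (𝔩 : Set 𝒜) := 𝔩.closed_of_finiteDimensional
  obtain ⟨B₀, hB₀, Y, hY, hcomm, hB₀n, hBeq⟩ := h𝔩.exists_split hτ hA hB
  obtain ⟨A₁, hA₁, hA₁exp, hA₁n, hA₁c⟩ := h𝔩.exists_commute_exp_eq hτ hA hB₀ hcomm
  have hB₀M : ‖B₀‖ ≤ M := by nlinarith [norm_nonneg B₀, abs_le_of_sq_le_sq' (hB₀n.trans hM') hM]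
  -- Conjugating by exp(-εY) contributes -Y exp A + exp A · Y to first order, exactly the tangent
  -- part of exp A · B. Hence `F` has zero derivative and is o(ε).
  let F : ℝ → 𝒜 := fun ε => NormedSpace.exp A * NormedSpace.exp (ε • B) -
    NormedSpace.exp (ε • (-Y)) * (NormedSpace.exp A * NormedSpace.exp (ε • B₀)) *
      NormedSpace.exp (ε • Y)
  have hF : HasDerivAt F 0 0 := by
    have h1 := (hasDerivAt_exp_smul_const B (0 : ℝ)).const_mul (NormedSpace.exp A)
    have h2 := (hasDerivAt_exp_smul_const B₀ (0 : ℝ)).const_mul (NormedSpace.exp A)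
    have h3 := hasDerivAt_exp_smul_const (-Y) (0 : ℝ)
    have h4 := hasDerivAt_exp_smul_const Y (0 : ℝ)
    refine (h1.sub ((h3.mul h2).mul h4)).congr_deriv ?_
    simp only [zero_smul, NormedSpace.exp_zero, one_mul, mul_one, Pi.mul_apply]
    rw [hBeq]
    have : NormedSpace.exp A * (NormedSpace.exp (-A) * Y * NormedSpace.exp A) =
        Y * NormedSpace.exp A := by
      rw [mul_assoc, ← mul_assoc, exp_mul_exp_neg, one_mul]
    rw [mul_add, mul_sub, this]
    noncomm_ring
  have hF0 : F 0 = 0 := by simp [F]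
  have hsmall : ∀ᶠ ε : ℝ in 𝓝[>] 0, ‖F ε‖ ≤ δ * ε := by
    have h := (hasDerivAt_iff_isLittleO.1 hF).def hδ
    filter_upwards [nhdsWithin_le_nhds h, self_mem_nhdsWithin] with ε hε hpos
    simpa [hF0, abs_of_pos (show (0 : ℝ) < ε from hpos)] using hε
  filter_upwards [hsmall, self_mem_nhdsWithin] with ε hε hpos
  have hpos' : (0 : ℝ) < ε := hpos
  have hεY : ε • (-Y) ∈ 𝔩 := 𝔩.smul_mem _ (𝔩.neg_mem hY)
  have hsum : A₁ + ε • B₀ ∈ 𝔩 := 𝔩.add_mem hA₁ (𝔩.smul_mem _ hB₀)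
  refine ⟨_, conj_exp_mem hcl h𝔩.bracket_mem hsum hεY, ?_, ?_⟩
  · rw [norm_conj_exp (h𝔩.skew _ hεY)]
    calc ‖A₁ + ε • B₀‖ ≤ ‖A₁‖ + ‖ε • B₀‖ := norm_add_le _ _
      _ ≤ ‖A‖ + ε * M := by
        rw [norm_smul, Real.norm_of_nonneg hpos'.le]
        gcongr
  · rw [exp_conj_exp, exp_add_of_commute (hA₁c.smul_right ε), hA₁exp]
    simpa [F] using hε

/-- The exponentials of a Lie algebra of skew-adjoint elements are dense in the group they
generate. -/
theorem IsSkewLie.exp_mul_exp_mem_closure (h𝔩 : IsSkewLie 𝔩) (hτ : IsDominatingTrace τ)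
    {A B : 𝒜} (hA : A ∈ 𝔩) (hB : B ∈ 𝔩) :
    NormedSpace.exp A * NormedSpace.exp B ∈ closure (NormedSpace.exp '' (𝔩 : Set 𝒜)) := by
  have hcl : IsClosed (𝔩 : Set 𝒜) := 𝔩.closed_of_finiteDimensional
  have : ProperSpace 𝒜 := FiniteDimensional.proper ℝ 𝒜
  have hq : 0 ≤ -τ (B * B) := by
    have := hτ.le B
    rw [h𝔩.skew B hB, neg_mul, map_neg] at this
    exact (sq_nonneg _).trans this
  set M := √(-τ (B * B))
  have hM : 0 ≤ M := Real.sqrt_nonneg _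
  have hM' : -τ (B * B) ≤ M ^ 2 := (Real.sq_sqrt hq).ge
  refine Metric.mem_closure_iff.2 fun δ' hδ' => ?_
  obtain ⟨δ, hδ, hδδ'⟩ := exists_between hδ'
  -- Pairs of a time and an approximate logarithm. The norm bound confines the logarithms to one
  -- ball for times in [0, 1], so the set of admissible times is closed.
  let K : Set (ℝ × 𝒜) := {p | p.2 ∈ 𝔩 ∧ ‖p.2‖ ≤ ‖A‖ + p.1 * M ∧
    ‖NormedSpace.exp A * NormedSpace.exp (p.1 • B) - NormedSpace.exp p.2‖ ≤ δ * p.1}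
  have hKcl : IsClosed K := by
    have he : Continuous fun p : ℝ × 𝒜 => NormedSpace.exp p.2 := continuous_exp.comp continuous_snd
    have he' : Continuous fun p : ℝ × 𝒜 => NormedSpace.exp (p.1 • B) :=
      continuous_exp.comp (by fun_prop)
    have h1 : IsClosed {p : ℝ × 𝒜 | ‖p.2‖ ≤ ‖A‖ + p.1 * M} :=
      isClosed_le (by fun_prop) (by fun_prop)
    have h2 : IsClosed {p : ℝ × 𝒜 |
        ‖NormedSpace.exp A * NormedSpace.exp (p.1 • B) - NormedSpace.exp p.2‖ ≤ δ * p.1} :=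
      isClosed_le (by fun_prop) (by fun_prop)
    exact (hcl.preimage continuous_snd).inter (h1.inter h2)
  let S : Set ℝ := {t | ∃ A', (t, A') ∈ K}
  have hS : S ∩ Set.Icc 0 1 =
      Prod.fst '' (K ∩ Set.Icc 0 1 ×ˢ Metric.closedBall (0 : 𝒜) (‖A‖ + M)) := by
    ext t
    constructor
    · rintro ⟨⟨A', hA'⟩, ht⟩
      refine ⟨(t, A'), ⟨hA', ht, ?_⟩, rfl⟩
      rw [mem_closedBall_zero_iff]
      exact hA'.2.1.trans (by simpa using mul_le_of_le_one_left hM ht.2)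
    · rintro ⟨⟨t, A'⟩, ⟨hA', ht, -⟩, rfl⟩
      exact ⟨⟨A', hA'⟩, ht⟩
  have hScl : IsClosed (S ∩ Set.Icc 0 1) := by
    rw [hS]
    exact (((isCompact_Icc.prod (isCompact_closedBall _ _)).inter_left hKcl).image
      continuous_fst).isClosed
  have hsub : Set.Icc (0 : ℝ) 1 ⊆ S := by
    refine hScl.Icc_subset_of_forall_exists_gt ⟨A, hA, by simp, by simp⟩ ?_
    rintro t ⟨⟨A₁, hA₁, hA₁n, hA₁e⟩, ht⟩ y hy
    have hev := h𝔩.exists_exp_near hτ hA₁ hB hM hM' hδ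
    have hlt : ∀ᶠ ε : ℝ in 𝓝[>] 0, ε < y - t :=
      nhdsWithin_le_nhds (gt_mem_nhds (sub_pos.2 hy))
    obtain ⟨ε, ⟨A₂, hA₂, hA₂n, hA₂e⟩, hεy, hε⟩ :=
      (hev.and (hlt.and self_mem_nhdsWithin)).exists
    have hε' : (0 : ℝ) < ε := hε
    refine ⟨t + ε, ⟨A₂, hA₂, ?_, ?_⟩, by linarith, by linarith⟩
    · simp only at hA₁n ⊢; linarith
    · have hadd : NormedSpace.exp ((t + ε) • B) =
          NormedSpace.exp (t • B) * NormedSpace.exp (ε • B) := by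
        rw [add_smul, exp_add_of_commute
          (((Commute.refl B).smul_left t).smul_right ε)]
      -- Right multiplication by a unitary is isometric, so the error made up to t is carried along
      -- unchanged and the errors add.
      have hu := CStarRing.norm_mul_coe_unitary
        (NormedSpace.exp A * NormedSpace.exp (t • B) - NormedSpace.exp A₁)
        ⟨_, exp_mem_unitary (h𝔩.skew _ (𝔩.smul_mem ε hB))⟩
      simp only at hA₁e hu ⊢
      calc ‖NormedSpace.exp A * NormedSpace.exp ((t + ε) • B) - NormedSpace.exp A₂‖
          = ‖(NormedSpace.exp A * NormedSpace.exp (t • B) - NormedSpace.exp A₁) *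
              NormedSpace.exp (ε • B) +
              (NormedSpace.exp A₁ * NormedSpace.exp (ε • B) - NormedSpace.exp A₂)‖ := by
            rw [hadd]; congr 1; noncomm_ring
        _ ≤ δ * t + δ * ε := (norm_add_le _ _).trans (add_le_add (hu.trans_le hA₁e) hA₂e)
        _ = δ * (t + ε) := by ring
  obtain ⟨A', hA', -, hA'e⟩ := hsub (Set.right_mem_Icc.2 zero_le_one)
  refine ⟨_, ⟨A', hA', rfl⟩, ?_⟩
  rw [dist_eq_norm]
  simp only [one_smul, mul_one] at hA'e
  exact hA'e.trans_lt hδδ'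

end CStar

/-! ### Skew-adjoint elements as a Lie algebra, and the product formula -/

section SkewAdjoint

variable {A : Type*} [NormedRing A] [StarRing A] [CStarRing A]

instance : LieRing (skewAdjoint A) where
  bracket a b := ⟨a * b - b * a, by
    have ha := skewAdjoint.mem_iff.1 a.2
    have hb := skewAdjoint.mem_iff.1 b.2
    rw [skewAdjoint.mem_iff]; simp [ha, hb]⟩
  add_lie a b c := Subtype.ext (by simp only [AddSubgroup.coe_add]; noncomm_ring)
  lie_add a b c := Subtype.ext (by simp only [AddSubgroup.coe_add]; noncomm_ring)
  lie_self a := Subtype.ext (by simp)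
  leibniz_lie a b c := Subtype.ext (by simp only [AddSubgroup.coe_add]; noncomm_ring)

theorem coe_bracket (a b : skewAdjoint A) : ((⁅a, b⁆ : skewAdjoint A) : A) = a * b - b * a := rfl

variable [NormedAlgebra ℝ A] [StarModule ℝ A]

noncomputable instance : LieAlgebra ℝ (skewAdjoint A) where
  lie_smul t a b := Subtype.ext (by
    simp [coe_bracket, smul_sub])

instance : ContinuousConstSMul ℝ (skewAdjoint A) :=
  ⟨fun c => (continuous_subtype_val.const_smul c).subtype_mk _⟩

variable [CompleteSpace A]

/-- The exponential of a skew-adjoint element as a unitary. -/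
noncomputable def expUnitary (a : skewAdjoint A) : unitary A :=
  ⟨NormedSpace.exp (a : A), exp_mem_unitary (skewAdjoint.mem_iff.1 a.2)⟩

theorem coe_expUnitary (a : skewAdjoint A) : (expUnitary a : A) = NormedSpace.exp (a : A) := rfl

theorem continuous_expUnitary : Continuous (expUnitary : skewAdjoint A → unitary A) :=
  (continuous_exp.comp continuous_subtype_val).subtype_mk _

theorem expUnitary_zero : expUnitary (0 : skewAdjoint A) = 1 :=
  Subtype.ext (by simp [coe_expUnitary])

theorem expUnitary_neg (a : skewAdjoint A) : expUnitary (-a) = (expUnitary a)⁻¹ := by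
  rw [eq_inv_iff_mul_eq_one]
  exact Subtype.ext (by simpa [coe_expUnitary] using exp_neg_mul_exp (a : A))

theorem expUnitary_add_smul (s t : ℝ) (a : skewAdjoint A) :
    expUnitary ((s + t) • a) = expUnitary (s • a) * expUnitary (t • a) :=
  Subtype.ext (by
    simp only [coe_expUnitary, skewAdjoint.val_smul, add_smul, AddSubgroup.coe_add,
      Submonoid.coe_mul]
    exact exp_add_of_commute (((Commute.refl _).smul_left s).smul_right t))

/-- The adjoint action of `exp a` on a skew-adjoint element. -/
noncomputable def adExp (a b : skewAdjoint A) : skewAdjoint A :=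
  ⟨NormedSpace.exp (a : A) * b * NormedSpace.exp (-(a : A)), by
    have ha := skewAdjoint.mem_iff.1 a.2
    have hb := skewAdjoint.mem_iff.1 b.2
    rw [skewAdjoint.mem_iff]
    simp [NormedSpace.star_exp, ha, hb, mul_assoc]⟩

theorem expUnitary_smul_adExp (t : ℝ) (a b : skewAdjoint A) :
    expUnitary (t • adExp a b) = expUnitary a * expUnitary (t • b) * (expUnitary a)⁻¹ := by
  rw [← expUnitary_neg]
  refine Subtype.ext ?_
  have := exp_conj_exp (t • (b : A)) (a : A)
  simpa [coe_expUnitary, adExp] using this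

/-- Presents the bracket as a limit of real combinations of b and its conjugates, the operations
under which the Lie algebra of a closed group is visibly stable. -/
theorem tendsto_adExp_slope (a b : skewAdjoint A) :
    Filter.Tendsto (fun s : ℝ => s⁻¹ • (adExp (s • a) b - b)) (𝓝[≠] 0) (𝓝 ⁅a, b⁆) := by
  rw [tendsto_subtype_rng, coe_bracket]
  have h := hasDerivAt_iff_tendsto_slope.1 (hasDerivAt_conj_exp (b : A) (a : A))
  refine h.congr fun s => ?_
  simp [slope, adExp]

/-- Telescoping: exchanging one factor costs ‖u - v‖, and the remaining unitary factors do not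
enlarge it. -/
theorem norm_pow_sub_pow_le (u v : unitary A) (n : ℕ) :
    ‖(u : A) ^ n - (v : A) ^ n‖ ≤ n * ‖(u : A) - v‖ := by
  induction n with
  | zero => simp
  | succ n ih =>
    have h1 := CStarRing.norm_mul_coe_unitary ((u : A) ^ n - (v : A) ^ n) u
    have h2 := CStarRing.norm_coe_unitary_mul (v ^ n) ((u : A) - v)
    calc ‖(u : A) ^ (n + 1) - (v : A) ^ (n + 1)‖
        = ‖((u : A) ^ n - (v : A) ^ n) * u + (v : A) ^ n * ((u : A) - v)‖ := by
          congr 1; rw [pow_succ, pow_succ]; noncomm_ring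
      _ ≤ n * ‖(u : A) - v‖ + ‖(u : A) - v‖ := by
          refine (norm_add_le _ _).trans (add_le_add (h1.trans_le ih) ?_)
          simpa using h2.le
      _ = ((n + 1 : ℕ) : ℝ) * ‖(u : A) - v‖ := by push_cast; ring

/-- The product formula of Lie and Trotter for skew-adjoint elements. -/
theorem tendsto_expUnitary_mul_pow (a b : skewAdjoint A) :
    Filter.Tendsto (fun n : ℕ => (expUnitary ((n : ℝ)⁻¹ • a) * expUnitary ((n : ℝ)⁻¹ • b)) ^ n)
      Filter.atTop (𝓝 (expUnitary (a + b))) := by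
  -- The error of one factor is o(s), so n factors with s = 1/n make a total error n · o(1/n), which
  -- tends to 0.
  let F : ℝ → A := fun s => NormedSpace.exp (s • (a : A)) * NormedSpace.exp (s • (b : A)) -
    NormedSpace.exp (s • ((a : A) + b))
  have hF : HasDerivAt F 0 0 := by
    refine (((hasDerivAt_exp_smul_const (a : A) (0 : ℝ)).mul
      (hasDerivAt_exp_smul_const (b : A) (0 : ℝ))).sub
      (hasDerivAt_exp_smul_const ((a : A) + b) (0 : ℝ))).congr_deriv ?_
    simp
  have hslope := hasDerivAt_iff_tendsto_slope.1 hF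
  have hinv : Filter.Tendsto (fun n : ℕ => (n : ℝ)⁻¹) Filter.atTop (𝓝[≠] 0) := by
    refine tendsto_nhdsWithin_iff.2 ⟨tendsto_inv_atTop_nhds_zero_nat, ?_⟩
    filter_upwards [Filter.eventually_gt_atTop 0] with n hn
    simpa using hn.ne'
  have h0 := (hslope.comp hinv).norm
  rw [norm_zero] at h0
  rw [tendsto_subtype_rng, tendsto_iff_norm_sub_tendsto_zero]
  refine squeeze_zero' (Filter.Eventually.of_forall fun _ => norm_nonneg _) ?_ h0
  filter_upwards [Filter.eventually_gt_atTop 0] with n hn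
  have hpow : (expUnitary (a + b) : A) = (expUnitary ((n : ℝ)⁻¹ • (a + b)) : A) ^ n := by
    let := NormedAlgebra.restrictScalars ℚ ℝ A
    rw [coe_expUnitary, coe_expUnitary, ← NormedSpace.exp_nsmul, skewAdjoint.val_smul,
      ← Nat.cast_smul_eq_nsmul ℝ, smul_smul, mul_inv_cancel₀ (by exact_mod_cast hn.ne'), one_smul]
  rw [hpow]
  refine (norm_pow_sub_pow_le _ _ n).trans (le_of_eq ?_)
  simp [slope, F, norm_smul, coe_expUnitary]

end SkewAdjoint

/-! ### Closed subgroups and exponentials in products of unitary groups -/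

section Product

variable {ι : Type*} {A : ι → Type*} [∀ i, NormedRing (A i)] [∀ i, StarRing (A i)]
  [∀ i, CStarRing (A i)] [∀ i, NormedAlgebra ℝ (A i)] [∀ i, StarModule ℝ (A i)]
  [∀ i, CompleteSpace (A i)]

instance : LieRing (∀ i, skewAdjoint (A i)) where
  bracket a b i := ⁅a i, b i⁆
  add_lie a b c := funext fun i => add_lie (a i) (b i) (c i)
  lie_add a b c := funext fun i => lie_add (a i) (b i) (c i)
  lie_self a := funext fun i => lie_self (a i)
  leibniz_lie a b c := funext fun i => leibniz_lie (a i) (b i) (c i)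

noncomputable instance : LieAlgebra ℝ (∀ i, skewAdjoint (A i)) where
  lie_smul t a b := funext fun i => lie_smul t (a i) (b i)

/-- The exponential of a family of skew-adjoint elements. -/
noncomputable def expFamily (a : ∀ i, skewAdjoint (A i)) : ∀ i, unitary (A i) :=
  fun i => expUnitary (a i)

theorem expFamily_apply (a : ∀ i, skewAdjoint (A i)) (i : ι) :
    expFamily a i = expUnitary (a i) := rfl

theorem continuous_expFamily :
    Continuous (expFamily : (∀ i, skewAdjoint (A i)) → ∀ i, unitary (A i)) :=
  continuous_pi fun i => continuous_expUnitary.comp (continuous_apply i)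

theorem expFamily_neg (a : ∀ i, skewAdjoint (A i)) : expFamily (-a) = (expFamily a)⁻¹ :=
  funext fun i => expUnitary_neg (a i)

/-- The Lie algebra of a closed subgroup of a product of unitary groups. -/
def lieAlgebraOf (G : Subgroup (∀ i, unitary (A i)))
    (hG : IsClosed (G : Set (∀ i, unitary (A i)))) :
    LieSubalgebra ℝ (∀ i, skewAdjoint (A i)) :=
  have hadd : ∀ a b : ∀ i, skewAdjoint (A i), (∀ t : ℝ, expFamily (t • a) ∈ G) →
      (∀ t : ℝ, expFamily (t • b) ∈ G) → ∀ t : ℝ, expFamily (t • (a + b)) ∈ G := by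
    intro a b ha hb t
    have hlim : Filter.Tendsto (fun n : ℕ =>
        (expFamily ((n : ℝ)⁻¹ • t • a) * expFamily ((n : ℝ)⁻¹ • t • b)) ^ n)
        Filter.atTop (𝓝 (expFamily (t • (a + b)))) := by
      refine tendsto_pi_nhds.2 fun i => ?_
      simpa [expFamily_apply, smul_add] using tendsto_expUnitary_mul_pow (t • a i) (t • b i)
    refine hG.mem_of_tendsto hlim (Filter.Eventually.of_forall fun n => ?_)
    refine G.pow_mem (G.mul_mem ?_ ?_) n
    · rw [smul_smul]; exact ha _
    · rw [smul_smul]; exact hb _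
  have hsmul : ∀ (c : ℝ) (a : ∀ i, skewAdjoint (A i)), (∀ t : ℝ, expFamily (t • a) ∈ G) →
      ∀ t : ℝ, expFamily (t • c • a) ∈ G := fun c a ha t => by
    rw [smul_smul]; exact ha _
  { carrier := {a | ∀ t : ℝ, expFamily (t • a) ∈ G}
    zero_mem' := fun t => by
      have : expFamily (t • (0 : ∀ i, skewAdjoint (A i))) = 1 :=
        funext fun i => by simp [expFamily_apply, expUnitary_zero]
      rw [this]; exact G.one_mem
    add_mem' := fun {a b} ha hb => hadd a b ha hb
    smul_mem' := fun c a ha => hsmul c a ha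
    lie_mem' := fun {a b} ha hb t => by
      -- The approximants of the bracket are combinations of b and a conjugate of b by an element of
      -- G; the closure properties under sums and scalars already apply to them.
      have hlim : Filter.Tendsto
          (fun s : ℝ => (s⁻¹ • ((fun i => adExp (s • a i) (b i)) - b) : ∀ i, skewAdjoint (A i)))
          (𝓝[≠] 0) (𝓝 ⁅a, b⁆) :=
        tendsto_pi_nhds.2 fun i => tendsto_adExp_slope (a i) (b i)
      have hlim' := (continuous_expFamily.tendsto _).comp (hlim.const_smul t)
      refine hG.mem_of_tendsto hlim' (Filter.Eventually.of_forall fun s => ?_)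
      refine hsmul _ _ ?_ t
      rw [sub_eq_add_neg]
      refine hadd _ _ (fun r => ?_) ?_
      · have : expFamily (r • (fun i => adExp (s • a i) (b i) : ∀ i, skewAdjoint (A i))) =
            expFamily (s • a) * expFamily (r • b) * (expFamily (s • a))⁻¹ :=
          funext fun i => expUnitary_smul_adExp r (s • a i) (b i)
        rw [this]
        exact G.mul_mem (G.mul_mem (ha s) (hb r)) (G.inv_mem (ha s))
      · intro r
        rw [smul_neg, expFamily_neg]
        exact G.inv_mem (hb r) }

theorem mem_lieAlgebraOf {G : Subgroup (∀ i, unitary (A i))}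
    {hG : IsClosed (G : Set (∀ i, unitary (A i)))} {a : ∀ i, skewAdjoint (A i)} :
    a ∈ lieAlgebraOf G hG ↔ ∀ t : ℝ, expFamily (t • a) ∈ G := Iff.rfl

variable [∀ i, FiniteDimensional ℝ (A i)]

/-- A basic neighbourhood restricts only finitely many coordinates, and the projection of 𝔩 to these
is a skew-adjoint Lie algebra in a finite-dimensional algebra, where the density of exponentials is
known. -/
theorem expFamily_mul_mem_closure {τ : ∀ i, A i →ₗ[ℝ] ℝ} (hτ : ∀ i, IsDominatingTrace (τ i))
    (𝔩 : LieSubalgebra ℝ (∀ i, skewAdjoint (A i))) {a b : ∀ i, skewAdjoint (A i)}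
    (ha : a ∈ 𝔩) (hb : b ∈ 𝔩) :
    expFamily a * expFamily b ∈ closure (expFamily '' (𝔩 : Set (∀ i, skewAdjoint (A i)))) := by
  classical
  rw [mem_closure_iff]
  intro o ho hmem
  obtain ⟨F, u, hu, hsub⟩ := isOpen_pi_iff.1 ho _ hmem
  choose! v hv hvu using fun i (hi : i ∈ F) => isOpen_induced_iff.1 (hu i hi).1
  let r : (∀ i, skewAdjoint (A i)) →ₗ[ℝ] (∀ i : F, A i) :=
    { toFun := fun a i => (a i : A i)
      map_add' := fun _ _ => rfl
      map_smul' := fun _ _ => rfl }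
  have hr : ∀ c i, r c i = (c i : A i) := fun _ _ => rfl
  have h𝔩 : IsSkewLie (𝔩.toSubmodule.map r) := by
    constructor
    · rintro _ ⟨c, -, rfl⟩
      exact funext fun i => skewAdjoint.mem_iff.1 (c i).2
    · rintro _ ⟨c, hc, rfl⟩ _ ⟨d, hd, rfl⟩
      exact ⟨⁅c, d⁆, 𝔩.lie_mem hc hd, rfl⟩
  -- The sum of the traces dominates the square of the supremum norm, since every summand τ(x* x) is
  -- nonnegative.
  let σ : (∀ i : F, A i) →ₗ[ℝ] ℝ := ∑ i : F, τ i ∘ₗ LinearMap.proj i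
  have hσ : ∀ x, σ x = ∑ i : F, τ i (x i) := fun x => by simp [σ]
  have hσt : IsDominatingTrace σ := by
    constructor
    · intro x y
      simp only [hσ, Pi.mul_apply]
      exact Finset.sum_congr rfl fun i _ => (hτ i).comm _ _
    · intro x
      have hnn : ∀ i : F, 0 ≤ τ i (star (x i) * x i) := fun i =>
        (sq_nonneg _).trans ((hτ i).le (x i))
      have hle : ‖x‖ ≤ √(σ (star x * x)) := by
        refine (pi_norm_le_iff_of_nonneg (Real.sqrt_nonneg _)).2 fun i => Real.le_sqrt_of_sq_le ?_
        refine ((hτ i).le (x i)).trans ?_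
        rw [hσ]
        exact Finset.single_le_sum (f := fun i : F => τ i ((star x * x) i))
          (fun i _ => hnn i) (Finset.mem_univ i)
      calc ‖x‖ ^ 2 ≤ √(σ (star x * x)) ^ 2 := by gcongr
        _ = _ := Real.sq_sqrt (by rw [hσ]; exact Finset.sum_nonneg fun i _ => hnn i)
  have hcl := h𝔩.exp_mul_exp_mem_closure hσt ⟨a, ha, rfl⟩ ⟨b, hb, rfl⟩
  have hexp : ∀ c (i : F), NormedSpace.exp (r c) i = (expFamily c i : A i) := fun c i => by
    let := fun i => NormedAlgebra.restrictScalars ℚ ℝ (A i)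
    rw [Pi.coe_exp]; rfl
  rw [mem_closure_iff] at hcl
  obtain ⟨y, hy, _, ⟨c, hc, rfl⟩, rfl⟩ := hcl (Set.univ.pi fun i : F => v i)
    (isOpen_set_pi Set.finite_univ fun i _ => hv i i.2) (by
      intro i _
      have h1 := (hu i i.2).2
      rw [← hvu i i.2] at h1
      rw [Pi.mul_apply, hexp, hexp]
      exact h1)
  refine ⟨expFamily c, hsub fun i hi => ?_, c, hc, rfl⟩
  rw [← hvu i hi]
  have := hy ⟨i, hi⟩ trivial
  rw [hexp] at this
  exact this

/-- The closure of the exponentials of a Lie algebra of families is a group. -/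
def closureExp {τ : ∀ i, A i →ₗ[ℝ] ℝ} (hτ : ∀ i, IsDominatingTrace (τ i))
    (𝔩 : LieSubalgebra ℝ (∀ i, skewAdjoint (A i))) : Subgroup (∀ i, unitary (A i)) where
  carrier := closure (expFamily '' (𝔩 : Set (∀ i, skewAdjoint (A i))))
  one_mem' := subset_closure ⟨0, 𝔩.zero_mem, funext fun i => by
    simp [expFamily_apply, expUnitary_zero]⟩
  mul_mem' := by
    intro x y hx hy
    set E := expFamily '' (𝔩 : Set (∀ i, skewAdjoint (A i)))
    -- Products are extended to the closure one factor at a time, by continuity of translations.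
    have h1 : ∀ b ∈ E, ∀ x ∈ closure E, x * b ∈ closure E := by
      rintro _ ⟨b, hb, rfl⟩ x hx
      refine closure_minimal ?_ (isClosed_closure.preimage (continuous_mul_const (expFamily b))) hx
      rintro _ ⟨a, ha, rfl⟩
      exact expFamily_mul_mem_closure hτ 𝔩 ha hb
    exact closure_minimal (fun b hb => h1 b hb x hx)
      (isClosed_closure.preimage (continuous_const_mul x)) hy
  inv_mem' := by
    intro x hx
    refine closure_minimal ?_ (isClosed_closure.preimage continuous_inv) hx
    rintro _ ⟨a, ha, rfl⟩
    exact subset_closure ⟨-a, 𝔩.neg_mem ha, expFamily_neg a⟩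

end Product

/-! ### Unitaries on Hilbert space and eigenvectors of generators -/

variable {𝓗 : Type*} [NormedAddCommGroup 𝓗] [InnerProductSpace ℂ 𝓗] [CompleteSpace 𝓗]

theorem unitary_inner (U : unitary (𝓗 →L[ℂ] 𝓗)) (φ ψ : 𝓗) :
    ⟪(U : 𝓗 →L[ℂ] 𝓗) φ, (U : 𝓗 →L[ℂ] 𝓗) ψ⟫_ℂ = ⟪φ, ψ⟫_ℂ :=
  ContinuousLinearMap.inner_map_map_of_mem_unitary U.2 φ ψ

theorem unitary_norm (U : unitary (𝓗 →L[ℂ] 𝓗)) (ψ : 𝓗) : ‖(U : 𝓗 →L[ℂ] 𝓗) ψ‖ = ‖ψ‖ :=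
  ContinuousLinearMap.norm_map_of_mem_unitary U.2 ψ

/-- An eigenvector of the generator of a one-parameter group is an eigenvector of the group. -/
theorem apply_eq_exp_smul_of_hasDerivAt {V : ℝ → unitary (𝓗 →L[ℂ] 𝓗)} (h0 : V 0 = 1)
    (hadd : ∀ s t, V (s + t) = V s * V t) {ψ : 𝓗} {c : ℂ}
    (hψ : HasDerivAt (fun t => (V t : 𝓗 →L[ℂ] 𝓗) ψ) (c • ψ) 0) (t : ℝ) :
    (V t : 𝓗 →L[ℂ] 𝓗) ψ = Complex.exp (c * t) • ψ := by
  have hd : ∀ s, HasDerivAt (fun t => (V t : 𝓗 →L[ℂ] 𝓗) ψ) (c • (V s : 𝓗 →L[ℂ] 𝓗) ψ) s := by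
    intro s
    have h1 : HasDerivAt (fun t => (V s : 𝓗 →L[ℂ] 𝓗) ((V t : 𝓗 →L[ℂ] 𝓗) ψ))
        ((V s : 𝓗 →L[ℂ] 𝓗) (c • ψ)) 0 :=
      ((V s : 𝓗 →L[ℂ] 𝓗).restrictScalars ℝ).hasFDerivAt.comp_hasDerivAt 0 hψ
    have h2 : HasDerivAt (fun t => (V s : 𝓗 →L[ℂ] 𝓗) ((V (t - s) : 𝓗 →L[ℂ] 𝓗) ψ))
        ((V s : 𝓗 →L[ℂ] 𝓗) (c • ψ)) s := by
      have := HasDerivAt.comp_sub_const (f := fun t => (V s : 𝓗 →L[ℂ] 𝓗) ((V t : 𝓗 →L[ℂ] 𝓗) ψ))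
        s s (by simpa using h1)
      exact this.congr_deriv (map_smul _ _ _).symm
    rw [map_smul] at h2
    refine h2.congr_of_eventuallyEq (Filter.Eventually.of_forall fun r => ?_)
    have : V r = V s * V (r - s) := by rw [← hadd]; congr 1; ring
    simp only
    conv_lhs => rw [this]
    rfl
  -- The group law makes the orbit a solution of y' = c y on all of ℝ; the integrating factor makes
  -- `g` constant.
  let g : ℝ → 𝓗 := fun t => Complex.exp (-(c * t)) • (V t : 𝓗 →L[ℂ] 𝓗) ψ
  have hg : ∀ s, HasDerivAt g 0 s := by
    intro s
    have he : HasDerivAt (fun t : ℝ => Complex.exp (-(c * t)))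
        (Complex.exp (-(c * s)) * (-(c * 1))) s :=
      (((Complex.ofRealCLM.hasDerivAt (x := s)).const_mul c).neg).cexp
    refine (he.smul (hd s)).congr_deriv ?_
    rw [smul_smul, ← add_smul]
    ring_nf
    simp
  have h01 : g t = g 0 := is_const_of_deriv_eq_zero (fun t => (hg t).differentiableAt)
    (fun t => (hg t).deriv) t 0
  simp only [g, h0, Complex.ofReal_zero, mul_zero, neg_zero, Complex.exp_zero, one_smul] at h01
  have h2 : Complex.exp (c * t) • Complex.exp (-(c * t)) • (V t : 𝓗 →L[ℂ] 𝓗) ψ =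
      Complex.exp (c * t) • ψ := by rw [h01]; rfl
  rwa [smul_smul, ← Complex.exp_add, add_neg_cancel, Complex.exp_zero, one_smul] at h2

theorem hasDerivAt_exp_smul (c : ℂ) (ψ : 𝓗) :
    HasDerivAt (fun t : ℝ => Complex.exp (c * t) • ψ) (c • ψ) 0 := by
  have he : HasDerivAt (fun t : ℝ => Complex.exp (c * t)) (Complex.exp (c * (0 : ℝ)) * (c * 1)) 0 :=
    ((Complex.ofRealCLM.hasDerivAt (x := (0 : ℝ))).const_mul c).cexp
  simpa using he.smul_const ψ

/-! ### Charge spaces of a representation of the circle -/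

section Charge

variable (π : Circle →* unitary (𝓗 →L[ℂ] 𝓗))

/-- Trades the eigenvalue equation of the unbounded operator X for a condition on bounded operators.
One direction integrates the equation and uses that every z is some exp(iα); the other
differentiates at α = 0. -/
theorem mem_chargeSpace_iff {μ : ℤ} {ψ : 𝓗} :
    ψ ∈ chargeSpace π μ ↔ ∀ z : Circle, (π z : 𝓗 →L[ℂ] 𝓗) ψ = (z : ℂ) ^ μ • ψ := by
  have key : ψ ∈ chargeSpace π μ ↔ HasDerivAt
      (fun α : ℝ => (π (Circle.exp α) : 𝓗 →L[ℂ] 𝓗) ψ) ((Complex.I * μ) • ψ) 0 := by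
    constructor
    · rintro ⟨h, h'⟩
      have hd : DifferentiableAt ℝ (fun α : ℝ => (π (Circle.exp α) : 𝓗 →L[ℂ] 𝓗) ψ) 0 := h
      have h'' : (-Complex.I) • deriv (fun α : ℝ => (π (Circle.exp α) : 𝓗 →L[ℂ] 𝓗) ψ) 0 =
        (μ : ℂ) • ψ := h'
      have h3 : deriv (fun α : ℝ => (π (Circle.exp α) : 𝓗 →L[ℂ] 𝓗) ψ) 0 =
          (Complex.I * μ) • ψ := by
        rw [mul_smul, ← h'', smul_smul]; simp
      rw [← h3]
      exact hd.hasDerivAt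
    · intro h
      refine ⟨h.differentiableAt, ?_⟩
      change (-Complex.I) • deriv (fun α : ℝ => (π (Circle.exp α) : 𝓗 →L[ℂ] 𝓗) ψ) 0 = _
      rw [h.deriv, smul_smul, ← mul_assoc]
      simp
  have hexp : ∀ α : ℝ, ((Circle.exp α : Circle) : ℂ) ^ μ = Complex.exp (Complex.I * μ * α) := by
    intro α
    rw [Circle.coe_exp, ← Complex.exp_int_mul]
    ring_nf
  rw [key]
  constructor
  · intro h z
    obtain ⟨α, rfl⟩ := Circle.exp_surjective z
    rw [hexp]
    exact apply_eq_exp_smul_of_hasDerivAt (V := fun α => π (Circle.exp α)) (by simp)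
      (fun s t => by rw [Circle.exp_add, map_mul]) h α
  · intro h
    refine (hasDerivAt_exp_smul (Complex.I * μ) ψ).congr_of_eventuallyEq
      (Filter.Eventually.of_forall fun α => ?_)
    simp only [h, hexp]

theorem chargeSpace_orthogonal : Pairwise (Function.onFun (· ⟂ ·) (chargeSpace π)) := by
  intro μ ν hμν
  rw [Function.onFun, Submodule.isOrtho_iff_inner_eq]
  intro φ hφ ψ hψ
  rw [mem_chargeSpace_iff] at hφ hψ
  have hne : ((ν - μ : ℤ) : ℂ) ≠ 0 := by exact_mod_cast sub_ne_zero.2 hμν.symm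
  -- Chosen so that z^(ν - μ) = -1; invariance of the inner product under π(z) then gives ⟪φ, ψ⟫ =
  -- -⟪φ, ψ⟫.
  set z : Circle := Circle.exp (Real.pi / (ν - μ : ℤ)) with hz
  have h1 := unitary_inner (π z) φ ψ
  rw [hφ, hψ, inner_smul_left, inner_smul_right, ← mul_assoc] at h1
  have h2 : (starRingEnd ℂ) ((z : ℂ) ^ μ) * (z : ℂ) ^ ν = -1 := by
    have : (starRingEnd ℂ) (z : ℂ) = (z : ℂ)⁻¹ := by rw [← Circle.coe_inv, Circle.coe_inv_eq_conj]
    rw [map_zpow₀, this, inv_zpow, ← zpow_neg, ← zpow_add₀ (Circle.coe_ne_zero z), hz,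
      Circle.coe_exp, ← Complex.exp_int_mul, ← Complex.exp_pi_mul_I]
    congr 1
    have : ((-μ + ν : ℤ) : ℂ) = ((ν - μ : ℤ) : ℂ) := by congr 1; ring
    rw [this, Complex.ofReal_div, Complex.ofReal_intCast]
    field_simp
  rw [h2] at h1
  have h3 : (2 : ℂ) * ⟪φ, ψ⟫_ℂ = 0 := by linear_combination -h1
  simpa using h3

/-- The spectral subspaces of a strongly continuous representation of the circle are total. -/
theorem chargeSpace_total (hπ : ∀ ψ : 𝓗, Continuous fun z => (π z : 𝓗 →L[ℂ] 𝓗) ψ) :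
    (⨆ μ, chargeSpace π μ)ᗮ = ⊥ := by
  have : Fact ((0 : ℝ) < 1) := ⟨one_pos⟩
  rw [Submodule.eq_bot_iff]
  intro φ hφ
  let p : AddCircle (1 : ℝ) → 𝓗 := fun x => (π (AddCircle.toCircle x) : 𝓗 →L[ℂ] 𝓗) φ
  have hp : Continuous p := (hπ φ).comp AddCircle.continuous_toCircle
  have hint : ∀ n : ℤ, Integrable (fun x => fourier (-n) x • p x)
      (AddCircle.haarAddCircle : Measure (AddCircle (1 : ℝ))) := fun n =>
    ((map_continuous (fourier (-n))).smul hp).integrable_of_hasCompactSupport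
      (HasCompactSupport.of_compactSpace _)
  -- By invariance of Haar measure, π(y) acts on the n-th coefficient of the orbit map by the n-th
  -- character.
  have hmem : ∀ n : ℤ, fourierCoeff p n ∈ chargeSpace π n := by
    intro n
    rw [mem_chargeSpace_iff]
    intro z
    obtain ⟨y, rfl⟩ := (AddCircle.homeomorphCircle (one_ne_zero : (1 : ℝ) ≠ 0)).surjective z
    rw [AddCircle.homeomorphCircle_apply]
    have h1 : (π (AddCircle.toCircle y) : 𝓗 →L[ℂ] 𝓗) (fourierCoeff p n) =
        ∫ x, (π (AddCircle.toCircle y) : 𝓗 →L[ℂ] 𝓗) (fourier (-n) x • p x)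
          ∂AddCircle.haarAddCircle :=
      (ContinuousLinearMap.integral_comp_comm _ (hint n)).symm
    have h2 : ∀ x, (π (AddCircle.toCircle y) : 𝓗 →L[ℂ] 𝓗) (fourier (-n) x • p x) =
        fourier n y • (fourier (-n) (y + x) • p (y + x)) := by
      intro x
      have h3 : (π (AddCircle.toCircle y) : 𝓗 →L[ℂ] 𝓗) (p x) = p (y + x) := by
        simp only [p, AddCircle.toCircle_add, map_mul]; rfl
      have h4 : fourier n y * fourier (-n) (y + x) = fourier (-n) x := by
        rw [fourier_apply, fourier_apply, fourier_apply, ← Circle.coe_mul,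
          ← AddCircle.toCircle_add, smul_add, ← add_assoc, neg_smul, add_neg_cancel, zero_add]
      rw [map_smul, h3, smul_smul, h4]
    rw [h1]
    simp only [h2]
    rw [integral_smul, integral_add_left_eq_self (fun x => fourier (-n) x • p x) y]
    simp only [fourierCoeff]
    congr 1
    rw [fourier_apply, AddCircle.toCircle_zsmul, Circle.coe_zpow]
  let f : C(AddCircle (1 : ℝ), ℂ) := ⟨fun x => ⟪φ, p x⟫_ℂ, continuous_const.inner hp⟩
  have hf : fourierCoeff f = 0 := by
    funext n
    have h1 : fourierCoeff f n = ⟪φ, fourierCoeff p n⟫_ℂ := by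
      have := ContinuousLinearMap.integral_comp_comm (innerSL ℂ φ) (hint n)
      simp only [innerSL_apply_apply, inner_smul_right] at this
      exact this
    rw [h1]
    exact (Submodule.mem_orthogonal' _ _).1 hφ _ (Submodule.mem_iSup_of_mem n (hmem n))
  -- A continuous function with summable Fourier coefficients is the sum of its series; all
  -- coefficients vanish here, and the value at 0 is ⟪φ, φ⟫.
  have hs := has_pointwise_sum_fourier_series_of_summable (f := f) (by rw [hf]; exact summable_zero) 0
  simp only [hf, Pi.zero_apply, zero_smul] at hs
  have h0 := hs.unique hasSum_zero
  have hp0 : p 0 = φ := by simp [p]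
  have : ⟪φ, φ⟫_ℂ = 0 := by
    have h1 : f 0 = ⟪φ, p 0⟫_ℂ := rfl
    rw [← h0, h1, hp0]
  exact inner_self_eq_zero.1 this

theorem chargeSpace_isHilbertSum (hπ : ∀ ψ : 𝓗, Continuous fun z => (π z : 𝓗 →L[ℂ] 𝓗) ψ)
    [∀ μ : ℤ, FiniteDimensional ℂ (chargeSpace π μ)] :
    IsHilbertSum ℂ (fun μ => chargeSpace π μ) fun μ => (chargeSpace π μ).subtypeₗᵢ := by
  refine IsHilbertSum.mkInternal _ (OrthogonalFamily.of_pairwise (chargeSpace_orthogonal π)) ?_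
  rw [top_le_iff, Submodule.topologicalClosure_eq_top_iff]
  exact chargeSpace_total π hπ

end Charge

/-! ### Block diagonal unitaries -/

section Block

theorem isClosed_unitary_of_cstar {A : Type*} [NormedRing A] [StarRing A] [CStarRing A] :
    IsClosed (unitary A : Set A) := isClosed_unitary

theorem isClosed_unitary_clm {E : Type*} [NormedAddCommGroup E] [InnerProductSpace ℂ E]
    [CompleteSpace E] : IsClosed (unitary (E →L[ℂ] E) : Set (E →L[ℂ] E)) :=
  isClosed_unitary_of_cstar (A := E →L[ℂ] E)

variable {𝓗 : Type*} [NormedAddCommGroup 𝓗] [InnerProductSpace ℂ 𝓗] [CompleteSpace 𝓗]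

/-- The Hilbert sum of a family of isometries of the summands. -/
noncomputable def lpCongr {ι : Type*} {G : ι → Type*} [∀ i, NormedAddCommGroup (G i)]
    [∀ i, InnerProductSpace ℂ (G i)] (u : ∀ i, G i ≃ₗᵢ[ℂ] G i) : lp G 2 ≃ₗᵢ[ℂ] lp G 2 where
  toFun f := ⟨fun i => u i (f i), by
    have h := lp.memℓp f
    rw [memℓp_gen_iff (by simp)] at h
    refine memℓp_gen ?_
    simpa using h⟩
  invFun f := ⟨fun i => (u i).symm (f i), by
    have h := lp.memℓp f
    rw [memℓp_gen_iff (by simp)] at h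
    refine memℓp_gen ?_
    simpa using h⟩
  map_add' f g := lp.ext (funext fun i => map_add (u i) (f i) (g i))
  map_smul' c f := lp.ext (funext fun i => by simp)
  left_inv f := lp.ext (funext fun i => by simp)
  right_inv f := lp.ext (funext fun i => by simp)
  norm_map' f := by
    rw [lp.norm_eq_tsum_rpow (by simp), lp.norm_eq_tsum_rpow (by simp)]
    simp

variable {ι : Type*} {S : ι → Submodule ℂ 𝓗} [∀ i, FiniteDimensional ℂ (S i)]
  (hS : IsHilbertSum ℂ (fun i => S i) fun i => (S i).subtypeₗᵢ)

theorem projOnto_of_mem_of_ne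
    (hS : IsHilbertSum ℂ (fun i => S i) fun i => (S i).subtypeₗᵢ)
    {i j : ι} (hij : i ≠ j) {ψ : 𝓗} (hψ : ψ ∈ S j) :
    (S i).orthogonalProjectionOnto ψ = 0 := by
  rw [Submodule.orthogonalProjectionOnto_eq_zero_iff, Submodule.mem_orthogonal]
  exact fun φ hφ => hS.OrthogonalFamily hij ⟨φ, hφ⟩ ⟨ψ, hψ⟩

theorem hasSum_projOnto
    (hS : IsHilbertSum ℂ (fun i => S i) fun i => (S i).subtypeₗᵢ)
    (ψ : 𝓗) :
    HasSum (fun i => ((S i).orthogonalProjectionOnto ψ : 𝓗)) ψ := by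
  classical
  have h := hS.hasSum_linearIsometryEquiv_symm (hS.linearIsometryEquiv ψ)
  rw [LinearIsometryEquiv.symm_apply_apply] at h
  convert! h using 2 with i
  have hi := h.mapL (S i).orthogonalProjectionOnto
  have h2 := hi.unique (hasSum_single i fun j hj => projOnto_of_mem_of_ne hS hj.symm
    (Submodule.coe_mem _))
  rw [h2]
  simp

/-- Identifies the coordinates of the abstract Hilbert sum with orthogonal projections, which allows
unitaries built on the ℓ² side to be computed on 𝓗. -/
theorem linearIsometryEquiv_apply_eq
    (hS : IsHilbertSum ℂ (fun i => S i) fun i => (S i).subtypeₗᵢ)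
    (ψ : 𝓗) (i : ι) :
    hS.linearIsometryEquiv ψ i = (S i).orthogonalProjectionOnto ψ := by
  classical
  have h := hS.hasSum_linearIsometryEquiv_symm (hS.linearIsometryEquiv ψ)
  rw [LinearIsometryEquiv.symm_apply_apply] at h
  have hi := h.mapL (S i).orthogonalProjectionOnto
  have h2 := hi.unique (hasSum_single i fun j hj => projOnto_of_mem_of_ne hS hj.symm
    (Submodule.coe_mem _))
  rw [h2]
  simp

theorem ext_projOnto
    (hS : IsHilbertSum ℂ (fun i => S i) fun i => (S i).subtypeₗᵢ)
    {φ ψ : 𝓗}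
    (h : ∀ i, (S i).orthogonalProjectionOnto φ = (S i).orthogonalProjectionOnto ψ) : φ = ψ := by
  refine (hasSum_projOnto hS φ).unique ?_
  simp only [h]
  exact hasSum_projOnto hS ψ

theorem ext_on_blocks
    (hS : IsHilbertSum ℂ (fun i => S i) fun i => (S i).subtypeₗᵢ)
    {U W : 𝓗 →L[ℂ] 𝓗} (h : ∀ i, ∀ ψ ∈ S i, U ψ = W ψ) : U = W := by
  ext ψ
  have h1 := (hasSum_projOnto hS ψ).mapL U
  have h2 := (hasSum_projOnto hS ψ).mapL W
  simp only [fun i => h i _ (Submodule.coe_mem ((S i).orthogonalProjectionOnto ψ))] at h1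
  exact h1.unique h2

/-- The unitary with given unitary blocks. -/
noncomputable def blockUnitary :
    (∀ i, unitary (S i →L[ℂ] S i)) →* unitary (𝓗 →L[ℂ] 𝓗) where
  toFun u := Unitary.linearIsometryEquiv.symm
    ((hS.linearIsometryEquiv.trans
      (lpCongr fun i => Unitary.linearIsometryEquiv (u i))).trans hS.linearIsometryEquiv.symm)
  map_one' := by
    refine Subtype.ext (ContinuousLinearMap.ext fun ψ => hS.linearIsometryEquiv.injective ?_)
    refine Eq.trans (LinearIsometryEquiv.apply_symm_apply _ _) (lp.ext (funext fun i => rfl))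
  map_mul' u v := by
    refine Subtype.ext (ContinuousLinearMap.ext fun ψ => hS.linearIsometryEquiv.injective ?_)
    refine Eq.trans (LinearIsometryEquiv.apply_symm_apply _ _) ?_
    refine Eq.symm (Eq.trans (LinearIsometryEquiv.apply_symm_apply _ _)
      (lp.ext (funext fun i => ?_)))
    have := congrArg (fun f : lp (fun i => S i) 2 => (u i : S i →L[ℂ] S i) (f i))
      (LinearIsometryEquiv.apply_symm_apply hS.linearIsometryEquiv
        (lpCongr (fun i => Unitary.linearIsometryEquiv (v i)) (hS.linearIsometryEquiv ψ)))
    exact this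

theorem projOnto_blockUnitary (u : ∀ i, unitary (S i →L[ℂ] S i)) (ψ : 𝓗) (i : ι) :
    (S i).orthogonalProjectionOnto ((blockUnitary hS u : 𝓗 →L[ℂ] 𝓗) ψ) =
      (u i : S i →L[ℂ] S i) ((S i).orthogonalProjectionOnto ψ) := by
  rw [← linearIsometryEquiv_apply_eq hS, ← linearIsometryEquiv_apply_eq hS]
  have := congrArg (fun f : lp (fun i => S i) 2 => f i)
      (LinearIsometryEquiv.apply_symm_apply hS.linearIsometryEquiv
        (lpCongr (fun i => Unitary.linearIsometryEquiv (u i)) (hS.linearIsometryEquiv ψ)))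
  exact this

theorem hasSum_blockUnitary (u : ∀ i, unitary (S i →L[ℂ] S i)) (ψ : 𝓗) :
    HasSum (fun i => ((u i : S i →L[ℂ] S i) ((S i).orthogonalProjectionOnto ψ) : 𝓗))
      ((blockUnitary hS u : 𝓗 →L[ℂ] 𝓗) ψ) := by
  simp only [← projOnto_blockUnitary hS]
  exact hasSum_projOnto hS _

theorem blockUnitary_apply_of_mem (u : ∀ i, unitary (S i →L[ℂ] S i)) {i : ι} (ψ : S i) :
    (blockUnitary hS u : 𝓗 →L[ℂ] 𝓗) ψ = ((u i : S i →L[ℂ] S i) ψ : 𝓗) := by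
  refine (hasSum_blockUnitary hS u ψ).unique ?_
  have := hasSum_single (f := fun j =>
    ((u j : S j →L[ℂ] S j) ((S j).orthogonalProjectionOnto (ψ : 𝓗)) : 𝓗)) i fun j hj => by
    rw [projOnto_of_mem_of_ne hS hj ψ.2]; simp
  simpa using this

theorem eq_blockUnitary_of_hasSum {u : ∀ i, unitary (S i →L[ℂ] S i)} {U : unitary (𝓗 →L[ℂ] 𝓗)}
    (h : ∀ ψ, HasSum (fun i => ((u i : S i →L[ℂ] S i) ((S i).orthogonalProjectionOnto ψ) : 𝓗))
      ((U : 𝓗 →L[ℂ] 𝓗) ψ)) : U = blockUnitary hS u :=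
  Subtype.ext (ContinuousLinearMap.ext fun ψ => (h ψ).unique (hasSum_blockUnitary hS u ψ))

/-- A unitary that preserves all blocks, together with its inverse, is block diagonal. -/
theorem exists_eq_blockUnitary {U : unitary (𝓗 →L[ℂ] 𝓗)}
    (h : ∀ i, ∀ ψ ∈ S i, (U : 𝓗 →L[ℂ] 𝓗) ψ ∈ S i)
    (h' : ∀ i, ∀ ψ ∈ S i, ((U⁻¹ : unitary (𝓗 →L[ℂ] 𝓗)) : 𝓗 →L[ℂ] 𝓗) ψ ∈ S i) :
    ∃ u, U = blockUnitary hS u := by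
  have h1 : ∀ ψ, (U : 𝓗 →L[ℂ] 𝓗) (((U⁻¹ : unitary (𝓗 →L[ℂ] 𝓗)) : 𝓗 →L[ℂ] 𝓗) ψ) = ψ := fun ψ => by
    have : ((U * U⁻¹ : unitary (𝓗 →L[ℂ] 𝓗)) : 𝓗 →L[ℂ] 𝓗) ψ = ψ := by rw [mul_inv_cancel]; rfl
    exact this
  have h2 : ∀ ψ, ((U⁻¹ : unitary (𝓗 →L[ℂ] 𝓗)) : 𝓗 →L[ℂ] 𝓗) ((U : 𝓗 →L[ℂ] 𝓗) ψ) = ψ := fun ψ => by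
    have : ((U⁻¹ * U : unitary (𝓗 →L[ℂ] 𝓗)) : 𝓗 →L[ℂ] 𝓗) ψ = ψ := by rw [inv_mul_cancel]; rfl
    exact this
  let e : ∀ i, S i ≃ₗᵢ[ℂ] S i := fun i =>
    { toFun := fun ψ => ⟨_, h i ψ ψ.2⟩
      invFun := fun ψ => ⟨_, h' i ψ ψ.2⟩
      map_add' := fun a b => Subtype.ext (by simp)
      map_smul' := fun c a => Subtype.ext (by simp)
      left_inv := fun ψ => Subtype.ext (h2 ψ)
      right_inv := fun ψ => Subtype.ext (h1 ψ)
      norm_map' := fun ψ => unitary_norm U ψ }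
  refine ⟨fun i => Unitary.linearIsometryEquiv.symm (e i), Subtype.ext (ext_on_blocks hS ?_)⟩
  intro i ψ hψ
  rw [blockUnitary_apply_of_mem hS _ ⟨ψ, hψ⟩]
  rfl

/-! ### The strong topology -/

theorem continuous_strongTopology_iff {X : Type*} [TopologicalSpace X]
    {f : X → unitary (𝓗 →L[ℂ] 𝓗)} :
    Continuous[_, strongTopology 𝓗] f ↔ ∀ ψ : 𝓗, Continuous fun x => (f x : 𝓗 →L[ℂ] 𝓗) ψ := by
  rw [continuous_induced_rng]
  exact ⟨fun h ψ => (PointwiseConvergenceCLM.evalCLM (RingHom.id ℂ) 𝓗 ψ).continuous.comp h,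
    fun h => PointwiseConvergenceCLM.continuous_of_continuous_eval h⟩

theorem continuous_strongTopology_apply (ψ : 𝓗) :
    Continuous[strongTopology 𝓗, _] fun U : unitary (𝓗 →L[ℂ] 𝓗) => (U : 𝓗 →L[ℂ] 𝓗) ψ :=
  letI := strongTopology 𝓗
  continuous_strongTopology_iff.1 continuous_id ψ

/-- On a finite partial sum of ψ only finitely many blocks act, and continuously. Truncating ψ
causes an error that is uniform in u because unitaries are isometric. -/
theorem continuous_blockUnitary : Continuous[_, strongTopology 𝓗] (blockUnitary hS) := by
  rw [continuous_strongTopology_iff]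
  intro ψ
  have hlim := hasSum_projOnto hS ψ
  refine TendstoUniformly.continuous (p := Filter.atTop)
    (F := fun (s : Finset ι) u => (blockUnitary hS u : 𝓗 →L[ℂ] 𝓗)
      (∑ i ∈ s, ((S i).orthogonalProjectionOnto ψ : 𝓗))) ?_ ?_
  · rw [Metric.tendstoUniformly_iff]
    intro ε hε
    filter_upwards [Metric.tendsto_nhds.1 hlim ε hε] with s hs u
    rw [dist_eq_norm, ← map_sub, unitary_norm, ← dist_eq_norm, dist_comm]
    exact hs
  · refine Filter.Frequently.of_forall fun s => ?_
    simp only [map_sum, blockUnitary_apply_of_mem]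
    refine continuous_finsetSum _ fun i _ => ?_
    have h1 : Continuous fun u : ∀ i, unitary (S i →L[ℂ] S i) => (u i : S i →L[ℂ] S i) :=
      continuous_subtype_val.comp (continuous_apply i)
    exact continuous_subtype_val.comp (h1.clm_apply continuous_const)

/-- Compression to the blocks is strongly continuous and recovers u from `blockUnitary hS u`. The
image of C is thus the closed range intersected with the preimage of a closed set. -/
theorem isClosed_blockUnitary_image (hcl : IsClosed[strongTopology 𝓗]
      (Set.range (blockUnitary hS))) {C : Set (∀ i, unitary (S i →L[ℂ] S i))} (hC : IsClosed C) :
    IsClosed[strongTopology 𝓗] (blockUnitary hS '' C) := by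
  have hu : ∀ i, IsClosed (unitary (S i →L[ℂ] S i) : Set (S i →L[ℂ] S i)) :=
    fun i => isClosed_unitary_clm
  let := strongTopology 𝓗
  -- Compressions of an arbitrary unitary need not be unitary, so the values are operators. Finite
  -- dimension of the blocks makes pointwise continuity imply norm continuity.
  let x : unitary (𝓗 →L[ℂ] 𝓗) → ∀ i, S i →L[ℂ] S i := fun U i =>
    (S i).orthogonalProjectionOnto ∘L (U : 𝓗 →L[ℂ] 𝓗) ∘L (S i).subtypeL
  have hx : Continuous x := by
    refine continuous_pi fun i => continuous_clm_apply.2 fun ψ => ?_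
    exact ((S i).orthogonalProjectionOnto).continuous.comp
      (continuous_strongTopology_apply (ψ : 𝓗))
  have hemb : IsClosedEmbedding fun (u : ∀ i, unitary (S i →L[ℂ] S i)) i =>
      (u i : S i →L[ℂ] S i) :=
    IsClosedEmbedding.piMap fun i => (hu i).isClosedEmbedding_subtypeVal
  have hxb : ∀ u, x (blockUnitary hS u) = fun i => (u i : S i →L[ℂ] S i) := by
    intro u
    funext i
    ext ψ
    simp [x, projOnto_blockUnitary]
  have : blockUnitary hS '' C = Set.range (blockUnitary hS) ∩
      x ⁻¹' ((fun (u : ∀ i, unitary (S i →L[ℂ] S i)) i => (u i : S i →L[ℂ] S i)) '' C) := by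
    ext U
    constructor
    · rintro ⟨u, hu, rfl⟩
      exact ⟨⟨u, rfl⟩, u, hu, (hxb u).symm⟩
    · rintro ⟨⟨u, rfl⟩, v, hv, hvu⟩
      refine ⟨v, hv, ?_⟩
      rw [hxb] at hvu
      rw [hemb.injective hvu]
  rw [this]
  exact hcl.inter ((hemb.isClosedMap C hC).preimage hx)

end Block

/-! ### Operators on finite-dimensional spaces -/

section FiniteDimensional

variable {E : Type*} [NormedAddCommGroup E] [InnerProductSpace ℂ E] [FiniteDimensional ℂ E]

/-- The real part of the trace. -/
noncomputable def reTrace (E : Type*) [NormedAddCommGroup E] [InnerProductSpace ℂ E]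
    [FiniteDimensional ℂ E] : (E →L[ℂ] E) →ₗ[ℝ] ℝ where
  toFun a := (LinearMap.trace ℂ E (a : E →ₗ[ℂ] E)).re
  map_add' a b := by simp
  map_smul' c a := by
    have : ((c • a : E →L[ℂ] E) : E →ₗ[ℂ] E) = (c : ℂ) • (a : E →ₗ[ℂ] E) := by ext; simp
    rw [this, map_smul]
    simp

/-- The trace of a* a is the squared Hilbert–Schmidt norm, which bounds the operator norm by
Cauchy–Schwarz. -/
theorem isDominatingTrace_reTrace : IsDominatingTrace (reTrace E) where
  comm a b := by
    change (LinearMap.trace ℂ E ((a : E →ₗ[ℂ] E) * (b : E →ₗ[ℂ] E))).re =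
      (LinearMap.trace ℂ E ((b : E →ₗ[ℂ] E) * (a : E →ₗ[ℂ] E))).re
    rw [LinearMap.trace_mul_comm]
  le a := by
    let b := stdOrthonormalBasis ℂ E
    have h : reTrace E (star a * a) = ∑ i, ‖a (b i)‖ ^ 2 := by
      change (LinearMap.trace ℂ E ((star a * a : E →L[ℂ] E) : E →ₗ[ℂ] E)).re = _
      rw [LinearMap.trace_eq_sum_inner _ b, Complex.re_sum]
      refine Finset.sum_congr rfl fun i _ => ?_
      have h1 : ⟪b i, (star a * a : E →L[ℂ] E) (b i)⟫_ℂ = ⟪a (b i), a (b i)⟫_ℂ :=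
        ContinuousLinearMap.adjoint_inner_right a (b i) (a (b i))
      change (⟪b i, (star a * a : E →L[ℂ] E) (b i)⟫_ℂ).re = _
      rw [h1, ← inner_self_eq_norm_sq (𝕜 := ℂ)]
      rfl
    rw [h]
    have hs : 0 ≤ ∑ i, ‖a (b i)‖ ^ 2 := Finset.sum_nonneg fun i _ => sq_nonneg _
    have hle : ‖a‖ ≤ √(∑ i, ‖a (b i)‖ ^ 2) := by
      refine a.opNorm_le_bound (Real.sqrt_nonneg _) fun x => ?_
      have hx : a x = ∑ i, ⟪b i, x⟫_ℂ • a (b i) := by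
        conv_lhs => rw [← b.sum_repr' x]
        simp
      calc ‖a x‖ ≤ ∑ i, ‖⟪b i, x⟫_ℂ‖ * ‖a (b i)‖ := by
            rw [hx]
            refine (norm_sum_le _ _).trans (le_of_eq (Finset.sum_congr rfl fun i _ => norm_smul _ _))
        _ ≤ √(∑ i, ‖⟪b i, x⟫_ℂ‖ ^ 2) * √(∑ i, ‖a (b i)‖ ^ 2) :=
            Real.sum_mul_le_sqrt_mul_sqrt _ _ _
        _ = √(∑ i, ‖a (b i)‖ ^ 2) * ‖x‖ := by
            rw [b.sum_sq_norm_inner_right, Real.sqrt_sq (norm_nonneg x), mul_comm]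
    calc ‖a‖ ^ 2 ≤ √(∑ i, ‖a (b i)‖ ^ 2) ^ 2 := by gcongr
      _ = _ := Real.sq_sqrt hs

theorem exp_apply_eigenvector {a : E →L[ℂ] E} {c : ℂ} {v : E} (h : a v = c • v) :
    NormedSpace.exp a v = Complex.exp c • v := by
  have h1 := (NormedSpace.exp_series_hasSum_exp' (𝕂 := ℂ) a).mapL
    (ContinuousLinearMap.apply ℂ E v)
  have h2 := (NormedSpace.exp_series_hasSum_exp' (𝕂 := ℂ) c).smul_const v
  rw [← Complex.exp_eq_exp_ℂ] at h2
  refine h1.unique ?_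
  convert! h2 using 2 with n
  have hp : (a ^ n) v = c ^ n • v := by
    induction n with
    | zero => simp
    | succ n ih => rw [pow_succ', mul_apply_eq_comp, ih, map_smul, h, smul_smul, pow_succ]
  simp [hp, smul_smul]

/-- A unitary with finite spectrum is an exponential. -/
theorem exists_exp_eq_of_finite_spectrum {A : Type*} [CStarAlgebra A] {u : A} (hu : u ∈ unitary A)
    (hfin : (spectrum ℂ u).Finite) : ∃ a : A, star a = -a ∧ NormedSpace.exp a = u := by
  have hn : IsStarNormal u := isStarNormal_of_mem_unitary hu
  have hcont : ∀ f : ℂ → ℂ, ContinuousOn f (spectrum ℂ u) := fun f => hfin.continuousOn f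
  -- The argument jumps on the circle, but every function is continuous on a finite spectrum.
  refine ⟨cfc (fun z : ℂ => (Complex.arg z : ℂ) * Complex.I) u, ?_, ?_⟩
  · rw [← cfc_star, ← cfc_neg]
    simp
  · have hsn : IsStarNormal (cfc (fun z : ℂ => (Complex.arg z : ℂ) * Complex.I) u) := by
      infer_instance
    rw [← CFC.exp_eq_normedSpace_exp (𝕜 := ℂ),
      ← cfc_comp' (fun z => NormedSpace.exp z) (fun z : ℂ => (Complex.arg z : ℂ) * Complex.I) u
        (by exact (hfin.image _).continuousOn _) (hcont _)]
    conv_rhs => rw [← cfc_id' ℂ u]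
    refine cfc_congr fun z hz => ?_
    have hz1 : ‖z‖ = 1 := by
      simpa using spectrum.subset_circle_of_unitary hu hz
    have := Complex.norm_mul_exp_arg_mul_I z
    rw [hz1] at this
    simpa [← Complex.exp_eq_exp_ℂ] using this

theorem finite_spectrum_clm (u : E →L[ℂ] E) : (spectrum ℂ u).Finite := by
  have h := AlgEquiv.spectrum_eq (Module.End.toContinuousLinearMap (𝕜 := ℂ) E)
    (u : E →ₗ[ℂ] E)
  have h2 : Module.End.toContinuousLinearMap (𝕜 := ℂ) E (u : E →ₗ[ℂ] E) = u := by ext; rfl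
  rw [h2] at h
  rw [h]
  exact Module.End.finite_spectrum _

/-- Every unitary on a finite-dimensional space is an exponential. -/
theorem exists_expUnitary_eq (u : unitary (E →L[ℂ] E)) :
    ∃ a : skewAdjoint (E →L[ℂ] E), expUnitary a = u := by
  obtain ⟨a, ha, hau⟩ := exists_exp_eq_of_finite_spectrum u.2 (finite_spectrum_clm _)
  exact ⟨⟨a, ha⟩, Subtype.ext hau⟩

theorem exists_orthonormalBasis_eigen {h : E →L[ℂ] E} (hh : IsSelfAdjoint h) :
    ∃ (b : OrthonormalBasis (Fin (Module.finrank ℂ E)) ℂ E) (l : Fin (Module.finrank ℂ E) → ℝ),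
      ∀ i, h (b i) = (l i : ℂ) • b i :=
  have hs : ((h : E →L[ℂ] E) : E →ₗ[ℂ] E).IsSymmetric :=
    ContinuousLinearMap.isSelfAdjoint_iff_isSymmetric.1 hh
  ⟨hs.eigenvectorBasis rfl, hs.eigenvalues rfl, hs.apply_eigenvectorBasis rfl⟩

end FiniteDimensional

/-! ### Diagonal operators -/

section Diagonal

variable {𝓗 : Type*} [NormedAddCommGroup 𝓗] [InnerProductSpace ℂ 𝓗] [CompleteSpace 𝓗]
  {ι : Type*} (b : HilbertBasis ι ℂ 𝓗) (l : ι → ℝ)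

theorem basis_hasSum (ψ : 𝓗) : HasSum (fun i => ⟪b i, ψ⟫_ℂ • b i) ψ := by
  simpa only [b.repr_apply_apply] using b.hasSum_repr ψ

theorem basis_inner [DecidableEq ι] (i j : ι) : ⟪b i, b j⟫_ℂ = if i = j then 1 else 0 :=
  orthonormal_iff_ite.1 b.orthonormal i j

theorem basis_ext {φ ψ : 𝓗} (h : ∀ i, ⟪b i, φ⟫_ℂ = ⟪b i, ψ⟫_ℂ) : φ = ψ := by
  refine (basis_hasSum b φ).unique ?_
  simp only [h]
  exact basis_hasSum b ψ

theorem basis_ext_clm {A B : 𝓗 →L[ℂ] 𝓗} (h : ∀ i, A (b i) = B (b i)) : A = B := by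
  ext ψ
  have h1 := (basis_hasSum b ψ).mapL A
  simp only [map_smul, h] at h1
  refine h1.unique ?_
  simpa using (basis_hasSum b ψ).mapL B

theorem basis_hasSum_normSq (ψ : 𝓗) : HasSum (fun i => ‖⟪b i, ψ⟫_ℂ‖ ^ 2) (‖ψ‖ ^ 2) := by
  have h := Complex.reCLM.hasSum (b.hasSum_inner_mul_inner ψ ψ)
  convert! h using 2 with i
  · simp only [Complex.reCLM_apply]
    have h1 : (⟪ψ, b i⟫_ℂ * ⟪b i, ψ⟫_ℂ).re = ‖⟪ψ, b i⟫_ℂ * ⟪b i, ψ⟫_ℂ‖ :=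
      inner_mul_symm_re_eq_norm (𝕜 := ℂ) ψ (b i)
    rw [h1, norm_mul, norm_inner_symm ψ (b i)]
    ring
  · exact (inner_self_eq_norm_sq (𝕜 := ℂ) ψ).symm

theorem basis_memℓp (ψ : 𝓗) : Memℓp (fun i => ⟪b i, ψ⟫_ℂ) 2 := by
  have h := lp.memℓp (b.repr ψ)
  have h2 : (b.repr ψ : ι → ℂ) = fun i => ⟪b i, ψ⟫_ℂ := funext fun i => b.repr_apply_apply ψ i
  rwa [h2] at h

theorem memℓp_two_iff {c : ι → ℂ} : Memℓp c 2 ↔ Summable fun i => ‖c i‖ ^ 2 := by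
  rw [memℓp_gen_iff (by simp)]
  simp

theorem basis_inner_repr_symm {c : ι → ℂ} (hc : Memℓp c 2) (i : ι) :
    ⟪b i, b.repr.symm ⟨c, hc⟩⟫_ℂ = c i := by
  rw [← b.repr_apply_apply, LinearIsometryEquiv.apply_symm_apply]

/-- The operator that is diagonal in a Hilbert basis, with real eigenvalues, on its maximal
domain. -/
noncomputable def diagOp : 𝓗 →ₗ.[ℂ] 𝓗 where
  domain :=
    { carrier := {ψ | Memℓp (fun i => (l i : ℂ) * ⟪b i, ψ⟫_ℂ) 2}
      add_mem' := fun {φ ψ} hφ hψ => by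
        have := Memℓp.add hφ hψ
        simp only [Set.mem_ofPred_eq, inner_add_right, mul_add]
        exact this
      zero_mem' := by
        simp only [Set.mem_ofPred_eq, inner_zero_right, mul_zero]
        exact zero_memℓp
      smul_mem' := fun c ψ hψ => by
        have := Memℓp.const_smul hψ c
        simp only [Set.mem_ofPred_eq, inner_smul_right, mul_left_comm _ c]
        exact this }
  toFun :=
    { toFun := fun ψ => b.repr.symm ⟨fun i => (l i : ℂ) * ⟪b i, (ψ : 𝓗)⟫_ℂ, ψ.2⟩
      map_add' := fun φ ψ => basis_ext b fun i => by
        rw [inner_add_right, basis_inner_repr_symm, basis_inner_repr_symm, basis_inner_repr_symm,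
          Submodule.coe_add, inner_add_right, mul_add]
      map_smul' := fun c ψ => basis_ext b fun i => by
        rw [RingHom.id_apply, inner_smul_right, basis_inner_repr_symm, basis_inner_repr_symm,
          Submodule.coe_smul, inner_smul_right, mul_left_comm] }

/-- No separate domain condition is needed: the coordinates of φ are square summable, and they are
the products whose summability defines the domain. -/
theorem mem_diagOp_graph_iff {φ ψ : 𝓗} :
    (ψ, φ) ∈ (diagOp b l).graph ↔ ∀ i, ⟪b i, φ⟫_ℂ = (l i : ℂ) * ⟪b i, ψ⟫_ℂ := by
  rw [LinearPMap.mem_graph_iff]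
  constructor
  · rintro ⟨x, hx, rfl⟩ i
    simp only at hx
    rw [← hx]
    exact basis_inner_repr_symm b x.2 i
  · intro h
    have hmem : Memℓp (fun i => (l i : ℂ) * ⟪b i, ψ⟫_ℂ) 2 := by
      simp only [← h]
      exact basis_memℓp b φ
    refine ⟨⟨ψ, hmem⟩, rfl, basis_ext b fun i => ?_⟩
    rw [h]
    exact basis_inner_repr_symm b hmem i

theorem basis_mem_diagOp_graph (i : ι) : (b i, (l i : ℂ) • b i) ∈ (diagOp b l).graph := by
  classical
  rw [mem_diagOp_graph_iff]
  intro j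
  rw [inner_smul_right, basis_inner]
  split_ifs with h
  · rw [h]
  · simp

theorem basis_mem_diagOp_domain (i : ι) : b i ∈ (diagOp b l).domain :=
  LinearPMap.mem_domain_of_mem_graph (basis_mem_diagOp_graph b l i)

theorem diagOp_dense : Dense ((diagOp b l).domain : Set 𝓗) := by
  have h : Submodule.span ℂ (Set.range b) ≤ (diagOp b l).domain :=
    Submodule.span_le.2 (by rintro _ ⟨i, rfl⟩; exact basis_mem_diagOp_domain b l i)
  exact (Submodule.dense_iff_topologicalClosure_eq_top.2 b.dense_span).mono h

theorem mem_graph_adjoint_iff {g : Submodule ℂ (𝓗 × 𝓗)} {x : 𝓗 × 𝓗} :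
    x ∈ g.adjoint ↔ ∀ y ∈ g, ⟪y.2, x.1⟫_ℂ = ⟪y.1, x.2⟫_ℂ := by
  rw [Submodule.mem_adjoint_iff]
  exact ⟨fun h y hy => sub_eq_zero.1 (h y.1 y.2 hy), fun h a c hac => sub_eq_zero.2 (h _ hac)⟩

theorem diagOp_graph_of_symm {φ ψ : 𝓗} (h : ∀ i, ⟪(l i : ℂ) • b i, ψ⟫_ℂ = ⟪b i, φ⟫_ℂ) :
    (ψ, φ) ∈ (diagOp b l).graph := by
  rw [mem_diagOp_graph_iff]
  intro i
  rw [← h, inner_smul_left, Complex.conj_ofReal]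

/-- Testing the adjoint relation on the basis vectors alone already yields the coordinate equations
of the graph; the other inclusion is Parseval with real eigenvalues. -/
theorem diagOp_isSelfAdjoint : IsSelfAdjoint (diagOp b l) := by
  rw [LinearPMap.isSelfAdjoint_def]
  refine LinearPMap.eq_of_eq_graph ?_
  rw [LinearPMap.adjoint_graph_eq_graph_adjoint (diagOp_dense b l)]
  ext ⟨ψ, φ⟩
  rw [mem_graph_adjoint_iff]
  constructor
  · intro h
    exact diagOp_graph_of_symm b l fun i => h _ (basis_mem_diagOp_graph b l i)
  · rintro h ⟨x, y⟩ hy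
    rw [mem_diagOp_graph_iff] at h hy
    refine (b.hasSum_inner_mul_inner y ψ).unique ?_
    convert! b.hasSum_inner_mul_inner x φ using 2 with i
    rw [h i, ← inner_conj_symm y (b i), hy i, map_mul, Complex.conj_ofReal, inner_conj_symm]
    ring

/-- A closed operator having all `b i` as eigenvectors extends the diagonal operator. -/
theorem diagOp_le_of_isClosed {T : 𝓗 →ₗ.[ℂ] 𝓗} (hT : T.IsClosed)
    (h : ∀ i, (b i, (l i : ℂ) • b i) ∈ T.graph) : diagOp b l ≤ T := by
  refine LinearPMap.le_of_le_graph ?_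
  rintro ⟨ψ, φ⟩ hφ
  rw [mem_diagOp_graph_iff] at hφ
  have h1 := (basis_hasSum b ψ).prodMk (basis_hasSum b φ)
  refine hT.mem_of_tendsto h1 (Filter.Eventually.of_forall fun s => ?_)
  refine T.graph.sum_mem fun i _ => ?_
  have := T.graph.smul_mem ⟪b i, ψ⟫_ℂ (h i)
  rw [hφ i, mul_comm, mul_smul]
  exact this

/-- A selfadjoint operator is determined by a Hilbert basis of eigenvectors. -/
theorem eq_diagOp {T : 𝓗 →ₗ.[ℂ] 𝓗} (hT : IsSelfAdjoint T)
    (h : ∀ i, (b i, (l i : ℂ) • b i) ∈ T.graph) : T = diagOp b l := by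
  refine le_antisymm (LinearPMap.le_of_le_graph ?_) (diagOp_le_of_isClosed b l hT.isClosed h)
  rintro ⟨ψ, φ⟩ hφ
  rw [← LinearPMap.isSelfAdjoint_def.1 hT,
    LinearPMap.adjoint_graph_eq_graph_adjoint hT.dense_domain, mem_graph_adjoint_iff] at hφ
  exact diagOp_graph_of_symm b l fun i => hφ _ (h i)

/-- The closure of the restriction is a closed operator that still has every b i as an eigenvector,
so it extends the whole diagonal operator. -/
theorem diagOp_hasCore {S : Submodule ℂ 𝓗} (hS : S ≤ (diagOp b l).domain) (hb : ∀ i, b i ∈ S) :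
    (diagOp b l).HasCore S := by
  have hcl : ((diagOp b l).domRestrict S).IsClosable :=
    (diagOp_isSelfAdjoint b l).isClosed.isClosable.leIsClosable LinearPMap.domRestrict_le
  refine ⟨hS, le_antisymm ?_ ?_⟩
  · refine LinearPMap.le_of_le_graph ?_
    rw [← hcl.graph_closure_eq_closure_graph]
    exact Submodule.topologicalClosure_minimal _ (LinearPMap.le_graph_of_le
      LinearPMap.domRestrict_le) (diagOp_isSelfAdjoint b l).isClosed
  · refine diagOp_le_of_isClosed b l hcl.closure_isClosed fun i => ?_
    refine LinearPMap.le_graph_of_le (LinearPMap.le_closure _) ?_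
    rw [LinearPMap.mem_graph_iff]
    obtain ⟨x, hx, hx'⟩ := (LinearPMap.mem_graph_iff _).1 (basis_mem_diagOp_graph b l i)
    refine ⟨⟨b i, hb i, basis_mem_diagOp_domain b l i⟩, rfl, ?_⟩
    rw [← hx']
    exact LinearPMap.domRestrict_apply hx.symm

/-! ### The unitary group of a diagonal operator -/

theorem mem_generator_graph_iff {V : ℝ → unitary (𝓗 →L[ℂ] 𝓗)} {φ ψ : 𝓗} :
    (ψ, φ) ∈ (generator V).graph ↔ HasDerivAt (fun t => (V t : 𝓗 →L[ℂ] 𝓗) ψ) φ 0 := by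
  rw [LinearPMap.mem_graph_iff]
  constructor
  · rintro ⟨⟨x, hx⟩, rfl, rfl⟩
    exact DifferentiableAt.hasDerivAt hx
  · intro h
    exact ⟨⟨ψ, h.differentiableAt⟩, rfl, h.deriv⟩

theorem mem_smul_graph_iff {T : 𝓗 →ₗ.[ℂ] 𝓗} {φ ψ : 𝓗} :
    (ψ, φ) ∈ (Complex.I • T).graph ↔ (ψ, (-Complex.I) • φ) ∈ T.graph := by
  rw [LinearPMap.mem_graph_iff, LinearPMap.mem_graph_iff]
  constructor
  · rintro ⟨x, hx, hx'⟩
    refine ⟨x, hx, ?_⟩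
    simp only at hx' ⊢
    rw [← hx', LinearPMap.smul_apply, smul_smul]
    simp
  · rintro ⟨x, hx, hx'⟩
    refine ⟨x, hx, ?_⟩
    simp only at hx' ⊢
    rw [LinearPMap.smul_apply, hx', smul_smul]
    simp

variable {b l} in
theorem inner_diagGroup {V : ℝ → unitary (𝓗 →L[ℂ] 𝓗)}
    (hV : ∀ t i, (V t : 𝓗 →L[ℂ] 𝓗) (b i) = Complex.exp (Complex.I * l i * t) • b i)
    (t : ℝ) (i : ι) (ψ : 𝓗) :
    ⟪b i, (V t : 𝓗 →L[ℂ] 𝓗) ψ⟫_ℂ = Complex.exp (Complex.I * l i * t) * ⟪b i, ψ⟫_ℂ := by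
  have h1 := unitary_inner (V t) (b i) ψ
  rw [hV, inner_smul_left] at h1
  rw [← h1, ← mul_assoc, ← Complex.exp_conj, ← Complex.exp_add]
  simp

variable {b l} in
-- Differentiating coordinates shows that the generator is contained in the diagonal operator.
-- Conversely, on the maximal domain the coordinatewise difference quotients converge in ℓ² by
-- dominated convergence.
theorem generator_diagGroup {V : ℝ → unitary (𝓗 →L[ℂ] 𝓗)}
    (hV : ∀ t i, (V t : 𝓗 →L[ℂ] 𝓗) (b i) = Complex.exp (Complex.I * l i * t) • b i) :
    generator V = Complex.I • diagOp b l := by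
  refine LinearPMap.eq_of_eq_graph ?_
  ext ⟨ψ, φ⟩
  rw [mem_generator_graph_iff, mem_smul_graph_iff, mem_diagOp_graph_iff]
  have hscal : ∀ i, HasDerivAt (fun t : ℝ => Complex.exp (Complex.I * l i * t))
      (Complex.I * l i) 0 := fun i => by
    simpa using hasDerivAt_exp_smul (Complex.I * l i) (1 : ℂ)
  constructor
  · intro h i
    have h1 := ((innerSL ℂ (b i)).restrictScalars ℝ).hasFDerivAt.comp_hasDerivAt 0 h
    have h2 : HasDerivAt (fun t : ℝ => ⟪b i, (V t : 𝓗 →L[ℂ] 𝓗) ψ⟫_ℂ) ⟪b i, φ⟫_ℂ 0 := h1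
    simp only [inner_diagGroup hV] at h2
    have h3 := h2.unique ((hscal i).mul_const ⟪b i, ψ⟫_ℂ)
    rw [inner_smul_right, h3, ← mul_assoc, ← mul_assoc]
    simp
  · intro h
    have hφ : ∀ i, ⟪b i, φ⟫_ℂ = Complex.I * l i * ⟪b i, ψ⟫_ℂ := fun i => by
      have := h i
      rw [inner_smul_right] at this
      rw [mul_assoc, ← this, ← mul_assoc]
      simp
    have hV0 : (V 0 : 𝓗 →L[ℂ] 𝓗) ψ = ψ := basis_ext b fun i => by
      rw [inner_diagGroup hV]; simp
    rw [hasDerivAt_iff_tendsto_slope, tendsto_iff_norm_sub_tendsto_zero]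
    have hsq : ∀ t : ℝ, ‖slope (fun t => (V t : 𝓗 →L[ℂ] 𝓗) ψ) 0 t - φ‖ ^ 2 =
        ∑' i, ‖slope (fun t : ℝ => Complex.exp (Complex.I * l i * t)) 0 t - Complex.I * l i‖ ^ 2 *
          ‖⟪b i, ψ⟫_ℂ‖ ^ 2 := by
      intro t
      rw [← (basis_hasSum_normSq b _).tsum_eq]
      refine tsum_congr fun i => ?_
      rw [← mul_pow, ← norm_mul]
      congr 2
      simp only [slope, vsub_eq_sub, sub_zero, inner_sub_right, hφ, hV0]
      rw [← Complex.coe_smul, inner_smul_right, inner_sub_right, inner_diagGroup hV]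
      simp
      ring
    have hlim : Filter.Tendsto (fun t : ℝ =>
        ∑' i, ‖slope (fun t : ℝ => Complex.exp (Complex.I * l i * t)) 0 t - Complex.I * l i‖ ^ 2 *
          ‖⟪b i, ψ⟫_ℂ‖ ^ 2) (𝓝[≠] 0) (𝓝 (∑' _ : ι, 0)) := by
      -- Difference quotient and derivative are each at most |l i| in norm, so their difference
      -- squared is at most 4 |l i|².
      refine tendsto_tsum_of_dominated_convergence
        (bound := fun i => 4 * ‖⟪b i, φ⟫_ℂ‖ ^ 2)
        ((basis_hasSum_normSq b φ).summable.mul_left 4) (fun i => ?_) ?_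
      · have h1 := hasDerivAt_iff_tendsto_slope.1 (hscal i)
        rw [tendsto_iff_norm_sub_tendsto_zero] at h1
        simpa using (h1.pow 2).mul_const (‖⟪b i, ψ⟫_ℂ‖ ^ 2)
      · refine Filter.Eventually.of_forall fun t i => ?_
        rw [Real.norm_of_nonneg (by positivity), hφ, norm_mul, mul_pow, ← mul_assoc]
        gcongr
        have hI : ‖Complex.I * (l i : ℂ)‖ = |l i| := by simp
        have hs : ‖slope (fun t : ℝ => Complex.exp (Complex.I * l i * t)) 0 t‖ ≤ |l i| := by
          rw [slope, vsub_eq_sub, sub_zero, norm_smul, norm_inv, Real.norm_eq_abs]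
          have h1 := Real.norm_exp_I_mul_ofReal_sub_one_le (x := l i * t)
          have h2 : Complex.I * l i * t = Complex.I * ((l i * t : ℝ) : ℂ) := by push_cast; ring
          rw [h2, Complex.ofReal_zero, mul_zero, Complex.exp_zero]
          rcases eq_or_ne t 0 with rfl | ht
          · simp
          · calc |t|⁻¹ * ‖Complex.exp (Complex.I * ((l i * t : ℝ) : ℂ)) - 1‖
                ≤ |t|⁻¹ * ‖l i * t‖ := by gcongr
              _ = |l i| := by
                rw [norm_mul, Real.norm_eq_abs, Real.norm_eq_abs]
                field_simp
        have h4 : ‖slope (fun t : ℝ => Complex.exp (Complex.I * l i * t)) 0 t -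
            Complex.I * l i‖ ≤ 2 * |l i| := by
          refine (norm_sub_le _ _).trans ?_
          rw [hI]; linarith
        calc _ ≤ (2 * |l i|) ^ 2 := by gcongr
          _ = 4 * ‖Complex.I * (l i : ℂ)‖ ^ 2 := by rw [hI]; ring
    rw [tsum_zero] at hlim
    simp only [← hsq] at hlim
    have := hlim.sqrt
    simpa [Real.sqrt_sq (norm_nonneg _)] using this

variable {b l} in
theorem diagGroup_eq {V : ℝ → unitary (𝓗 →L[ℂ] 𝓗)} (hV : IsUnitaryGroup V)
    (hgen : generator V = Complex.I • diagOp b l) (t : ℝ) (i : ι) :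
    (V t : 𝓗 →L[ℂ] 𝓗) (b i) = Complex.exp (Complex.I * l i * t) • b i := by
  refine apply_eq_exp_smul_of_hasDerivAt hV.map_zero hV.map_add ?_ t
  rw [← mem_generator_graph_iff, hgen, mem_smul_graph_iff, smul_smul, ← mul_assoc]
  simpa using basis_mem_diagOp_graph b l i

variable {b l} in
-- Any group with this generator evolves each eigenvector b i by the same scalar exponential, and
-- the b i are total. The group chosen in `expGroup` is thereby determined.
theorem diagGroup_unique {V W : ℝ → unitary (𝓗 →L[ℂ] 𝓗)} (hV : IsUnitaryGroup V)
    (hVgen : generator V = Complex.I • diagOp b l)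
    (hW : ∀ t i, (W t : 𝓗 →L[ℂ] 𝓗) (b i) = Complex.exp (Complex.I * l i * t) • b i) : V = W :=
  funext fun t => Subtype.ext (basis_ext_clm b fun i => by
    rw [diagGroup_eq hV hVgen, hW])

variable {b l} in
theorem expGroup_diagOp {W : ℝ → unitary (𝓗 →L[ℂ] 𝓗)} (hWg : IsUnitaryGroup W)
    (hW : ∀ t i, (W t : 𝓗 →L[ℂ] 𝓗) (b i) = Complex.exp (Complex.I * l i * t) • b i) :
    expGroup (Complex.I • diagOp b l) = W := by
  have hex : ∃ V : ℝ → unitary (𝓗 →L[ℂ] 𝓗), IsUnitaryGroup V ∧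
      generator V = Complex.I • diagOp b l := ⟨W, hWg, generator_diagGroup hW⟩
  rw [expGroup, dif_pos hex]
  exact diagGroup_unique hex.choose_spec.1 hex.choose_spec.2 hW

end Diagonal

/-! ### The spectral measure of a diagonal operator -/

section DiagonalSpectral

variable {𝓗 : Type*} [NormedAddCommGroup 𝓗] [InnerProductSpace ℂ 𝓗] [CompleteSpace 𝓗]

namespace SpectralMeasure

variable (E : SpectralMeasure 𝓗)

theorem scalarMeasure_apply (ψ : 𝓗) {B : Set ℝ} (hB : MeasurableSet B) :
    E.scalarMeasure ψ B = ENNReal.ofReal (‖E.proj B ψ‖ ^ 2) := by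
  rw [SpectralMeasure.scalarMeasure, Measure.ofMeasurable_apply _ hB]

instance (ψ : 𝓗) : IsFiniteMeasure (E.scalarMeasure ψ) :=
  ⟨by rw [E.scalarMeasure_apply ψ MeasurableSet.univ]; exact ENNReal.ofReal_lt_top⟩

/-- Guarantees that the integral of x in `IsSpectralMeasureOf` is a genuine first moment and not the
default value 0; the bound is |x| ≤ 1 + x². -/
theorem integrable_id {ψ : 𝓗} (h : ∫⁻ x, ENNReal.ofReal (x ^ 2) ∂(E.scalarMeasure ψ) < ∞) :
    Integrable (fun x : ℝ => x) (E.scalarMeasure ψ) := by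
  have hsq : Integrable (fun x : ℝ => x ^ 2) (E.scalarMeasure ψ) := by
    refine ⟨by fun_prop, ?_⟩
    rwa [hasFiniteIntegral_iff_ofReal (Filter.Eventually.of_forall fun x => sq_nonneg x)]
  refine ((integrable_const (1 : ℝ)).add hsq).mono' (by fun_prop)
    (Filter.Eventually.of_forall fun x => ?_)
  simp only [Pi.add_apply, Real.norm_eq_abs]
  nlinarith [sq_nonneg (|x| - 1), sq_abs x, abs_nonneg x]

end SpectralMeasure

variable  {ι : Type*} (b : HilbertBasis ι ℂ 𝓗) (l : ι → ℝ)

/-- The projection onto the closed span of the `b i` with `l i ∈ B`. -/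
noncomputable def diagProj (B : Set ℝ) : 𝓗 →L[ℂ] 𝓗 :=
  (Submodule.span ℂ (b '' (l ⁻¹' B))).topologicalClosure.starProjection

open Classical in
theorem diagProj_basis (B : Set ℝ) (i : ι) :
    diagProj b l B (b i) = if l i ∈ B then b i else 0 := by
  split_ifs with h
  · exact Submodule.starProjection_eq_self_iff.2
      (Submodule.le_topologicalClosure _ (Submodule.subset_span ⟨i, h, rfl⟩))
  · refine (Submodule.starProjection_apply_eq_zero_iff _).2 ?_
    rw [Submodule.orthogonal_closure]
    refine (Submodule.mem_orthogonal _ _).2 fun x hx => ?_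
    induction hx using Submodule.span_induction with
    | mem x hx =>
      obtain ⟨j, hj, rfl⟩ := hx
      rw [basis_inner, if_neg]
      rintro rfl
      exact h hj
    | zero => simp
    | add x y _ _ hx hy => rw [inner_add_left, hx, hy, add_zero]
    | smul c x _ hx => rw [inner_smul_left, hx, mul_zero]

theorem diagProj_isStarProjection (B : Set ℝ) : IsStarProjection (diagProj b l B) :=
  isStarProjection_starProjection

open Classical in
theorem inner_diagProj (B : Set ℝ) (i : ι) (ψ : 𝓗) :
    ⟪b i, diagProj b l B ψ⟫_ℂ = if l i ∈ B then ⟪b i, ψ⟫_ℂ else 0 := by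
  have h := (ContinuousLinearMap.isSelfAdjoint_iff_isSymmetric.1
    (diagProj_isStarProjection b l B).isSelfAdjoint) (b i) ψ
  simp only [ContinuousLinearMap.coe_coe] at h
  rw [← h, diagProj_basis]
  split_ifs <;> simp

/-- The spectral measure of a diagonal operator. -/
noncomputable def diagSpectral : SpectralMeasure 𝓗 where
  proj := diagProj b l
  isStarProjection B _ := diagProj_isStarProjection b l B
  proj_empty := basis_ext_clm b fun i => by simp [diagProj_basis]
  proj_univ := basis_ext_clm b fun i => by simp [diagProj_basis]
  proj_inter B C _ _ := basis_ext_clm b fun i => by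
    classical
    rw [mul_apply_eq_comp, diagProj_basis, diagProj_basis]
    by_cases hB : l i ∈ B <;> by_cases hC : l i ∈ C <;> simp [hB, hC, diagProj_basis]
  hasSum_iUnion B _ hd ψ := by
    classical
    -- Countable additivity is an exchange of sums over this double family. By disjointness each
    -- basis index contributes for at most one n, so the double sum reduces to a sum over `s`.
    let f : ℕ × ι → 𝓗 := fun p => (if l p.2 ∈ B p.1 then ⟪b p.2, ψ⟫_ℂ else 0) • b p.2
    have hrow : ∀ n, HasSum (fun i => f (n, i)) (diagProj b l (B n) ψ) := fun n => by
      have := basis_hasSum b (diagProj b l (B n) ψ)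
      simpa only [inner_diagProj] using this
    refine HasSum.prod_fiberwise (f := f) ?_ hrow
    have htot := basis_hasSum b (diagProj b l (⋃ n, B n) ψ)
    simp only [inner_diagProj] at htot
    let s : Set ι := {i | l i ∈ ⋃ n, B n}
    rw [← hasSum_subtype_iff_of_support_subset (s := s)] at htot
    · have hex : ∀ i : s, ∃ n, l i ∈ B n := fun i => Set.mem_iUnion.1 i.2
      choose n hn using hex
      let g : s → ℕ × ι := fun i => (n i, i)
      have hg : Function.Injective g := fun i j hij => Subtype.ext (Prod.ext_iff.1 hij).2
      rw [← hg.hasSum_iff]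
      · convert! htot using 1
        funext i
        have h1 : l (i : ι) ∈ ⋃ n, B n := i.2
        simp only [f, g, Function.comp, if_pos (hn i), if_pos h1]
      · rintro ⟨m, i⟩ hmi
        simp only [f]
        rw [if_neg, zero_smul]
        intro hmem
        have hi : i ∈ s := Set.mem_iUnion.2 ⟨m, hmem⟩
        refine hmi ⟨⟨i, hi⟩, ?_⟩
        have : n ⟨i, hi⟩ = m := by
          by_contra hne
          exact Set.disjoint_left.1 (hd hne) (hn ⟨i, hi⟩) hmem
        simp [g, this]
    · intro i hi
      by_contra hc
      have hc' : l i ∉ ⋃ n, B n := hc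
      exact hi (by simp only [if_neg hc', zero_smul])

theorem diagSpectral_scalarMeasure (ψ : 𝓗) :
    (diagSpectral b l).scalarMeasure ψ =
      Measure.sum fun i => ENNReal.ofReal (‖⟪b i, ψ⟫_ℂ‖ ^ 2) • Measure.dirac (l i) := by
  classical
  ext B hB
  rw [SpectralMeasure.scalarMeasure_apply _ _ hB, Measure.sum_apply _ hB]
  have h := basis_hasSum_normSq b (diagProj b l B ψ)
  change ENNReal.ofReal (‖diagProj b l B ψ‖ ^ 2) = _
  rw [← h.tsum_eq, ENNReal.ofReal_tsum_of_nonneg (fun i => by positivity) h.summable]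
  refine tsum_congr fun i => ?_
  rw [inner_diagProj, Measure.smul_apply, Measure.dirac_apply' _ hB]
  by_cases hi : l i ∈ B <;> simp [hi]

theorem diagSpectral_isSpectralMeasureOf :
    (diagSpectral b l).IsSpectralMeasureOf (diagOp b l) := by
  have hlint : ∀ ψ, ∫⁻ x, ENNReal.ofReal (x ^ 2) ∂((diagSpectral b l).scalarMeasure ψ) =
      ∑' i, ENNReal.ofReal (‖(l i : ℂ) * ⟪b i, ψ⟫_ℂ‖ ^ 2) := by
    intro ψ
    rw [diagSpectral_scalarMeasure, lintegral_sum_measure]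
    refine tsum_congr fun i => ?_
    rw [lintegral_smul_measure, lintegral_dirac, smul_eq_mul,
      ← ENNReal.ofReal_mul (by positivity)]
    congr 1
    rw [norm_mul, mul_pow, mul_comm]
    simp
  have hdom : ∀ ψ, ψ ∈ (diagOp b l).domain ↔
      ∫⁻ x, ENNReal.ofReal (x ^ 2) ∂((diagSpectral b l).scalarMeasure ψ) < ∞ := by
    intro ψ
    rw [hlint]
    change Memℓp (fun i => (l i : ℂ) * ⟪b i, ψ⟫_ℂ) 2 ↔ _
    rw [memℓp_two_iff]
    constructor
    · intro h
      rw [← ENNReal.ofReal_tsum_of_nonneg (fun i => by positivity) h]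
      exact ENNReal.ofReal_lt_top
    · intro h
      have := ENNReal.summable_toReal h.ne
      simpa [ENNReal.toReal_ofReal, sq_nonneg] using this
  refine ⟨hdom, fun ψ => ?_⟩
  have hint := (diagSpectral b l).integrable_id ((hdom ψ).1 ψ.2)
  have h1 := b.hasSum_inner_mul_inner (ψ : 𝓗) (diagOp b l ψ)
  rw [diagSpectral_scalarMeasure] at hint ⊢
  have h2 := hasSum_integral_measure hint
  refine h1.unique ?_
  have h3 := Complex.hasSum_ofReal.2 h2
  convert! h3 using 2 with i
  have h4 : ⟪b i, diagOp b l ψ⟫_ℂ = (l i : ℂ) * ⟪b i, (ψ : 𝓗)⟫_ℂ :=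
    basis_inner_repr_symm b ψ.2 i
  rw [integral_smul_measure, integral_dirac, ENNReal.toReal_ofReal (by positivity), h4]
  have h5 : ⟪(ψ : 𝓗), b i⟫_ℂ * ⟪b i, (ψ : 𝓗)⟫_ℂ = ((‖⟪b i, (ψ : 𝓗)⟫_ℂ‖ ^ 2 : ℝ) : ℂ) := by
    rw [← inner_conj_symm (ψ : 𝓗) (b i), Complex.conj_mul']
    push_cast; rfl
  rw [mul_left_comm, h5, smul_eq_mul]
  push_cast
  ring

theorem diagProj_commute_starProjection {K : Submodule ℂ 𝓗} [K.HasOrthogonalProjection]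
    (hK : ∀ i, b i ∈ K ∨ b i ∈ Kᗮ) (B : Set ℝ) : Commute (diagProj b l B) K.starProjection := by
  classical
  refine basis_ext_clm b fun i => ?_
  rw [mul_apply_eq_comp, mul_apply_eq_comp, diagProj_basis]
  rcases hK i with h | h
  · rw [Submodule.starProjection_eq_self_iff.2 h, diagProj_basis]
    split_ifs
    · rw [Submodule.starProjection_eq_self_iff.2 h]
    · simp
  · rw [(Submodule.starProjection_apply_eq_zero_iff _).2 h]
    split_ifs
    · rw [(Submodule.starProjection_apply_eq_zero_iff _).2 h, map_zero]
    · simp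

end DiagonalSpectral

/-! ### Operators whose spectral measure preserves finite-dimensional subspaces -/

section Reducing

variable {𝓗 : Type*} [NormedAddCommGroup 𝓗] [InnerProductSpace ℂ 𝓗] [CompleteSpace 𝓗]

namespace SpectralMeasure

variable (E : SpectralMeasure 𝓗)

theorem inner_proj_proj (φ ψ : 𝓗) {B C : Set ℝ} (hB : MeasurableSet B) (hC : MeasurableSet C) :
    ⟪E.proj B φ, E.proj C ψ⟫_ℂ = ⟪φ, E.proj (B ∩ C) ψ⟫_ℂ := by
  rw [E.proj_inter B C hB hC]
  exact ContinuousLinearMap.isSelfAdjoint_iff_isSymmetric.1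
    (E.isStarProjection B hB).isSelfAdjoint φ (E.proj C ψ)

/-- The components of ψ for the intervals [n, n+1) are mutually orthogonal and stay in K, so the
nonzero ones are linearly independent. -/
theorem finite_floor_of_mem {K : Submodule ℂ 𝓗} [FiniteDimensional ℂ K]
    (hK : ∀ B, MeasurableSet B → ∀ ψ ∈ K, E.proj B ψ ∈ K) {ψ : 𝓗} (hψ : ψ ∈ K) :
    {n : ℤ | E.proj (Int.floor ⁻¹' {n}) ψ ≠ 0}.Finite := by
  have hm : ∀ n : ℤ, MeasurableSet (Int.floor ⁻¹' {n} : Set ℝ) :=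
    fun n => Int.measurable_floor (measurableSet_singleton n)
  let v : {n : ℤ | E.proj (Int.floor ⁻¹' {n}) ψ ≠ 0} → K :=
    fun n => ⟨E.proj (Int.floor ⁻¹' {(n : ℤ)}) ψ, hK _ (hm n) ψ hψ⟩
  have hv : LinearIndependent ℂ v := by
    refine linearIndependent_of_ne_zero_of_inner_eq_zero
      (fun n h => n.2 (congrArg Subtype.val h)) fun m n hmn => ?_
    have h := E.inner_proj_proj ψ ψ (hm m) (hm n)
    have hd : (Int.floor ⁻¹' {(m : ℤ)} ∩ Int.floor ⁻¹' {(n : ℤ)} : Set ℝ) = ∅ := by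
      ext x
      simp only [Set.mem_inter_iff, Set.mem_preimage, Set.mem_singleton_iff,
        Set.mem_empty_iff_false, iff_false, not_and]
      exact fun h1 h2 => hmn (Subtype.ext (h1.symm.trans h2))
    rw [hd, E.proj_empty] at h
    exact h.trans (by simp)
  exact Set.finite_coe_iff.1 hv.finite

/-- The scalar measure of ψ lives on finitely many unit intervals, where x² is bounded. -/
theorem lintegral_sq_lt_top_of_mem {K : Submodule ℂ 𝓗} [FiniteDimensional ℂ K]
    (hK : ∀ B, MeasurableSet B → ∀ ψ ∈ K, E.proj B ψ ∈ K) {ψ : 𝓗} (hψ : ψ ∈ K) :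
    ∫⁻ x, ENNReal.ofReal (x ^ 2) ∂(E.scalarMeasure ψ) < ∞ := by
  have hm : ∀ n : ℤ, MeasurableSet (Int.floor ⁻¹' {n} : Set ℝ) :=
    fun n => Int.measurable_floor (measurableSet_singleton n)
  have hfin := E.finite_floor_of_mem hK hψ
  set N := {n : ℤ | E.proj (Int.floor ⁻¹' {n}) ψ ≠ 0} with hN
  have hae : ∀ᵐ x ∂(E.scalarMeasure ψ), ⌊x⌋ ∈ N := by
    rw [ae_iff]
    refine measure_mono_null (t := ⋃ n : (Nᶜ : Set ℤ), Int.floor ⁻¹' {(n : ℤ)})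
      (fun x hx => Set.mem_iUnion.2 ⟨⟨⌊x⌋, hx⟩, rfl⟩) ?_
    rw [measure_iUnion_null_iff]
    intro n
    rw [E.scalarMeasure_apply ψ (hm n)]
    have h : E.proj (Int.floor ⁻¹' {(n : ℤ)}) ψ = 0 := not_not.1 n.2
    rw [h]
    simp
  obtain ⟨C, hC⟩ := (hfin.image fun n : ℤ => ((|n| : ℝ) + 1) ^ 2).bddAbove
  calc ∫⁻ x, ENNReal.ofReal (x ^ 2) ∂(E.scalarMeasure ψ)
      ≤ ∫⁻ _, ENNReal.ofReal C ∂(E.scalarMeasure ψ) := by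
        refine lintegral_mono_ae (hae.mono fun x hx => ENNReal.ofReal_le_ofReal ?_)
        refine le_trans ?_ (hC ⟨⌊x⌋, hx, rfl⟩)
        have h1 := Int.floor_le x
        have h2 := Int.lt_floor_add_one x
        have h3 : |x| ≤ |(⌊x⌋ : ℝ)| + 1 := by
          have : |x| ≤ |(⌊x⌋ : ℝ)| + |x - ⌊x⌋| := by
            simpa using abs_add_le (⌊x⌋ : ℝ) (x - ⌊x⌋)
          have h4 : |x - ⌊x⌋| ≤ 1 := abs_le.2 ⟨by linarith, by linarith⟩
          linarith
        rw [← sq_abs x]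
        exact pow_le_pow_left₀ (abs_nonneg x) h3 2
    _ < ∞ := by
        rw [lintegral_const]
        exact ENNReal.mul_lt_top ENNReal.ofReal_lt_top (measure_lt_top _ _)

theorem scalarMeasure_add {φ ψ : 𝓗} (h : ∀ B, MeasurableSet B → ⟪φ, E.proj B ψ⟫_ℂ = 0) :
    E.scalarMeasure (φ + ψ) = E.scalarMeasure φ + E.scalarMeasure ψ := by
  ext B hB
  rw [Measure.add_apply, E.scalarMeasure_apply _ hB, E.scalarMeasure_apply _ hB,
    E.scalarMeasure_apply _ hB, ← ENNReal.ofReal_add (by positivity) (by positivity), map_add]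
  congr 1
  have h1 : ⟪E.proj B φ, E.proj B ψ⟫_ℂ = 0 := by
    rw [E.inner_proj_proj φ ψ hB hB, Set.inter_self, h B hB]
  simpa only [sq] using norm_add_sq_eq_norm_sq_add_norm_sq_of_inner_eq_zero _ _ h1

variable {E} {T : 𝓗 →ₗ.[ℂ] 𝓗}

/-- The scalar measures of φ and ψ add, so the quadratic form is additive on φ + ψ and the cross
terms cancel. -/
theorem IsSpectralMeasureOf.cross_eq_zero (hE : E.IsSpectralMeasureOf T) (φ ψ : T.domain)
    (h : ∀ B, MeasurableSet B → ⟪(φ : 𝓗), E.proj B ψ⟫_ℂ = 0) :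
    ⟪(φ : 𝓗), T ψ⟫_ℂ + ⟪(ψ : 𝓗), T φ⟫_ℂ = 0 := by
  have hq := hE.2 (φ + ψ)
  rw [Submodule.coe_add, E.scalarMeasure_add h,
    integral_add_measure (E.integrable_id ((hE.1 φ).1 φ.2)) (E.integrable_id ((hE.1 ψ).1 ψ.2)),
    Complex.ofReal_add, ← hE.2 φ, ← hE.2 ψ, T.map_add] at hq
  simp only [inner_add_left, inner_add_right] at hq
  linear_combination hq

/-- Polarization: replacing ψ by iψ reverses the relative sign of the two cross terms, so each of
them vanishes. -/
theorem IsSpectralMeasureOf.inner_eq_zero (hE : E.IsSpectralMeasureOf T) (φ ψ : T.domain)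
    (h : ∀ B, MeasurableSet B → ⟪(φ : 𝓗), E.proj B ψ⟫_ℂ = 0) : ⟪(φ : 𝓗), T ψ⟫_ℂ = 0 := by
  have h1 := hE.cross_eq_zero φ ψ h
  have h2 := hE.cross_eq_zero φ (Complex.I • ψ) fun B hB => by
    rw [Submodule.coe_smul, map_smul, inner_smul_right, h B hB, mul_zero]
  rw [T.map_smul, Submodule.coe_smul, inner_smul_right, inner_smul_left, Complex.conj_I] at h2
  have h3 : Complex.I * (⟪(φ : 𝓗), T ψ⟫_ℂ - ⟪(ψ : 𝓗), T φ⟫_ℂ) = 0 := by linear_combination h2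
  have h4 := (mul_eq_zero.1 h3).resolve_left Complex.I_ne_zero
  linear_combination (h1 + h4) / 2

theorem IsSpectralMeasureOf.mem_domain (hE : E.IsSpectralMeasureOf T) {K : Submodule ℂ 𝓗}
    [FiniteDimensional ℂ K] (hK : ∀ B, MeasurableSet B → Commute (E.proj B) K.starProjection)
    {ψ : 𝓗} (hψ : ψ ∈ K) : ψ ∈ T.domain := by
  refine (hE.1 ψ).2 (E.lintegral_sq_lt_top_of_mem (K := K) (fun B hB φ hφ => ?_) hψ)
  have h := congrArg (fun A : 𝓗 →L[ℂ] 𝓗 => A φ) (hK B hB).eq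
  simp only [mul_apply_eq_comp, Submodule.starProjection_eq_self_iff.2 hφ] at h
  rw [h]
  exact Submodule.starProjection_apply_mem _ _

end SpectralMeasure

/-! ### Assembling eigenbases of the blocks -/

variable {ι : Type*} {S : ι → Submodule ℂ 𝓗} [∀ i, FiniteDimensional ℂ (S i)]
  (hS : IsHilbertSum ℂ (fun i => S i) fun i => (S i).subtypeₗᵢ)

/-- Orthonormal bases of the blocks of a Hilbert sum, assembled to a Hilbert basis. -/
theorem exists_hilbertBasis_of_blocks
    (hS : IsHilbertSum ℂ (fun i => S i) fun i => (S i).subtypeₗᵢ)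
    {n : ι → ℕ}
    (b : ∀ i, OrthonormalBasis (Fin (n i)) ℂ (S i)) :
    ∃ c : HilbertBasis (Σ i, Fin (n i)) ℂ 𝓗, ∀ p, c p = (b p.1 p.2 : 𝓗) := by
  let v : (Σ i, Fin (n i)) → 𝓗 := fun p => (b p.1 p.2 : 𝓗)
  have hv : Orthonormal ℂ v := hS.OrthogonalFamily.orthonormal_sigma_orthonormal
    fun i => (b i).orthonormal
  suffices hbot : (Submodule.span ℂ (Set.range v))ᗮ = ⊥ from
    ⟨HilbertBasis.mkOfOrthogonalEqBot hv hbot, fun p => by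
      rw [HilbertBasis.coe_mkOfOrthogonalEqBot]⟩
  rw [Submodule.eq_bot_iff]
  intro ψ hψ
  have h : ∀ p, ⟪v p, ψ⟫_ℂ = 0 :=
    fun p => (Submodule.mem_orthogonal _ _).1 hψ _ (Submodule.subset_span ⟨p, rfl⟩)
  refine ext_projOnto hS fun i => ?_
  rw [map_zero]
  refine InnerProductSpace.ext_inner_left_basis (𝕜 := ℂ) (b i).toBasis fun j => ?_
  rw [OrthonormalBasis.coe_toBasis, inner_zero_right, Submodule.coe_inner,
    Submodule.coe_orthogonalProjectionOnto_apply, ← Submodule.inner_starProjection_left_eq_right,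
    Submodule.starProjection_eq_self_iff.2 (Submodule.coe_mem _)]
  exact h ⟨i, j⟩

theorem exists_eigenbasis_of_blocks
    (hS : IsHilbertSum ℂ (fun i => S i) fun i => (S i).subtypeₗᵢ)
    {h : ∀ i, S i →L[ℂ] S i} (hh : ∀ i, IsSelfAdjoint (h i)) :
    ∃ (c : HilbertBasis (Σ i, Fin (Module.finrank ℂ (S i))) ℂ 𝓗)
      (l : (Σ i, Fin (Module.finrank ℂ (S i))) → ℝ),
      ∀ p, ∃ v : S p.1, c p = v ∧ h p.1 v = (l p : ℂ) • v := by
  choose b l hb using fun i => exists_orthonormalBasis_eigen (hh i)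
  obtain ⟨c, hc⟩ := exists_hilbertBasis_of_blocks hS b
  exact ⟨c, fun p => l p.1 p.2, fun p => ⟨b p.1 p.2, hc p, hb p.1 p.2⟩⟩

/-- The operator `T` acts on the summands `S i` by the bounded operators `h i`. -/
def HasBlocks (T : 𝓗 →ₗ.[ℂ] 𝓗) (h : ∀ i, S i →L[ℂ] S i) : Prop :=
  ∀ i (ψ : S i), ((ψ : 𝓗), (h i ψ : 𝓗)) ∈ T.graph

theorem HasBlocks.blocks_unique {T : 𝓗 →ₗ.[ℂ] 𝓗} {h h' : ∀ i, S i →L[ℂ] S i}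
    (hT : HasBlocks T h) (hT' : HasBlocks T h') : h = h' :=
  funext fun i => ContinuousLinearMap.ext fun ψ =>
    Subtype.ext (T.mem_graph_snd_inj' (hT i ψ) (hT' i ψ) rfl)

section Eigenbasis

variable {h : ∀ i, S i →L[ℂ] S i} {n : ι → ℕ} {c : HilbertBasis (Σ i, Fin (n i)) ℂ 𝓗}
  {l : (Σ i, Fin (n i)) → ℝ}

/-- The reduction behind all later statements: the eigenbasis is built from the blocks alone, so the
blocks determine the selfadjoint operator together with its domain. -/
theorem HasBlocks.eq_diagOp {T : 𝓗 →ₗ.[ℂ] 𝓗} (hT : HasBlocks T h) (hsa : IsSelfAdjoint T)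
    (hc : ∀ p, ∃ v : S p.1, c p = v ∧ h p.1 v = (l p : ℂ) • v) : T = diagOp c l := by
  refine ChargeControl.eq_diagOp c l hsa fun p => ?_
  obtain ⟨v, hv, hl⟩ := hc p
  have := hT p.1 v
  rwa [hl, Submodule.coe_smul, ← hv] at this

theorem inner_eigenbasis
    (hS : IsHilbertSum ℂ (fun i => S i) fun i => (S i).subtypeₗᵢ)
    (hh : ∀ i, IsSelfAdjoint (h i))
    (hc : ∀ p, ∃ v : S p.1, c p = v ∧ h p.1 v = (l p : ℂ) • v) (p) {i : ι} (ψ : S i) :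
    ⟪c p, (h i ψ : 𝓗)⟫_ℂ = (l p : ℂ) * ⟪c p, (ψ : 𝓗)⟫_ℂ := by
  obtain ⟨v, hv, hl⟩ := hc p
  rw [hv]
  by_cases hp : p.1 = i
  · subst hp
    have h1 : ⟪h p.1 v, ψ⟫_ℂ = ⟪v, h p.1 ψ⟫_ℂ :=
      ContinuousLinearMap.isSelfAdjoint_iff_isSymmetric.1 (hh p.1) v ψ
    rw [hl, inner_smul_left, Complex.conj_ofReal] at h1
    exact h1.symm
  · have h0 : ∀ φ : S i, ⟪(v : 𝓗), (φ : 𝓗)⟫_ℂ = 0 := fun φ => hS.OrthogonalFamily hp v φ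
    rw [h0, h0, mul_zero]

theorem diagOp_hasBlocks
    (hS : IsHilbertSum ℂ (fun i => S i) fun i => (S i).subtypeₗᵢ)
    (hh : ∀ i, IsSelfAdjoint (h i))
    (hc : ∀ p, ∃ v : S p.1, c p = v ∧ h p.1 v = (l p : ℂ) • v) : HasBlocks (diagOp c l) h :=
  fun _ ψ => (mem_diagOp_graph_iff c l).2 fun p => inner_eigenbasis hS hh hc p ψ

end Eigenbasis

theorem exists_hasBlocks
    (hS : IsHilbertSum ℂ (fun i => S i) fun i => (S i).subtypeₗᵢ)
    {h : ∀ i, S i →L[ℂ] S i} (hh : ∀ i, IsSelfAdjoint (h i)) :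
    ∃ T : 𝓗 →ₗ.[ℂ] 𝓗, IsSelfAdjoint T ∧ HasBlocks T h := by
  obtain ⟨c, l, hc⟩ := exists_eigenbasis_of_blocks hS hh
  exact ⟨diagOp c l, diagOp_isSelfAdjoint c l, diagOp_hasBlocks hS hh hc⟩

theorem HasBlocks.unique
    (hS : IsHilbertSum ℂ (fun i => S i) fun i => (S i).subtypeₗᵢ)
    {T T' : 𝓗 →ₗ.[ℂ] 𝓗} {h : ∀ i, S i →L[ℂ] S i}
    (hh : ∀ i, IsSelfAdjoint (h i)) (hT : HasBlocks T h) (hT' : HasBlocks T' h)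
    (hsa : IsSelfAdjoint T) (hsa' : IsSelfAdjoint T') : T = T' := by
  obtain ⟨c, l, hc⟩ := exists_eigenbasis_of_blocks hS hh
  rw [hT.eq_diagOp hsa hc, hT'.eq_diagOp hsa' hc]

theorem HasBlocks.exists_spectralMeasure
    (hS : IsHilbertSum ℂ (fun i => S i) fun i => (S i).subtypeₗᵢ)
    {T : 𝓗 →ₗ.[ℂ] 𝓗} {h : ∀ i, S i →L[ℂ] S i}
    (hh : ∀ i, IsSelfAdjoint (h i)) (hT : HasBlocks T h) (hsa : IsSelfAdjoint T) :
    ∃ E : SpectralMeasure 𝓗, E.IsSpectralMeasureOf T ∧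
      ∀ B, MeasurableSet B → ∀ i, Commute (E.proj B) (S i).starProjection := by
  obtain ⟨c, l, hc⟩ := exists_eigenbasis_of_blocks hS hh
  refine ⟨diagSpectral c l, ?_, fun B _ i => diagProj_commute_starProjection c l (fun p => ?_) B⟩
  · rw [hT.eq_diagOp hsa hc]
    exact diagSpectral_isSpectralMeasureOf c l
  · obtain ⟨v, hv, -⟩ := hc p
    rw [hv]
    by_cases hp : p.1 = i
    · subst hp
      exact Or.inl v.2
    · exact Or.inr ((Submodule.mem_orthogonal' _ _).2
        fun φ hφ => hS.OrthogonalFamily hp v ⟨φ, hφ⟩)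

/-- For ψ in one block and φ in another, every E(B)ψ is orthogonal to φ, so Tψ is orthogonal to φ
and T preserves blocks. The blocks are selfadjoint because their quadratic forms are integrals of a
real function. -/
theorem SpectralMeasure.IsSpectralMeasureOf.exists_hasBlocks
    (hS : IsHilbertSum ℂ (fun i => S i) fun i => (S i).subtypeₗᵢ)
    {E : SpectralMeasure 𝓗}
    {T : 𝓗 →ₗ.[ℂ] 𝓗} (hE : E.IsSpectralMeasureOf T)
    (hcomm : ∀ B, MeasurableSet B → ∀ i, Commute (E.proj B) (S i).starProjection) :
    ∃ h : ∀ i, S i →L[ℂ] S i, (∀ i, IsSelfAdjoint (h i)) ∧ HasBlocks T h := by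
  have hdom : ∀ i, ∀ ψ : S i, (ψ : 𝓗) ∈ T.domain :=
    fun i ψ => hE.mem_domain (fun B hB => hcomm B hB i) ψ.2
  let A : ∀ i, S i →ₗ[ℂ] 𝓗 := fun i => T.toFun ∘ₗ Submodule.inclusion fun ψ hψ => hdom i ⟨ψ, hψ⟩
  let h : ∀ i, S i →L[ℂ] S i := fun i =>
    LinearMap.toContinuousLinearMap (((S i).orthogonalProjectionOnto : 𝓗 →ₗ[ℂ] S i) ∘ₗ A i)
  have hval : ∀ i (ψ : S i), (h i ψ : 𝓗) = T ⟨ψ, hdom i ψ⟩ := by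
    intro i ψ
    refine ext_projOnto hS fun j => ?_
    by_cases hj : j = i
    · subst hj
      exact Submodule.orthogonalProjectionOnto_mem_subspace_eq_self _
    · rw [projOnto_of_mem_of_ne hS hj (Submodule.coe_mem _)]
      refine (Submodule.orthogonalProjectionOnto_eq_zero_iff.2 ?_).symm
      refine (Submodule.mem_orthogonal _ _).2 fun φ hφ => ?_
      refine hE.inner_eq_zero ⟨φ, hdom j ⟨φ, hφ⟩⟩ ⟨ψ, hdom i ψ⟩ fun B hB => ?_
      have hc := congrArg (fun A : 𝓗 →L[ℂ] 𝓗 => A ψ) (hcomm B hB i).eq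
      simp only [mul_apply_eq_comp, Submodule.starProjection_eq_self_iff.2 ψ.2] at hc
      simp only
      rw [hc]
      exact hS.OrthogonalFamily hj ⟨φ, hφ⟩ ((S i).orthogonalProjectionOnto (E.proj B ψ))
  refine ⟨h, fun i => ?_, fun i ψ => ?_⟩
  · rw [ContinuousLinearMap.isSelfAdjoint_iff_isSymmetric,
      LinearMap.isSymmetric_iff_inner_map_self_real]
    intro ψ
    have h1 : ⟪h i ψ, ψ⟫_ℂ = starRingEnd ℂ ⟪(ψ : 𝓗), T ⟨ψ, hdom i ψ⟩⟫_ℂ := by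
      rw [inner_conj_symm, ← hval]
      rfl
    have h2 := hE.2 ⟨ψ, hdom i ψ⟩
    simp only [ContinuousLinearMap.coe_coe]
    rw [h1, h2, Complex.conj_ofReal, Complex.conj_ofReal]
  · rw [hval]
    exact T.mem_graph ⟨ψ, hdom i ψ⟩

end Reducing

/-! ### Families of skew-adjoint operators -/

section SkewFamilies

variable {ι : Type*} {E : ι → Type*} [∀ i, NormedAddCommGroup (E i)]
  [∀ i, InnerProductSpace ℂ (E i)] [∀ i, FiniteDimensional ℂ (E i)]

/-- Families of skew-adjoint operators on finite-dimensional spaces. -/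
def SkewFamily (E : ι → Type*) [∀ i, NormedAddCommGroup (E i)]
    [∀ i, InnerProductSpace ℂ (E i)] [∀ i, FiniteDimensional ℂ (E i)] : Type _ :=
  ∀ i, skewAdjoint (E i →L[ℂ] E i)

namespace SkewFamily

set_option synthInstance.maxHeartbeats 200000

noncomputable instance : LieRing (SkewFamily E) :=
  inferInstanceAs (LieRing (∀ i, skewAdjoint (E i →L[ℂ] E i)))

noncomputable instance : LieAlgebra ℝ (SkewFamily E) :=
  inferInstanceAs (LieAlgebra ℝ (∀ i, skewAdjoint (E i →L[ℂ] E i)))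

/-- The operators of a family. -/
def op (a : SkewFamily E) (i : ι) : E i →L[ℂ] E i := (a i : E i →L[ℂ] E i)

@[ext] theorem ext {a b : SkewFamily E} (h : ∀ i, a.op i = b.op i) : a = b :=
  funext fun i => Subtype.ext (h i)

theorem op_add (a b : SkewFamily E) (i : ι) : (a + b).op i = a.op i + b.op i := rfl

theorem op_smul_apply (t : ℝ) (a : SkewFamily E) (i : ι) (v : E i) :
    (t • a).op i v = (t : ℂ) • a.op i v := by
  rw [Complex.coe_smul]
  rfl

theorem op_lie (a b : SkewFamily E) (i : ι) :
    (⁅a, b⁆ : SkewFamily E).op i = a.op i * b.op i - b.op i * a.op i := rfl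

/-- The family `i h` for a family `h` of selfadjoint operators. -/
noncomputable def ofSelfAdjoint (h : ∀ i, E i →L[ℂ] E i) (hh : ∀ i, IsSelfAdjoint (h i)) :
    SkewFamily E :=
  fun i => ⟨Complex.I • h i, by
    rw [skewAdjoint.mem_iff, star_smul, (hh i).star_eq]
    simp⟩

theorem op_ofSelfAdjoint (h : ∀ i, E i →L[ℂ] E i) (hh : ∀ i, IsSelfAdjoint (h i)) (i : ι) :
    (ofSelfAdjoint h hh).op i = Complex.I • h i := rfl

theorem isSelfAdjoint_smul_op (a : SkewFamily E) (i : ι) :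
    IsSelfAdjoint ((-Complex.I) • a.op i) := by
  rw [isSelfAdjoint_iff, star_smul, show star (a.op i) = -a.op i from skewAdjoint.mem_iff.1 (a i).2]
  simp

/-- The family of exponentials. -/
noncomputable def exp (a : SkewFamily E) : ∀ i, unitary (E i →L[ℂ] E i) :=
  expFamily (A := fun i => E i →L[ℂ] E i) a

theorem coe_exp (a : SkewFamily E) (i : ι) :
    (a.exp i : E i →L[ℂ] E i) = NormedSpace.exp (a.op i) := rfl

theorem exp_zero_smul (a : SkewFamily E) : ((0 : ℝ) • a).exp = 1 := by
  rw [zero_smul]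
  exact funext fun i => expUnitary_zero

theorem exp_add_smul (a : SkewFamily E) (s t : ℝ) :
    ((s + t) • a).exp = (s • a).exp * (t • a).exp :=
  funext fun i => expUnitary_add_smul s t (a i)

theorem continuous_exp_smul (a : SkewFamily E) : Continuous fun t : ℝ => (t • a).exp := by
  refine continuous_pi fun i => ?_
  refine Continuous.subtype_mk (f := fun t : ℝ => NormedSpace.exp (t • a.op i)) ?_ _
  exact continuous_exp.comp (continuous_id.smul continuous_const)

theorem exists_exp_eq (u : ∀ i, unitary (E i →L[ℂ] E i)) : ∃ a : SkewFamily E, a.exp = u := by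
  choose a ha using fun i => exists_expUnitary_eq (u i)
  exact ⟨a, funext ha⟩

/-- The closure of the exponentials of a Lie algebra of families of operators. -/
noncomputable def closureExp (𝔩 : LieSubalgebra ℝ (SkewFamily E)) :
    Subgroup (∀ i, unitary (E i →L[ℂ] E i)) :=
  ChargeControl.closureExp (A := fun i => E i →L[ℂ] E i) (fun _ => isDominatingTrace_reTrace) 𝔩

theorem coe_closureExp (𝔩 : LieSubalgebra ℝ (SkewFamily E)) :
    (closureExp 𝔩 : Set (∀ i, unitary (E i →L[ℂ] E i))) =
      closure (exp '' (𝔩 : Set (SkewFamily E))) := rfl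

/-- The Lie algebra of the closed group G contains s, hence everything that s generates. -/
theorem exp_mem_of_isClosed {G : Subgroup (∀ i, unitary (E i →L[ℂ] E i))}
    (hG : IsClosed (G : Set (∀ i, unitary (E i →L[ℂ] E i)))) {s : Set (SkewFamily E)}
    (hs : ∀ a ∈ s, ∀ t : ℝ, (t • a).exp ∈ G) {a : SkewFamily E}
    (ha : a ∈ LieSubalgebra.lieSpan ℝ _ s) : a.exp ∈ G := by
  have hle : LieSubalgebra.lieSpan ℝ _ s ≤ lieAlgebraOf (A := fun i => E i →L[ℂ] E i) G hG :=
    LieSubalgebra.lieSpan_le.2 hs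
  have h : ((1 : ℝ) • a).exp ∈ G := mem_lieAlgebraOf.1 (hle ha) 1
  rwa [one_smul] at h

end SkewFamily

end SkewFamilies

/-! ### Exponentials of block diagonal operators -/

section Group

variable {𝓗 : Type*} [NormedAddCommGroup 𝓗] [InnerProductSpace ℂ 𝓗] [CompleteSpace 𝓗]
  {ι : Type*} {S : ι → Submodule ℂ 𝓗} [∀ i, FiniteDimensional ℂ (S i)]
  (hS : IsHilbertSum ℂ (fun i => S i) fun i => (S i).subtypeₗᵢ)

/-- The one-parameter group of block diagonal unitaries with given generators in the blocks. -/
noncomputable def blockGroup (a : SkewFamily fun i => S i) (t : ℝ) :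
    unitary (𝓗 →L[ℂ] 𝓗) := blockUnitary hS (t • a).exp

theorem blockGroup_isUnitaryGroup (a : SkewFamily fun i => S i) :
    IsUnitaryGroup (blockGroup hS a) where
  map_zero := by rw [blockGroup, a.exp_zero_smul, MonoidHom.map_one]
  map_add s t := by rw [blockGroup, a.exp_add_smul, MonoidHom.map_mul]; rfl
  continuous ψ := (continuous_strongTopology_iff.1 (continuous_blockUnitary hS) ψ).comp
    a.continuous_exp_smul

variable {h : ∀ i, S i →L[ℂ] S i} {n : ι → ℕ} {c : HilbertBasis (Σ i, Fin (n i)) ℂ 𝓗}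
  {l : (Σ i, Fin (n i)) → ℝ} {a : SkewFamily fun i => S i}

/-- Connects the blockwise exponentials with the diagonal picture, where generator and uniqueness
are already known. -/
theorem blockGroup_eigenbasis (ha : ∀ i, a.op i = Complex.I • h i)
    (hc : ∀ p, ∃ v : S p.1, c p = v ∧ h p.1 v = (l p : ℂ) • v) (t : ℝ) (p) :
    (blockGroup hS a t : 𝓗 →L[ℂ] 𝓗) (c p) = Complex.exp (Complex.I * l p * t) • c p := by
  obtain ⟨v, hv, hl⟩ := hc p
  rw [hv, blockGroup, blockUnitary_apply_of_mem, ← Submodule.coe_smul]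
  congr 1
  rw [SkewFamily.coe_exp]
  refine exp_apply_eigenvector ?_
  rw [SkewFamily.op_smul_apply, ha, smul_apply, hl, smul_smul, smul_smul]
  congr 1
  ring

variable {T : 𝓗 →ₗ.[ℂ] 𝓗}

theorem HasBlocks.generator_blockGroup (hT : HasBlocks T h) (hsa : IsSelfAdjoint T)
    (hh : ∀ i, IsSelfAdjoint (h i)) (ha : ∀ i, a.op i = Complex.I • h i) :
    generator (blockGroup hS a) = Complex.I • T := by
  obtain ⟨c, l, hc⟩ := exists_eigenbasis_of_blocks hS hh
  rw [hT.eq_diagOp hsa hc]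
  exact generator_diagGroup (blockGroup_eigenbasis hS ha hc)

theorem HasBlocks.eq_blockGroup (hT : HasBlocks T h) (hsa : IsSelfAdjoint T)
    (hh : ∀ i, IsSelfAdjoint (h i)) (ha : ∀ i, a.op i = Complex.I • h i)
    {V : ℝ → unitary (𝓗 →L[ℂ] 𝓗)} (hV : IsUnitaryGroup V) (hgen : generator V = Complex.I • T) :
    V = blockGroup hS a := by
  obtain ⟨c, l, hc⟩ := exists_eigenbasis_of_blocks hS hh
  rw [hT.eq_diagOp hsa hc] at hgen
  exact diagGroup_unique hV hgen (blockGroup_eigenbasis hS ha hc)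

theorem HasBlocks.expGroup_eq (hT : HasBlocks T h) (hsa : IsSelfAdjoint T)
    (hh : ∀ i, IsSelfAdjoint (h i)) (ha : ∀ i, a.op i = Complex.I • h i) :
    expGroup (Complex.I • T) = blockGroup hS a := by
  obtain ⟨c, l, hc⟩ := exists_eigenbasis_of_blocks hS hh
  rw [hT.eq_diagOp hsa hc]
  exact expGroup_diagOp (blockGroup_isUnitaryGroup hS a) (blockGroup_eigenbasis hS ha hc)

end Group

/-! ### Dynamical groups of block diagonal generators -/

section Dynamical

variable {𝓗 : Type*} [NormedAddCommGroup 𝓗] [InnerProductSpace ℂ 𝓗] [CompleteSpace 𝓗]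
  {ι : Type*} {S : ι → Submodule ℂ 𝓗} [∀ i, FiniteDimensional ℂ (S i)]
  (hS : IsHilbertSum ℂ (fun i => S i) fun i => (S i).subtypeₗᵢ)
  {κ : Type*} {A : κ → 𝓗 →ₗ.[ℂ] 𝓗} {a : κ → SkewFamily fun i => S i}

theorem isClosed_dynamicalGroup (A : κ → 𝓗 →ₗ.[ℂ] 𝓗) :
    IsClosed[strongTopology 𝓗] (dynamicalGroup A : Set (unitary (𝓗 →L[ℂ] 𝓗))) := by
  let _ := strongTopology 𝓗
  rw [dynamicalGroup, Subgroup.coe_sInf]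
  exact isClosed_biInter fun G hG => hG.1

theorem expGroup_mem_dynamicalGroup (A : κ → 𝓗 →ₗ.[ℂ] 𝓗) (k : κ) (t : ℝ) :
    expGroup (A k) t ∈ dynamicalGroup A :=
  Subgroup.mem_sInf.2 fun _ hG => hG.2 k t

/-- The dynamical group pulls back to a closed subgroup of the product of unitary groups, which has
a Lie algebra containing all a k. -/
theorem blockUnitary_exp_mem_dynamicalGroup
    (hS : IsHilbertSum ℂ (fun i => S i) fun i => (S i).subtypeₗᵢ)
    (hA : ∀ k, expGroup (A k) = blockGroup hS (a k))
    {x : SkewFamily fun i => S i} (hx : x ∈ LieSubalgebra.lieSpan ℝ _ (Set.range a)) :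
    blockUnitary hS x.exp ∈ dynamicalGroup A := by
  have hcl : IsClosed ((dynamicalGroup A).comap (blockUnitary hS) :
      Set (∀ i, unitary (S i →L[ℂ] S i))) :=
    @IsClosed.preimage _ _ _ (strongTopology 𝓗) _ (continuous_blockUnitary hS) _
      (isClosed_dynamicalGroup A)
  refine SkewFamily.exp_mem_of_isClosed hcl ?_ hx
  rintro _ ⟨k, rfl⟩ t
  have := expGroup_mem_dynamicalGroup A k t
  rwa [hA k] at this

/-- The closure of the exponentials in the product is a group; its image is strongly closed and
contains the given one-parameter groups, so it contains the dynamical group by minimality.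
Continuity puts this image into the strong closure. -/
theorem closure_blockUnitary_exp_eq_dynamicalGroup
    (hS : IsHilbertSum ℂ (fun i => S i) fun i => (S i).subtypeₗᵢ)
    (hcl : IsClosed[strongTopology 𝓗] (Set.range (blockUnitary hS)))
    (hA : ∀ k, expGroup (A k) = blockGroup hS (a k)) :
    closure[strongTopology 𝓗] ((fun x : SkewFamily fun i => S i => blockUnitary hS x.exp) ''
      (LieSubalgebra.lieSpan ℝ _ (Set.range a) : Set (SkewFamily fun i => S i))) =
      (dynamicalGroup A : Set (unitary (𝓗 →L[ℂ] 𝓗))) := by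
  refine Set.Subset.antisymm ?_ ?_
  · refine @closure_minimal _ (strongTopology 𝓗) _ _ ?_ (isClosed_dynamicalGroup A)
    rintro _ ⟨x, hx, rfl⟩
    exact blockUnitary_exp_mem_dynamicalGroup hS hA hx
  · set 𝔩 := LieSubalgebra.lieSpan ℝ _ (Set.range a)
    have hle : dynamicalGroup A ≤ (SkewFamily.closureExp 𝔩).map (blockUnitary hS) := by
      refine sInf_le ⟨?_, fun k t => ?_⟩
      · exact isClosed_blockUnitary_image hS hcl (by
          rw [SkewFamily.coe_closureExp]
          exact isClosed_closure)
      · rw [hA k]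
        refine ⟨(t • a k).exp, ?_, rfl⟩
        rw [SkewFamily.coe_closureExp]
        exact subset_closure ⟨t • a k,
          𝔩.smul_mem t (LieSubalgebra.subset_lieSpan ⟨k, rfl⟩), rfl⟩
    intro U hU
    obtain ⟨u, hu, rfl⟩ := hle hU
    rw [SkewFamily.coe_closureExp] at hu
    have := @image_closure_subset_closure_image _ _ _ (strongTopology 𝓗) _ _
      (continuous_blockUnitary hS) _ (Set.mem_image_of_mem (blockUnitary hS) hu)
    rwa [Set.image_image] at this

end Dynamical

/-! ### Unitaries and operators commuting with the charge -/

section Charge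

variable {𝓗 : Type*} [NormedAddCommGroup 𝓗] [InnerProductSpace ℂ 𝓗] [CompleteSpace 𝓗]
  (π : Circle →* unitary (𝓗 →L[ℂ] 𝓗)) [∀ μ : ℤ, FiniteDimensional ℂ (chargeSpace π μ)]

theorem mem_chargeGroup_iff {U : unitary (𝓗 →L[ℂ] 𝓗)} :
    U ∈ chargeGroup π ↔ ∀ z ψ, (π z : 𝓗 →L[ℂ] 𝓗) ((U : 𝓗 →L[ℂ] 𝓗) ψ) =
      (U : 𝓗 →L[ℂ] 𝓗) ((π z : 𝓗 →L[ℂ] 𝓗) ψ) := by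
  rw [chargeGroup, Subgroup.mem_centralizer_iff]
  constructor
  · intro h z ψ
    exact congrArg (fun V : unitary (𝓗 →L[ℂ] 𝓗) => (V : 𝓗 →L[ℂ] 𝓗) ψ) (h (π z) ⟨z, rfl⟩)
  · rintro h _ ⟨z, rfl⟩
    exact Subtype.ext (ContinuousLinearMap.ext fun ψ => h z ψ)

theorem isClosed_chargeGroup :
    IsClosed[strongTopology 𝓗] (chargeGroup π : Set (unitary (𝓗 →L[ℂ] 𝓗))) := by
  let _ := strongTopology 𝓗
  have h : (chargeGroup π : Set (unitary (𝓗 →L[ℂ] 𝓗))) = ⋂ (z : Circle) (ψ : 𝓗),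
      {U : unitary (𝓗 →L[ℂ] 𝓗) | (π z : 𝓗 →L[ℂ] 𝓗) ((U : 𝓗 →L[ℂ] 𝓗) ψ) =
        (U : 𝓗 →L[ℂ] 𝓗) ((π z : 𝓗 →L[ℂ] 𝓗) ψ)} := by
    ext U
    simp only [SetLike.mem_coe, mem_chargeGroup_iff, Set.mem_iInter, Set.mem_ofPred_eq]
  rw [h]
  exact isClosed_iInter fun z => isClosed_iInter fun ψ => isClosed_eq
    ((π z : 𝓗 →L[ℂ] 𝓗).continuous.comp (continuous_strongTopology_apply ψ))
    (continuous_strongTopology_apply _)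

theorem apply_mem_chargeSpace {U : unitary (𝓗 →L[ℂ] 𝓗)} (hU : U ∈ chargeGroup π) {μ : ℤ} {ψ : 𝓗}
    (hψ : ψ ∈ chargeSpace π μ) : (U : 𝓗 →L[ℂ] 𝓗) ψ ∈ chargeSpace π μ := by
  rw [mem_chargeSpace_iff] at hψ ⊢
  intro z
  rw [(mem_chargeGroup_iff π).1 hU, hψ, map_smul]

variable (hπ : ∀ ψ : 𝓗, Continuous fun z => (π z : 𝓗 →L[ℂ] 𝓗) ψ)

theorem blockUnitary_mem_chargeGroup
    (u : ∀ μ, unitary (chargeSpace π μ →L[ℂ] chargeSpace π μ)) :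
    blockUnitary (chargeSpace_isHilbertSum π hπ) u ∈ chargeGroup π := by
  rw [mem_chargeGroup_iff]
  intro z ψ
  refine congrArg (fun A : 𝓗 →L[ℂ] 𝓗 => A ψ) (ext_on_blocks (chargeSpace_isHilbertSum π hπ)
    (U := (π z : 𝓗 →L[ℂ] 𝓗) * (blockUnitary (chargeSpace_isHilbertSum π hπ) u : 𝓗 →L[ℂ] 𝓗))
    (W := (blockUnitary (chargeSpace_isHilbertSum π hπ) u : 𝓗 →L[ℂ] 𝓗) * (π z : 𝓗 →L[ℂ] 𝓗))
    fun μ φ hφ => ?_)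
  rw [mul_apply_eq_comp, mul_apply_eq_comp, (mem_chargeSpace_iff π).1 hφ z, map_smul,
    blockUnitary_apply_of_mem _ u (⟨φ, hφ⟩ : chargeSpace π μ),
    (mem_chargeSpace_iff π).1 (Submodule.coe_mem _) z]

/-- Since π(z) is scalar on every charge space, commuting with all π(z) amounts to preserving the
charge spaces. -/
theorem range_blockUnitary : Set.range (blockUnitary (chargeSpace_isHilbertSum π hπ)) =
    (chargeGroup π : Set (unitary (𝓗 →L[ℂ] 𝓗))) := by
  refine Set.Subset.antisymm ?_ fun U hU => ?_
  · rintro _ ⟨u, rfl⟩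
    exact blockUnitary_mem_chargeGroup π hπ u
  · obtain ⟨u, hu⟩ := exists_eq_blockUnitary (chargeSpace_isHilbertSum π hπ)
      (fun μ ψ hψ => apply_mem_chargeSpace π hU hψ)
      (fun μ ψ hψ => apply_mem_chargeSpace π ((chargeGroup π).inv_mem hU) hψ)
    exact ⟨u, hu.symm⟩

/-! ### Action on finite particle vectors -/

theorem mem_finiteParticle_iff {ψ : 𝓗} :
    ψ ∈ finiteParticle π ↔ {μ : ℤ | component π μ ψ ≠ 0}.Finite := by
  have h : {μ : ℤ | component π μ ψ ≠ 0} = {μ : ℤ | chargeProj π μ ψ ≠ 0} := by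
    ext μ
    exact not_congr (Submodule.coe_eq_zero (x := component π μ ψ)).symm
  rw [h]
  rfl

theorem chargeSpace_le_finiteParticle
    (hπ : ∀ ψ : 𝓗, Continuous fun z => (π z : 𝓗 →L[ℂ] 𝓗) ψ)
    (μ : ℤ) : chargeSpace π μ ≤ finiteParticle π := by
  intro ψ hψ
  rw [mem_finiteParticle_iff]
  refine (Set.finite_singleton μ).subset fun ν hν => ?_
  by_contra hne
  exact hν (projOnto_of_mem_of_ne (chargeSpace_isHilbertSum π hπ) hne hψ)

variable {π} in
theorem finite_support_block (h : ∀ μ, chargeSpace π μ →L[ℂ] chargeSpace π μ)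
    (ψ : finiteParticle π) :
    (Function.support fun μ => (h μ (component π μ ψ) : 𝓗)).Finite := by
  refine ((mem_finiteParticle_iff π).1 ψ.2).subset fun μ hμ hc => hμ ?_
  simp only [hc, map_zero, ZeroMemClass.coe_zero]

theorem hasSum_finsum_block (h : ∀ μ, chargeSpace π μ →L[ℂ] chargeSpace π μ)
    (ψ : finiteParticle π) : HasSum (fun μ => (h μ (component π μ ψ) : 𝓗))
      (∑ᶠ μ, (h μ (component π μ ψ) : 𝓗)) := by
  have hf := finite_support_block h ψ
  rw [finsum_eq_sum _ hf]
  refine hasSum_sum_of_ne_finset_zero fun μ hμ => ?_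
  simpa using hμ

theorem component_finsum_block
    (hπ : ∀ ψ : 𝓗, Continuous fun z => (π z : 𝓗 →L[ℂ] 𝓗) ψ)
    (h : ∀ μ, chargeSpace π μ →L[ℂ] chargeSpace π μ)
    (ψ : finiteParticle π) (ν : ℤ) :
    component π ν (∑ᶠ μ, (h μ (component π μ ψ) : 𝓗)) = h ν (component π ν ψ) := by
  have h1 := (hasSum_finsum_block π h ψ).mapL (component π ν)
  refine h1.unique ?_
  have h2 := hasSum_single (f := fun μ => component π ν (h μ (component π μ ψ) : 𝓗)) ν
    fun μ hμ => projOnto_of_mem_of_ne (chargeSpace_isHilbertSum π hπ) hμ.symm (Submodule.coe_mem _)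
  rwa [show component π ν (h ν (component π ν ψ) : 𝓗) = h ν (component π ν ψ) from
    Submodule.orthogonalProjectionOnto_mem_subspace_eq_self _] at h2

/-- The operator on finite particle vectors with given blocks. -/
noncomputable def blockEnd (h : ∀ μ, chargeSpace π μ →L[ℂ] chargeSpace π μ) :
    Module.End ℂ (finiteParticle π) where
  toFun ψ := ⟨∑ᶠ μ, (h μ (component π μ ψ) : 𝓗), by
    rw [mem_finiteParticle_iff]
    refine ((mem_finiteParticle_iff π).1 ψ.2).subset fun μ hμ hc => hμ ?_
    rw [component_finsum_block π hπ, hc, map_zero]⟩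
  map_add' φ ψ := Subtype.ext (by
    simp only [Submodule.coe_add, map_add]
    exact finsum_add_distrib (finite_support_block h φ) (finite_support_block h ψ))
  map_smul' c ψ := Subtype.ext (by
    simp only [Submodule.coe_smul, map_smul, RingHom.id_apply]
    exact (smul_finsum c _).symm)

theorem hasSum_blockEnd (h : ∀ μ, chargeSpace π μ →L[ℂ] chargeSpace π μ)
    (ψ : finiteParticle π) : HasSum (fun μ => (h μ (component π μ ψ) : 𝓗))
      (blockEnd π hπ h ψ : 𝓗) :=
  hasSum_finsum_block π h ψ

theorem component_blockEnd (h : ∀ μ, chargeSpace π μ →L[ℂ] chargeSpace π μ)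
    (ψ : finiteParticle π) (ν : ℤ) :
    component π ν (blockEnd π hπ h ψ : 𝓗) = h ν (component π ν ψ) :=
  component_finsum_block π hπ h ψ ν

theorem finiteParticle_ext
    (hπ : ∀ ψ : 𝓗, Continuous fun z => (π z : 𝓗 →L[ℂ] 𝓗) ψ)
    {φ ψ : finiteParticle π}
    (h : ∀ μ, component π μ (φ : 𝓗) = component π μ (ψ : 𝓗)) : φ = ψ :=
  Subtype.ext (ext_projOnto (chargeSpace_isHilbertSum π hπ) h)

theorem blockEnd_injective {h h' : ∀ μ, chargeSpace π μ →L[ℂ] chargeSpace π μ}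
    (hh : blockEnd π hπ h = blockEnd π hπ h') : h = h' := by
  funext μ
  ext1 ψ
  have h1 := component_blockEnd π hπ h ⟨ψ, chargeSpace_le_finiteParticle π hπ μ ψ.2⟩ μ
  have h2 := component_blockEnd π hπ h' ⟨ψ, chargeSpace_le_finiteParticle π hπ μ ψ.2⟩ μ
  have h3 : component π μ (ψ : 𝓗) = ψ := Submodule.orthogonalProjectionOnto_mem_subspace_eq_self _
  simp only [h3] at h1 h2
  rw [← h1, ← h2, hh]

variable {π} in
-- A finite particle vector is a finite sum of block vectors, so linearity of the graph suffices and
-- no limit is taken.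
theorem HasBlocks.mem_graph_blockEnd {T : 𝓗 →ₗ.[ℂ] 𝓗}
    {h : ∀ μ, chargeSpace π μ →L[ℂ] chargeSpace π μ} (hT : HasBlocks T h) (ψ : finiteParticle π) :
    ((ψ : 𝓗), (blockEnd π hπ h ψ : 𝓗)) ∈ T.graph := by
  have hf := (mem_finiteParticle_iff π).1 ψ.2
  have h1 : (ψ : 𝓗) = ∑ μ ∈ hf.toFinset, (component π μ ψ : 𝓗) := by
    refine (hasSum_projOnto (chargeSpace_isHilbertSum π hπ) (ψ : 𝓗)).unique
      (hasSum_sum_of_ne_finset_zero fun μ hμ => ?_)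
    have : component π μ (ψ : 𝓗) = 0 := by simpa using hμ
    exact congrArg Subtype.val this
  have h2 : (blockEnd π hπ h ψ : 𝓗) = ∑ μ ∈ hf.toFinset, (h μ (component π μ ψ) : 𝓗) := by
    refine (hasSum_blockEnd π hπ h ψ).unique (hasSum_sum_of_ne_finset_zero fun μ hμ => ?_)
    have : component π μ (ψ : 𝓗) = 0 := by simpa using hμ
    rw [this, map_zero, ZeroMemClass.coe_zero]
  have h3 : ((ψ : 𝓗), (blockEnd π hπ h ψ : 𝓗)) =
      ∑ μ ∈ hf.toFinset, ((component π μ ψ : 𝓗), (h μ (component π μ ψ) : 𝓗)) := by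
    refine Prod.ext ?_ ?_
    · rw [Prod.fst_sum]; exact h1
    · rw [Prod.snd_sum]; exact h2
  rw [h3]
  exact Submodule.sum_mem _ fun μ _ => hT μ _

variable {π} in
theorem CommutesWithCharge.exists_hasBlocks {T : 𝓗 →ₗ.[ℂ] 𝓗} (hT : CommutesWithCharge π T)
    (hπ : ∀ ψ : 𝓗, Continuous fun z => (π z : 𝓗 →L[ℂ] 𝓗) ψ) :
    ∃ h : ∀ μ, chargeSpace π μ →L[ℂ] chargeSpace π μ, (∀ μ, IsSelfAdjoint (h μ)) ∧
      HasBlocks T h := by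
  obtain ⟨E, hE, hc⟩ := hT
  exact hE.exists_hasBlocks (chargeSpace_isHilbertSum π hπ) hc

theorem hasCore_finiteParticle (hπ : ∀ ψ : 𝓗, Continuous fun z => (π z : 𝓗 →L[ℂ] 𝓗) ψ)
    {T : 𝓗 →ₗ.[ℂ] 𝓗} (hsa : IsSelfAdjoint T) (hT : CommutesWithCharge π T) :
    T.HasCore (finiteParticle π) := by
  obtain ⟨h, hh, hb⟩ := hT.exists_hasBlocks hπ
  obtain ⟨c, l, hc⟩ := exists_eigenbasis_of_blocks (chargeSpace_isHilbertSum π hπ) hh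
  have hdom : finiteParticle π ≤ T.domain := fun ψ hψ =>
    LinearPMap.mem_domain_of_mem_graph (hb.mem_graph_blockEnd hπ ⟨ψ, hψ⟩)
  rw [hb.eq_diagOp hsa hc] at hdom ⊢
  refine diagOp_hasCore c l hdom fun p => ?_
  obtain ⟨v, hv, -⟩ := hc p
  rw [hv]
  exact chargeSpace_le_finiteParticle π hπ p.1 v.2

theorem apply_mem_finiteParticle (hπ : ∀ ψ : 𝓗, Continuous fun z => (π z : 𝓗 →L[ℂ] 𝓗) ψ)
    {T : 𝓗 →ₗ.[ℂ] 𝓗} (hT : CommutesWithCharge π T) (ψ : T.domain)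
    (hψ : (ψ : 𝓗) ∈ finiteParticle π) : T ψ ∈ finiteParticle π := by
  obtain ⟨h, -, hb⟩ := hT.exists_hasBlocks hπ
  rw [T.mem_graph_snd_inj (T.mem_graph ψ) (hb.mem_graph_blockEnd hπ ⟨ψ, hψ⟩) rfl]
  exact Submodule.coe_mem _

/-! ### The Lie algebra of operators commuting with the charge -/

theorem hasBlocks_smul_I {T : 𝓗 →ₗ.[ℂ] 𝓗} {h : ∀ μ, chargeSpace π μ →L[ℂ] chargeSpace π μ} :
    HasBlocks (Complex.I • T) (fun μ => Complex.I • h μ) ↔ HasBlocks T h := by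
  refine forall_congr' fun μ => forall_congr' fun ψ => ?_
  rw [mem_smul_graph_iff, smul_apply, Submodule.coe_smul, smul_smul, neg_mul, Complex.I_mul_I,
    neg_neg, one_smul]

variable {π} in
theorem exists_hasBlocks_of_mem (hπ : ∀ ψ : 𝓗, Continuous fun z => (π z : 𝓗 →L[ℂ] 𝓗) ψ)
    {Q : 𝓗 →ₗ.[ℂ] 𝓗} (hQ : Q ∈ chargeAlgebra π) :
    ∃ (T : 𝓗 →ₗ.[ℂ] 𝓗) (h : ∀ μ, chargeSpace π μ →L[ℂ] chargeSpace π μ), IsSelfAdjoint T ∧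
      (∀ μ, IsSelfAdjoint (h μ)) ∧ HasBlocks T h ∧ Q = Complex.I • T := by
  obtain ⟨T, hsa, hT, rfl⟩ := hQ
  obtain ⟨h, hh, hb⟩ := hT.exists_hasBlocks hπ
  exact ⟨T, h, hsa, hh, hb, rfl⟩

variable {π} in
theorem exists_skewFamily (hπ : ∀ ψ : 𝓗, Continuous fun z => (π z : 𝓗 →L[ℂ] 𝓗) ψ)
    {Q : 𝓗 →ₗ.[ℂ] 𝓗} (hQ : Q ∈ chargeAlgebra π) :
    ∃ a : SkewFamily fun μ => chargeSpace π μ, HasBlocks Q a.op := by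
  obtain ⟨T, h, -, hh, hb, rfl⟩ := exists_hasBlocks_of_mem hπ hQ
  exact ⟨SkewFamily.ofSelfAdjoint h hh, (hasBlocks_smul_I π).2 hb⟩

variable {π} in
theorem HasBlocks.exists_selfAdjoint (hπ : ∀ ψ : 𝓗, Continuous fun z => (π z : 𝓗 →L[ℂ] 𝓗) ψ)
    {Q : 𝓗 →ₗ.[ℂ] 𝓗} (hQ : Q ∈ chargeAlgebra π) {a : SkewFamily fun μ => chargeSpace π μ}
    (ha : HasBlocks Q a.op) :
    ∃ (T : 𝓗 →ₗ.[ℂ] 𝓗) (h : ∀ μ, chargeSpace π μ →L[ℂ] chargeSpace π μ), IsSelfAdjoint T ∧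
      (∀ μ, IsSelfAdjoint (h μ)) ∧ HasBlocks T h ∧ Q = Complex.I • T ∧
        ∀ μ, a.op μ = Complex.I • h μ := by
  obtain ⟨T, h, hsa, hh, hb, rfl⟩ := exists_hasBlocks_of_mem hπ hQ
  exact ⟨T, h, hsa, hh, hb, rfl,
    fun μ => congrFun (ha.blocks_unique ((hasBlocks_smul_I π).2 hb)) μ⟩

theorem exists_mem_chargeAlgebra (hπ : ∀ ψ : 𝓗, Continuous fun z => (π z : 𝓗 →L[ℂ] 𝓗) ψ)
    (a : SkewFamily fun μ => chargeSpace π μ) :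
    ∃ Q ∈ chargeAlgebra π, HasBlocks Q a.op := by
  have hS := chargeSpace_isHilbertSum π hπ
  obtain ⟨T, hsa, hT⟩ := ChargeControl.exists_hasBlocks hS a.isSelfAdjoint_smul_op
  refine ⟨Complex.I • T, ⟨T, hsa, hT.exists_spectralMeasure hS a.isSelfAdjoint_smul_op hsa, rfl⟩,
    ?_⟩
  have h : a.op = fun μ => Complex.I • (-Complex.I) • a.op μ := funext fun μ => by
    rw [smul_smul, mul_neg, Complex.I_mul_I, neg_neg, one_smul]
  rw [h]
  exact (hasBlocks_smul_I π).2 hT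

variable {π} in
theorem HasBlocks.eq_of_mem (hπ : ∀ ψ : 𝓗, Continuous fun z => (π z : 𝓗 →L[ℂ] 𝓗) ψ)
    {Q Q' : 𝓗 →ₗ.[ℂ] 𝓗} (hQ : Q ∈ chargeAlgebra π) (hQ' : Q' ∈ chargeAlgebra π)
    {a : SkewFamily fun μ => chargeSpace π μ} (ha : HasBlocks Q a.op) (ha' : HasBlocks Q' a.op) :
    Q = Q' := by
  obtain ⟨T, h, hsa, hh, hb, rfl, hah⟩ := ha.exists_selfAdjoint hπ hQ
  obtain ⟨T', h', hsa', hh', hb', rfl, hah'⟩ := ha'.exists_selfAdjoint hπ hQ'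
  have heq : h' = h := funext fun μ =>
    smul_right_injective _ Complex.I_ne_zero ((hah' μ).symm.trans (hah μ))
  subst heq
  rw [hb.unique (chargeSpace_isHilbertSum π hπ) hh hb' hsa hsa']

/-- The elements of the charge algebra are the families of skew-adjoint operators on the
eigenspaces of the charge operator. -/
noncomputable def chargeEquiv : chargeAlgebra π ≃ SkewFamily fun μ => chargeSpace π μ where
  toFun Q := (exists_skewFamily hπ Q.2).choose
  invFun a := ⟨_, (exists_mem_chargeAlgebra π hπ a).choose_spec.1⟩
  left_inv Q := Subtype.ext ((exists_mem_chargeAlgebra π hπ _).choose_spec.2.eq_of_mem hπ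
    (exists_mem_chargeAlgebra π hπ _).choose_spec.1 Q.2 (exists_skewFamily hπ Q.2).choose_spec)
  right_inv a := SkewFamily.ext fun μ => congrFun ((exists_skewFamily hπ
    (exists_mem_chargeAlgebra π hπ a).choose_spec.1).choose_spec.blocks_unique
      (exists_mem_chargeAlgebra π hπ a).choose_spec.2) μ

theorem hasBlocks_chargeEquiv (Q : chargeAlgebra π) :
    HasBlocks (Q : 𝓗 →ₗ.[ℂ] 𝓗) (chargeEquiv π hπ Q).op :=
  (exists_skewFamily hπ Q.2).choose_spec

theorem expGroup_eq_blockGroup (Q : chargeAlgebra π) : expGroup (Q : 𝓗 →ₗ.[ℂ] 𝓗) =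
    blockGroup (chargeSpace_isHilbertSum π hπ) (chargeEquiv π hπ Q) := by
  obtain ⟨T, h, hsa, hh, hb, hQ, ha⟩ := (hasBlocks_chargeEquiv π hπ Q).exists_selfAdjoint hπ Q.2
  rw [hQ, hb.expGroup_eq (chargeSpace_isHilbertSum π hπ) hsa hh ha]

theorem expOp_eq_blockUnitary (Q : chargeAlgebra π) : expOp (Q : 𝓗 →ₗ.[ℂ] 𝓗) =
    blockUnitary (chargeSpace_isHilbertSum π hπ) (chargeEquiv π hπ Q).exp := by
  rw [expOp, expGroup_eq_blockGroup π hπ, blockGroup, one_smul]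

theorem existsUnique_isUnitaryGroup (hπ : ∀ ψ : 𝓗, Continuous fun z => (π z : 𝓗 →L[ℂ] 𝓗) ψ)
    {Q : 𝓗 →ₗ.[ℂ] 𝓗} (hQ : Q ∈ chargeAlgebra π) :
    ∃! V : ℝ → unitary (𝓗 →L[ℂ] 𝓗), IsUnitaryGroup V ∧ generator V = Q := by
  obtain ⟨a, hab⟩ := exists_skewFamily hπ hQ
  obtain ⟨T, h, hsa, hh, hb, rfl, ha⟩ := hab.exists_selfAdjoint hπ hQ
  have hS := chargeSpace_isHilbertSum π hπ
  exact ⟨blockGroup hS a, ⟨blockGroup_isUnitaryGroup hS a, hb.generator_blockGroup hS hsa hh ha⟩,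
    fun V hV => hb.eq_blockGroup hS hsa hh ha hV.1 hV.2⟩

theorem expOp_image_chargeAlgebra (hπ : ∀ ψ : 𝓗, Continuous fun z => (π z : 𝓗 →L[ℂ] 𝓗) ψ) :
    expOp '' chargeAlgebra π = (chargeGroup π : Set (unitary (𝓗 →L[ℂ] 𝓗))) := by
  rw [← range_blockUnitary π hπ]
  refine Set.Subset.antisymm ?_ ?_
  · rintro _ ⟨Q, hQ, rfl⟩
    exact ⟨_, (expOp_eq_blockUnitary π hπ ⟨Q, hQ⟩).symm⟩
  · rintro _ ⟨u, rfl⟩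
    obtain ⟨a, rfl⟩ := SkewFamily.exists_exp_eq u
    refine ⟨(chargeEquiv π hπ).symm a, Subtype.coe_prop _, ?_⟩
    rw [expOp_eq_blockUnitary π hπ, Equiv.apply_symm_apply]

/-- Translates a condition on vectors of D_X into an identity of blocks, so that existence and
uniqueness can be read off from `chargeEquiv`. -/
theorem hasSum_blockEnd_iff (a : SkewFamily fun μ => chargeSpace π μ)
    (h : ∀ μ, chargeSpace π μ →L[ℂ] chargeSpace π μ) :
    (∀ ψ : finiteParticle π, HasSum (fun μ => Complex.I • (h μ (component π μ ψ) : 𝓗))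
      (blockEnd π hπ a.op ψ : 𝓗)) ↔ ∀ μ, a.op μ = Complex.I • h μ := by
  constructor
  · intro hs
    refine congrFun (blockEnd_injective π hπ (LinearMap.ext fun ψ => Subtype.ext ?_))
    exact (hs ψ).unique (hasSum_blockEnd π hπ (fun μ => Complex.I • h μ) ψ)
  · intro ha ψ
    have := hasSum_blockEnd π hπ a.op ψ
    simpa only [ha, smul_apply, Submodule.coe_smul] using this

theorem blockEnd_smul_add (t : ℝ) (a b : SkewFamily fun μ => chargeSpace π μ)
    (ψ : finiteParticle π) : blockEnd π hπ (t • a + b).op ψ =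
      (t : ℂ) • blockEnd π hπ a.op ψ + blockEnd π hπ b.op ψ :=
  finiteParticle_ext π hπ fun μ => by
    rw [Submodule.coe_add, Submodule.coe_smul, map_add, map_smul, component_blockEnd,
      component_blockEnd, component_blockEnd, SkewFamily.op_add, add_apply,
      SkewFamily.op_smul_apply]

theorem blockEnd_lie (a b : SkewFamily fun μ => chargeSpace π μ) (ψ : finiteParticle π) :
    blockEnd π hπ (⁅a, b⁆ : SkewFamily fun μ => chargeSpace π μ).op ψ =
      blockEnd π hπ a.op (blockEnd π hπ b.op ψ) - blockEnd π hπ b.op (blockEnd π hπ a.op ψ) :=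
  finiteParticle_ext π hπ fun μ => by
    rw [AddSubgroupClass.coe_sub, map_sub]
    simp only [component_blockEnd]
    rw [SkewFamily.op_lie, sub_apply, mul_apply_eq_comp, mul_apply_eq_comp]

end Charge

end ChargeControl

/-! ### Assembly of the theorem -/

open ChargeControl

theorem mainTheorem1 {𝓗 : Type*} [NormedAddCommGroup 𝓗] [InnerProductSpace ℂ 𝓗]
    [CompleteSpace 𝓗] (π : Circle →* unitary (𝓗 →L[ℂ] 𝓗))
    (hπ : ∀ ψ : 𝓗, Continuous fun z => (π z : 𝓗 →L[ℂ] 𝓗) ψ)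
    [∀ μ : ℤ, FiniteDimensional ℂ (chargeSpace π μ)] :
    -- `D_X` is an invariant domain of essential selfadjointness
    (∀ T : 𝓗 →ₗ.[ℂ] 𝓗, IsSelfAdjoint T → CommutesWithCharge π T →
      T.HasCore (finiteParticle π) ∧
        ∀ ψ : T.domain, (ψ : 𝓗) ∈ finiteParticle π → T ψ ∈ finiteParticle π) ∧
    -- restriction of the elements of `𝔲(X)` to `D_X`
    ∃ res : chargeAlgebra π → Module.End ℂ (finiteParticle π),
      (∀ (Q : chargeAlgebra π) (ψ : finiteParticle π),
        ((ψ : 𝓗), (res Q ψ : 𝓗)) ∈ (Q : 𝓗 →ₗ.[ℂ] 𝓗).graph) ∧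
      -- `𝔲(X)` consists exactly of the block diagonal operators with selfadjoint blocks
      (∀ Q : chargeAlgebra π, ∃ h : (μ : ℤ) → chargeSpace π μ →L[ℂ] chargeSpace π μ,
        (∀ μ, IsSelfAdjoint (h μ)) ∧ ∀ ψ : finiteParticle π,
          HasSum (fun μ => Complex.I • (h μ (component π μ ψ) : 𝓗)) (res Q ψ : 𝓗)) ∧
      (∀ h : (μ : ℤ) → chargeSpace π μ →L[ℂ] chargeSpace π μ, (∀ μ, IsSelfAdjoint (h μ)) →
        ∃! Q : chargeAlgebra π, ∀ ψ : finiteParticle π,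
          HasSum (fun μ => Complex.I • (h μ (component π μ ψ) : 𝓗)) (res Q ψ : 𝓗)) ∧
      -- the exponential map is well defined on `𝔲(X)` and is computed block by block
      (∀ Q ∈ chargeAlgebra π, ∃! V : ℝ → unitary (𝓗 →L[ℂ] 𝓗),
        IsUnitaryGroup V ∧ generator V = Q) ∧
      (∀ (Q : chargeAlgebra π) (h : (μ : ℤ) → chargeSpace π μ →L[ℂ] chargeSpace π μ),
        (∀ μ, IsSelfAdjoint (h μ)) →
        (∀ ψ : finiteParticle π,
          HasSum (fun μ => Complex.I • (h μ (component π μ ψ) : 𝓗)) (res Q ψ : 𝓗)) →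
        ∀ ψ : 𝓗, HasSum
          (fun μ => (boundedExp (Complex.I • h μ) (component π μ ψ) : 𝓗))
          ((expOp (Q : 𝓗 →ₗ.[ℂ] 𝓗) : 𝓗 →L[ℂ] 𝓗) ψ)) ∧
      -- it maps `𝔲(X)` onto the strongly closed group `𝒰(X)`
      expOp '' chargeAlgebra π = (chargeGroup π : Set (unitary (𝓗 →L[ℂ] 𝓗))) ∧
      IsClosed[strongTopology 𝓗] (chargeGroup π : Set (unitary (𝓗 →L[ℂ] 𝓗))) ∧
      -- `𝒰(X)` consists exactly of the block diagonal operators with unitary blocks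
      (∀ U ∈ chargeGroup π,
        ∃ u : (μ : ℤ) → unitary (chargeSpace π μ →L[ℂ] chargeSpace π μ), ∀ ψ : 𝓗,
          HasSum (fun μ => ((u μ : chargeSpace π μ →L[ℂ] chargeSpace π μ) (component π μ ψ) : 𝓗))
            ((U : 𝓗 →L[ℂ] 𝓗) ψ)) ∧
      (∀ u : (μ : ℤ) → unitary (chargeSpace π μ →L[ℂ] chargeSpace π μ),
        ∃! U : chargeGroup π, ∀ ψ : 𝓗,
          HasSum (fun μ => ((u μ : chargeSpace π μ →L[ℂ] chargeSpace π μ) (component π μ ψ) : 𝓗))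
            (((U : unitary (𝓗 →L[ℂ] 𝓗)) : 𝓗 →L[ℂ] 𝓗) ψ)) ∧
      -- `𝔲(X)` is a real Lie algebra with the commutator on `D_X` as its bracket
      ∃ (_ : LieRing (chargeAlgebra π)) (_ : LieAlgebra ℝ (chargeAlgebra π)),
        (∀ (a : ℝ) (Q₁ Q₂ : chargeAlgebra π) (ψ : finiteParticle π),
          res (a • Q₁ + Q₂) ψ = (a : ℂ) • res Q₁ ψ + res Q₂ ψ) ∧
        (∀ (Q₁ Q₂ : chargeAlgebra π) (ψ : finiteParticle π),
          res ⁅Q₁, Q₂⁆ ψ = res Q₁ (res Q₂ ψ) - res Q₂ (res Q₁ ψ)) ∧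
        -- the generated Lie algebra exponentiates into, and strongly densely in, the dynamical group
        ∀ (d : ℕ) (Q : Fin d → chargeAlgebra π),
          (∀ A ∈ LieSubalgebra.lieSpan ℝ (chargeAlgebra π) (Set.range Q),
            expOp (A : 𝓗 →ₗ.[ℂ] 𝓗) ∈ dynamicalGroup fun k => (Q k : 𝓗 →ₗ.[ℂ] 𝓗)) ∧
          closure[strongTopology 𝓗]
              ((fun A : chargeAlgebra π => expOp (A : 𝓗 →ₗ.[ℂ] 𝓗)) ''
                (LieSubalgebra.lieSpan ℝ (chargeAlgebra π) (Set.range Q) :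
                  Set (chargeAlgebra π))) =
            (dynamicalGroup fun k => (Q k : 𝓗 →ₗ.[ℂ] 𝓗) : Set (unitary (𝓗 →L[ℂ] 𝓗))) := by
  have hS := chargeSpace_isHilbertSum π hπ
  let e := chargeEquiv π hπ
  -- Restriction to D_X is the action of the block family, and the Lie structure on 𝔲(X) is the one
  -- transported from families of blocks along `e`.
  refine ⟨fun T hsa hT => ⟨hasCore_finiteParticle π hπ hsa hT, apply_mem_finiteParticle π hπ hT⟩,
    fun Q => blockEnd π hπ (e Q).op,
    fun Q ψ => (hasBlocks_chargeEquiv π hπ Q).mem_graph_blockEnd hπ ψ, fun Q => ?_, fun h hh => ?_,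
    fun Q hQ => existsUnique_isUnitaryGroup π hπ hQ, fun Q h hh hs ψ => ?_,
    expOp_image_chargeAlgebra π hπ, isClosed_chargeGroup π, fun U hU => ?_, fun u => ?_,
    e.lieRing, e.lieAlgebra ℝ, ?_, ?_, ?_⟩
  · obtain ⟨T, h, -, hh, -, -, ha⟩ :=
      (hasBlocks_chargeEquiv π hπ Q).exists_selfAdjoint hπ Q.2
    exact ⟨h, hh, (hasSum_blockEnd_iff π hπ _ h).2 ha⟩
  · refine ⟨e.symm (SkewFamily.ofSelfAdjoint h hh), ?_, fun Q hQ => ?_⟩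
    · refine (hasSum_blockEnd_iff π hπ _ h).2 ?_
      rw [Equiv.apply_symm_apply]
      exact SkewFamily.op_ofSelfAdjoint h hh
    · rw [Equiv.eq_symm_apply]
      exact SkewFamily.ext ((hasSum_blockEnd_iff π hπ _ h).1 hQ)
  · rw [hasSum_blockEnd_iff] at hs
    have := hasSum_blockUnitary hS (e Q).exp ψ
    rw [expOp_eq_blockUnitary π hπ]
    simp only [SkewFamily.coe_exp, hs] at this
    exact this
  · rw [← SetLike.mem_coe, ← range_blockUnitary π hπ] at hU
    obtain ⟨u, rfl⟩ := hU
    exact ⟨u, hasSum_blockUnitary hS u⟩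
  · refine ⟨⟨blockUnitary hS u, blockUnitary_mem_chargeGroup π hπ u⟩, hasSum_blockUnitary hS u,
      fun U hU => Subtype.ext (eq_blockUnitary_of_hasSum hS hU)⟩
  · intro a Q₁ Q₂ ψ
    let _ := e.lieRing
    let _ := e.lieAlgebra ℝ
    have h : e (a • Q₁ + Q₂) = a • e Q₁ + e Q₂ := by
      have h1 := (e.lieEquiv ℝ).toLinearEquiv.map_add (a • Q₁) Q₂
      rw [LinearEquiv.map_smul] at h1
      exact h1
    simp only [h]
    exact blockEnd_smul_add π hπ a (e Q₁) (e Q₂) ψ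
  · intro Q₁ Q₂ ψ
    let _ := e.lieRing
    let _ := e.lieAlgebra ℝ
    have h : e ⁅Q₁, Q₂⁆ = ⁅e Q₁, e Q₂⁆ := (e.lieEquiv ℝ).map_lie Q₁ Q₂
    simp only [h]
    exact blockEnd_lie π hπ (e Q₁) (e Q₂) ψ
  · intro d Q
    let _ := e.lieRing
    let _ := e.lieAlgebra ℝ
    let f : chargeAlgebra π ≃ₗ⁅ℝ⁆ SkewFamily fun μ => chargeSpace π μ := e.lieEquiv ℝ
    -- As an isomorphism of Lie algebras, `e` carries the generated subalgebra onto the one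
    -- generated by the block families.
    have hspan : (LieSubalgebra.lieSpan ℝ _ (Set.range Q)).map (f : _ →ₗ⁅ℝ⁆ _) =
        LieSubalgebra.lieSpan ℝ _ (Set.range fun k => e (Q k)) := by
      rw [LieSubalgebra.map_lieSpan, ← Set.range_comp]
      rfl
    have hexp : ∀ k, expGroup (Q k : 𝓗 →ₗ.[ℂ] 𝓗) = blockGroup hS (e (Q k)) :=
      fun k => expGroup_eq_blockGroup π hπ (Q k)
    constructor
    · intro A hA
      rw [expOp_eq_blockUnitary π hπ]
      refine blockUnitary_exp_mem_dynamicalGroup hS hexp ?_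
      rw [← hspan]
      exact ⟨A, hA, rfl⟩
    · have himage : (((LieSubalgebra.lieSpan ℝ _ (Set.range Q)).map (f : _ →ₗ⁅ℝ⁆ _) :
          LieSubalgebra ℝ (SkewFamily fun μ => chargeSpace π μ)) : Set _) =
          e '' (LieSubalgebra.lieSpan ℝ _ (Set.range Q)) := rfl
      rw [← closure_blockUnitary_exp_eq_dynamicalGroup hS
        (by rw [range_blockUnitary π hπ]; exact isClosed_chargeGroup π) hexp, ← hspan,
        himage, Set.image_image]
      simp only [expOp_eq_blockUnitary π hπ]
      rfl
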